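/- **Theorem (Fixed point of the coarse-grained master equation).** There is a universal constant $C$ such that the following holds. *Setting.* Let $d\ge 1$, let $H$ be a Hermitian $d\times d$ matrix, $\beta>0$, $T>0$, and write $A(t)=e^{iHt}Ae^{-iHt}$ and $\rho_\beta=e^{-\beta H}/\operatorname{Tr}e^{-\beta H}$. Let $(A^a)_{a}$ be a finite family of $d\times d$ matrices that is closed under adjoints (counted with multiplicity: there is a permutation $\pi$ of the index set with $A^{\pi(a)}=A^{a\dagger}$ for all $a$) and satisfies $\|\sum_a A^{a\dagger}A^a\|\le 1$ in operator norm. Let $\gamma:\mathbb R\to[0,1]$ satisfy $\gamma(\omega)=e^{-\beta\omega}\gamma(-\omega)$ for all $\omega$, and suppose that its inverse Fourier transform $c(t)=\frac1{\sqrt{2\pi}}\int_{-\infty}^{\infty}\gamma(\omega)e^{i\omega t}\,d\omega$ is integrable with $\|c\|_1\le\sqrt{2\pi}$ (if $\gamma$ is not integrable, this means: $c\in L^1(\mathbb R)$ and $\gamma(\omega)=\frac1{\sqrt{2\pi}}\int c(t)e^{-i\omega t}\,dt$ for almost every $\omega$). Put $$\hat A^a(\omega)=\frac{1}{\sqrt{2\pi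 T}}\int_{-T/2}^{T/2}e^{-i\omega t}A^a(t)\,dt,$$ $$H_{LS}=\sum_a\frac{i}{2\sqrt{2\pi}\,T}\int_{-T/2}^{T/2}\int_{-T/2}^{T/2}\operatorname{sgn}(t_1-t_2)\,c(t_2-t_1)\,A^{a\dagger}(t_2)A^a(t_1)\,dt_2\,dt_1,$$ $$\mathcal L_{diss}[\rho]=\sum_a\int_{-\infty}^{\infty}\gamma(\omega)\Big(\hat A^a(\omega)\rho\hat A^a(\omega)^\dagger-\tfrac12\{\hat A^a(\omega)^\dagger\hat A^a(\omega),\rho\}\Big)d\omega,\qquad \mathcal L_{CGME}[\rho]=-i[H_{LS},\rho]+\mathcal L_{diss}[\rho].$$ For a generator $\mathcal L$ let $t_{mix}(\mathcal L)\in[0,\infty]$ be the shortest time $t\ge0$ such that $\|e^{\mathcal Lt}[\rho-\rho']\|_1\le\frac12\|\rho-\rho'\|_1$ for all density matrices $\rho,\rho'$ (and $\infty$ if there is none), where $\|\cdot\|_1$ is the trace norm. *Conclusion.* If $t_{mix}(\mathcal L_{CGME})<\infty$, then $\mathcal L_{CGME}$ has exactly one fixed point $\rho_{fix}(\mathcal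 L_{CGME})$ among the density matrices. Every density matrix $\sigma$ with $\mathcal L_{CGME}[\sigma]=0$ satisfies $$\|\sigma-\rho_\beta\|_1\le C\,\sqrt{\frac{\beta}{T}}\,\big(t_{mix}(\mathcal L_{CGME})+t_{mix}(\mathcal L_{diss})\big),$$ where the right-hand side is read as $+\infty$ when one of the mixing times is infinite. -/

import Mathlib

open scoped Matrix NNReal ENNReal ComplexOrder Matrix.Norms.L2Operator

noncomputable section

namespace CGME

/-- Complex `d × d` matrices. The norm on them is the operator norm (spectral norm) with respect to
the Euclidean norm on `ℂ^d`. -/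
abbrev Mat (d : ℕ) : Type := Matrix (Fin d) (Fin d) ℂ

/-- Superoperators: linear maps on `d × d` matrices (continuous, as is automatic here), a Banach
algebra in which exponentials and integrals are taken. -/
abbrev SuperOp (d : ℕ) : Type := Mat d →L[ℂ] Mat d

/-- The trace norm `‖X‖₁ = Tr |X|`: the sum of the singular values of `X`. -/
def traceNorm {d : ℕ} (X : Mat d) : ℝ :=
  ∑ i, √((Matrix.isHermitian_conjTranspose_mul_self X).eigenvalues i)

/-- Quantum states (density matrices). -/
def IsState {d : ℕ} (ρ : Mat d) : Prop :=
  ρ.PosSemidef ∧ ρ.trace = 1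

/-- The Gibbs state `exp(-βH) / Tr exp(-βH)`. -/
def gibbs {d : ℕ} (β : ℝ) (H : Mat d) : Mat d :=
  (Matrix.trace (NormedSpace.exp ((-β : ℂ) • H)))⁻¹ • NormedSpace.exp ((-β : ℂ) • H)

/-- Heisenberg evolution `A(t) = exp(iHt) A exp(-iHt)`. -/
def heis {d : ℕ} (H A : Mat d) (t : ℝ) : Mat d :=
  NormedSpace.exp ((Complex.I * t) • H) * A * NormedSpace.exp ((-(Complex.I * t)) • H)

/-- The operator Fourier transform of `A` over the time window `[-T/2, T/2]`,
`Â(ω) = (2πT)^(-1/2) ∫_{-T/2}^{T/2} exp(-iωt) A(t) dt`, that is, with the real, `L²`-normalized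
weight function `f = T^(-1/2) 1_{[-T/2, T/2]}`. -/
def opFourier {d : ℕ} (T : ℝ) (H A : Mat d) (ω : ℝ) : Mat d :=
  (((√(2 * Real.pi * T))⁻¹ : ℝ) : ℂ) •
    ∫ t in (-(T / 2))..(T / 2), Complex.exp (-(Complex.I * ω * t)) • heis H A t

/-- The superoperator `ρ ↦ K ρ L`. -/
def sandwich {d : ℕ} (K L : Mat d) : SuperOp d :=
  ContinuousLinearMap.mulLeftRight ℂ (Mat d) K L

/-- The dissipator `ρ ↦ K ρ K† - (1/2) {K† K, ρ}`. -/
def dissipator {d : ℕ} (K : Mat d) : SuperOp d :=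
  sandwich K Kᴴ - (1 / 2 : ℂ) • (sandwich (Kᴴ * K) 1 + sandwich 1 (Kᴴ * K))

/-- The unitary generator `ρ ↦ -i [G, ρ]`. -/
def hamiltonianPart {d : ℕ} (G : Mat d) : SuperOp d :=
  (-Complex.I) • (sandwich G 1 - sandwich 1 G)

/-- `c` is the (unitary) inverse Fourier transform `c(t) = (2π)^(-1/2) ∫ γ(ω) exp(iωt) dω` of `γ`,
and is integrable. The relation is written in the inverted form
`γ(ω) = (2π)^(-1/2) ∫ c(t) exp(-iωt) dt` for almost every `ω`: this determines `c` up to a null set,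
and also makes sense when `γ` is not integrable. For integrable `γ` and `c` it is implied by the
first formula, as shown below. -/
def IsInverseFourier (γ : ℝ → ℝ) (c : ℝ → ℂ) : Prop :=
  MeasureTheory.Integrable c ∧
    ∀ᵐ ω : ℝ, (γ ω : ℂ) =
      (((√(2 * Real.pi))⁻¹ : ℝ) : ℂ) * ∫ t : ℝ, c t * Complex.exp (-(Complex.I * ω * t))

open FourierTransform MeasureTheory in
/-- Inversion almost everywhere: if `h` and its inverse Fourier integral are integrable. -/
theorem ae_eq_fourier_fourierInv {h : ℝ → ℂ} (hh : Integrable h) (hi : Integrable (𝓕⁻ h)) :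
    ∀ᵐ x : ℝ, h x = 𝓕 (𝓕⁻ h) x := by
  have flip : ∀ f g : ℝ → ℂ, Integrable f → Integrable g →
      ∫ x, 𝓕 f x * g x = ∫ x, f x * 𝓕 g x := by
    intro f g hf hg
    simpa using! VectorFourier.integral_bilin_fourierIntegral_eq_flip (ContinuousLinearMap.mul ℂ ℂ)
      (L := innerₗ ℝ) Real.continuous_fourierChar continuous_inner hf hg
  have hcont : Continuous (𝓕 (𝓕⁻ h)) :=
    VectorFourier.fourierIntegral_continuous Real.continuous_fourierChar
      (L := innerₗ ℝ) continuous_inner hi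
  refine ae_eq_of_integral_contDiff_smul_eq hh.locallyIntegrable hcont.locallyIntegrable ?_
  intro g hg hgs
  let φ : SchwartzMap ℝ ℂ := (hgs.comp_left (g := ((↑) : ℝ → ℂ)) (by simp)).toSchwartzMap
    (Complex.ofRealCLM.contDiff.comp hg)
  have hφ : ∀ x, φ x = (g x : ℂ) := fun x => rfl
  have e1 : ∀ x, 𝓕 (φ : ℝ → ℂ) x = (𝓕 φ) x := fun x => by
    rw [SchwartzMap.fourier_coe]
  have e3 : ∫ x, 𝓕⁻ h x * (𝓕 φ) x = ∫ x, h x * φ x := by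
    have hneg : Integrable (fun x => h (-x)) := hh.comp_neg
    have e4 : (𝓕⁻ h) = 𝓕 (fun x => h (-x)) := by
      rw [Real.fourierInv_eq_fourier_comp_neg]
    rw [e4, flip _ _ hneg (𝓕 φ).integrable]
    rw [← integral_neg_eq_self]
    simp only [neg_neg]
    refine integral_congr_ae (Filter.Eventually.of_forall fun x => ?_)
    simp only
    rw [← Real.fourierInv_eq_fourier_neg, ← SchwartzMap.fourierInv_coe,
      FourierTransform.fourierInv_fourier_eq]
  calc ∫ x, g x • h x = ∫ x, h x * φ x := by simp [hφ, mul_comm]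
    _ = ∫ x, 𝓕⁻ h x * 𝓕 (φ : ℝ → ℂ) x := by rw [← e3]; simp only [e1]
    _ = ∫ x, 𝓕 (𝓕⁻ h) x * φ x := (flip _ _ hi φ.integrable).symm
    _ = ∫ x, g x • 𝓕 (𝓕⁻ h) x := by simp [hφ, mul_comm]

open FourierTransform MeasureTheory in
/-- For integrable `γ` whose inverse Fourier transform, given by the usual integral, is integrable,
the relation `IsInverseFourier` holds. -/
theorem isInverseFourier_of_integrable {γ : ℝ → ℝ} {c : ℝ → ℂ} (hγ : Integrable γ)
    (hc : Integrable c)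
    (h : ∀ t : ℝ, c t = (((√(2 * Real.pi))⁻¹ : ℝ) : ℂ) *
      ∫ ω : ℝ, (γ ω : ℂ) * Complex.exp (Complex.I * ω * t)) :
    IsInverseFourier γ c := by
  have hpi : (0 : ℝ) < 2 * Real.pi := by positivity
  have hsq : (((√(2 * Real.pi))⁻¹ : ℝ) : ℂ) * (((√(2 * Real.pi))⁻¹ : ℝ) : ℂ) *
      ((2 * Real.pi : ℝ) : ℂ) = 1 := by
    norm_cast
    rw [← mul_inv, Real.mul_self_sqrt hpi.le, inv_mul_cancel₀ hpi.ne']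
  have hs0 : (((√(2 * Real.pi))⁻¹ : ℝ) : ℂ) ≠ 0 := by
    norm_cast; positivity
  have hc' : ∀ u : ℝ, c (2 * Real.pi * u) =
      (((√(2 * Real.pi))⁻¹ : ℝ) : ℂ) * 𝓕⁻ (fun ω => (γ ω : ℂ)) u := by
    intro u
    rw [h, Real.fourierInv_eq']
    congr 1
    refine integral_congr_ae (Filter.Eventually.of_forall fun x => ?_)
    simp only [smul_eq_mul]
    rw [mul_comm]
    congr 2
    simp
    ring
  have hscaled : Integrable (fun u : ℝ => c (2 * Real.pi * u)) := hc.comp_mul_left' hpi.ne'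
  have hi : Integrable (𝓕⁻ (fun ω => (γ ω : ℂ))) := by
    have := hscaled.const_mul ((((√(2 * Real.pi))⁻¹ : ℝ) : ℂ)⁻¹)
    refine this.congr (Filter.Eventually.of_forall fun u => ?_)
    simp only [hc']
    rw [inv_mul_cancel_left₀ hs0]
  refine ⟨hc, ?_⟩
  filter_upwards [ae_eq_fourier_fourierInv hγ.ofReal hi] with ω hω
  have key : ∫ t : ℝ, c t * Complex.exp (-(Complex.I * ω * t)) =
      ((2 * Real.pi : ℝ) : ℂ) * ∫ u : ℝ, c (2 * Real.pi * u) *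
        Complex.exp (-(Complex.I * ω * ((2 * Real.pi * u : ℝ) : ℂ))) := by
    have := Measure.integral_comp_mul_left
      (fun t : ℝ => c t * Complex.exp (-(Complex.I * ω * t))) (2 * Real.pi)
    rw [this, abs_of_pos (inv_pos.mpr hpi), Complex.real_smul, ← mul_assoc]
    norm_cast
    rw [mul_inv_cancel₀ hpi.ne']; simp
  rw [key]
  simp only [hc']
  have : (γ ω : ℂ) = 𝓕 (𝓕⁻ (fun ω => (γ ω : ℂ))) ω := hω
  rw [this, Real.fourier_eq']
  simp only [mul_assoc]
  rw [integral_const_mul]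
  have hcancel : ∀ X : ℂ, (((√(2 * Real.pi))⁻¹ : ℝ) : ℂ) * (((2 * Real.pi : ℝ) : ℂ) *
      ((((√(2 * Real.pi))⁻¹ : ℝ) : ℂ) * X)) = X := fun X => by
    linear_combination X * hsq
  rw [hcancel]
  refine integral_congr_ae (Filter.Eventually.of_forall fun x => ?_)
  simp only [smul_eq_mul]
  rw [mul_comm]
  congr 2
  simp
  ring

/-- The Lamb-shift Hamiltonian
`∑_a i / (2 √(2π) T) ∫∫_{[-T/2, T/2]²} sgn(t₁ - t₂) c(t₂ - t₁) A^a(t₂)† A^a(t₁) dt₂ dt₁`. -/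
def lambShift {d m : ℕ} (T : ℝ) (H : Mat d) (A : Fin m → Mat d) (c : ℝ → ℂ) : Mat d :=
  ∑ a, (Complex.I / (2 * √(2 * Real.pi) * T : ℝ)) •
    ∫ t₁ in (-(T / 2))..(T / 2), ∫ t₂ in (-(T / 2))..(T / 2),
      ((Real.sign (t₁ - t₂) : ℂ) * c (t₂ - t₁)) • (heis H (A a)ᴴ t₂ * heis H (A a) t₁)

/-- The dissipative part `∑_a ∫ γ(ω) (Â^a(ω) ρ Â^a(ω)† - (1/2) {Â^a(ω)† Â^a(ω), ρ}) dω` of the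
coarse-grained master equation. -/
def dissGenerator {d m : ℕ} (T : ℝ) (H : Mat d) (A : Fin m → Mat d) (γ : ℝ → ℝ) : SuperOp d :=
  ∑ a, ∫ ω : ℝ, (γ ω : ℂ) • dissipator (opFourier T H (A a) ω)

/-- The full generator of the coarse-grained master equation: Lamb shift and dissipative part. -/
def cgmeGenerator {d m : ℕ} (T : ℝ) (H : Mat d) (A : Fin m → Mat d) (γ : ℝ → ℝ) (c : ℝ → ℂ) :
    SuperOp d :=
  hamiltonianPart (lambShift T H A c) + dissGenerator T H A γ

/-- After time `t`, the semigroup `exp(tL)` has halved the trace distance of any two states. -/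
def MixedAt {d : ℕ} (L : SuperOp d) (t : ℝ≥0) : Prop :=
  ∀ ρ ρ' : Mat d, IsState ρ → IsState ρ' →
    traceNorm (NormedSpace.exp (((t : ℝ) : ℂ) • L) (ρ - ρ')) ≤ (1 / 2) * traceNorm (ρ - ρ')

/-- The mixing time: the shortest time `t ≥ 0` at which `exp(tL)` has halved the trace distance of
any two states (`∞` if there is no such time). -/
def mixingTime {d : ℕ} (L : SuperOp d) : ℝ≥0∞ :=
  ⨅ (t : ℝ≥0) (_ : MixedAt L t), (t : ℝ≥0∞)

/-- `σ` is a state that is a fixed point of the semigroup generated by `L`. -/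
def IsFixedState {d : ℕ} (L : SuperOp d) (σ : Mat d) : Prop :=
  IsState σ ∧ L σ = 0

end CGME

end

/-! Write `L` for the full generator and `ρ` for the Gibbs state. Two facts suffice: the semigroup
of `L` contracts the trace norm, and `‖L ρ‖₁ ≤ 13 √(β/T)`. If `σ` is a fixed state and `exp(tL)`
halves distances of states, then `‖σ - ρ‖₁ ≤ ‖exp(tL)(σ - ρ)‖₁ + ‖exp(tL) ρ - ρ‖₁ ≤ ½ ‖σ - ρ‖₁ + t
‖L ρ‖₁`, so `C = 26` works (`IsLindbladian.traceNorm_sub_le`). A unique fixed state exists because a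
power iteration of a mixing map is Cauchy.

Contractivity. `L` has the form `X ↦ J X + G X + X G†` with `J` completely positive. A matrix
factors as `X = B C†` with both squared Hilbert–Schmidt norms equal to `‖X‖₁`, and Cauchy–Schwarz
then bounds an Euler step by the traces of its values at `B B†` and `C C†`, which are preserved. The
error is quadratic in the step, so it disappears in the limit. Of complete positivity only
`TraceDominated` is used; it passes to sums and integrals.

Dissipative part. Let `S = √ρ`, let `K = Â(ω)` be a jump operator and `D = K S - exp(βω/2) S K`. In
the energy basis an entry of `D` carries `q_k - exp(βω/2) q_j`, which vanishes at the Bohr frequency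
`ν = E_j - E_k`, times the window transform, which is at most of order `T^(-1/2) / |ω - ν|`.
Weighted with `γ`, the square is below a Lorentzian with integral of order `β/T`
(`sum_integral_balanceDefect_le`). Applied to `S²`, the dissipator is gain minus loss plus terms
containing a factor `D`. Gain and loss cancel after `ω ↦ -ω`, `a ↦ π a`, by detailed balance. The
remaining terms are estimated by a weighted Cauchy–Schwarz inequality, with Plancherel bounding the
other factor.

Lamb shift. Heisenberg evolution of the Lamb shift `Λ` translates its square time window, so only
strips at the ends change and `‖[H, Λ]‖ ≤ 2/T`. Therefore `[Λ, ρ]` is of order `β/T`, which is at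
most `√(β/T)` when `β ≤ T`; for `β > T` the bound `‖Λ‖ ≤ ½` is enough. -/

noncomputable section

namespace CGME

/-! ### Hilbert–Schmidt norm, trace norm, and states. -/

variable {d : ℕ}

/-- The squared Hilbert–Schmidt norm. -/
def hsSq (M : Mat d) : ℝ := ∑ i, ∑ j, ‖M i j‖ ^ 2

theorem hsSq_nonneg (M : Mat d) : 0 ≤ hsSq M := by unfold hsSq; positivity

theorem hsSq_conjTranspose (M : Mat d) : hsSq Mᴴ = hsSq M := by
  unfold hsSq
  rw [Finset.sum_comm]
  simp

theorem trace_conjTranspose_mul_self (M : Mat d) : (Mᴴ * M).trace = (hsSq M : ℂ) := by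
  unfold hsSq
  rw [Finset.sum_comm]
  simp only [Matrix.trace, Matrix.diag_apply, Matrix.mul_apply, Matrix.conjTranspose_apply]
  push_cast
  refine Finset.sum_congr rfl fun j _ => Finset.sum_congr rfl fun i _ => ?_
  exact Complex.conj_mul' _

theorem trace_mul_conjTranspose_self (M : Mat d) : (M * Mᴴ).trace = (hsSq M : ℂ) := by
  rw [Matrix.trace_mul_comm, trace_conjTranspose_mul_self]

/-- Cauchy–Schwarz for the Hilbert–Schmidt inner product. -/
theorem norm_trace_conjTranspose_mul_le (A B : Mat d) :
    ‖(Aᴴ * B).trace‖ ≤ √(hsSq A) * √(hsSq B) := by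
  simp only [Matrix.trace, Matrix.diag_apply, Matrix.mul_apply, Matrix.conjTranspose_apply]
  have key := Real.sum_mul_le_sqrt_mul_sqrt (Finset.univ : Finset (Fin d × Fin d))
    (fun p => ‖A p.2 p.1‖) (fun p => ‖B p.2 p.1‖)
  rw [Fintype.sum_prod_type, Fintype.sum_prod_type, Fintype.sum_prod_type] at key
  have hsw : ∀ M : Mat d, hsSq M = ∑ j, ∑ i, ‖M i j‖ ^ 2 := fun M => Finset.sum_comm
  rw [hsw A, hsw B]
  refine le_trans ?_ key
  refine (norm_sum_le _ _).trans (Finset.sum_le_sum fun j _ => ?_)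
  refine (norm_sum_le _ _).trans (Finset.sum_le_sum fun i _ => ?_)
  simp

theorem norm_trace_mul_le_sqrt (A B : Mat d) :
    ‖(A * B).trace‖ ≤ √(hsSq A) * √(hsSq B) := by
  have := norm_trace_conjTranspose_mul_le Aᴴ B
  rwa [Matrix.conjTranspose_conjTranspose, hsSq_conjTranspose] at this

theorem norm_trace_mul_le_half (A B : Mat d) :
    ‖(A * B).trace‖ ≤ (1 / 2) * (hsSq A + hsSq B) := by
  refine (norm_trace_mul_le_sqrt A B).trans ?_
  nlinarith [sq_nonneg (√(hsSq A) - √(hsSq B)), Real.sq_sqrt (hsSq_nonneg A),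
    Real.sq_sqrt (hsSq_nonneg B)]

theorem hsSq_mul_le (U M : Mat d) : hsSq (U * M) ≤ ‖U‖ ^ 2 * hsSq M := by
  unfold hsSq
  rw [Finset.sum_comm, Finset.sum_comm (f := fun i j => ‖M i j‖ ^ 2), Finset.mul_sum]
  refine Finset.sum_le_sum fun j _ => ?_
  have h := Matrix.l2_opNorm_mulVec U (WithLp.toLp 2 (fun i => M i j))
  have h2 := pow_le_pow_left₀ (norm_nonneg _) h 2
  rw [mul_pow, EuclideanSpace.norm_sq_eq, EuclideanSpace.norm_sq_eq] at h2
  simpa [Matrix.mul_apply, Matrix.mulVec, dotProduct] using! h2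

theorem hsSq_mul_le' (M U : Mat d) : hsSq (M * U) ≤ ‖U‖ ^ 2 * hsSq M := by
  have := hsSq_mul_le Uᴴ Mᴴ
  rwa [← Matrix.conjTranspose_mul, hsSq_conjTranspose, hsSq_conjTranspose,
    Matrix.l2_opNorm_conjTranspose] at this

theorem norm_one_le : ‖(1 : Mat d)‖ ≤ 1 := by
  rw [← Matrix.diagonal_one, Matrix.l2_opNorm_diagonal]
  exact (pi_norm_le_iff_of_nonneg zero_le_one).2 fun i => by simp

theorem norm_le_one_of_isometry {V : Mat d} (h : Vᴴ * V = 1) : ‖V‖ ≤ 1 := by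
  have := Matrix.l2_opNorm_conjTranspose_mul_self V
  rw [h] at this
  nlinarith [norm_one_le (d := d), norm_nonneg V]

theorem hsSq_isometry_mul {V : Mat d} (h : Vᴴ * V = 1) (M : Mat d) : hsSq (V * M) = hsSq M := by
  have : ((hsSq (V * M) : ℝ) : ℂ) = hsSq M := by
    rw [← trace_conjTranspose_mul_self, ← trace_conjTranspose_mul_self, Matrix.conjTranspose_mul,
      Matrix.mul_assoc, ← Matrix.mul_assoc Vᴴ, h, Matrix.one_mul]
  exact_mod_cast this

theorem hsSq_mul_coisometry {V : Mat d} (h : V * Vᴴ = 1) (M : Mat d) : hsSq (M * V) = hsSq M := by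
  have := hsSq_isometry_mul (V := Vᴴ) (by simpa using h) Mᴴ
  rwa [← Matrix.conjTranspose_mul, hsSq_conjTranspose, hsSq_conjTranspose] at this

/-- The sum is the trace of `Zᴴ N Z`, so only the norm of `N = ∑ Aᴴ A` enters and not the number of
operators. -/
theorem sum_hsSq_mul_le {ι : Type*} [Fintype ι] (A : ι → Mat d) (Z : Mat d) :
    ∑ a, hsSq (A a * Z) ≤ ‖∑ a, (A a)ᴴ * A a‖ * hsSq Z := by
  set N := ∑ a, (A a)ᴴ * A a
  have h : ((∑ a, hsSq (A a * Z) : ℝ) : ℂ) = (Zᴴ * (N * Z)).trace := by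
    push_cast
    simp only [← trace_conjTranspose_mul_self, N, Matrix.sum_mul, Matrix.mul_sum,
      Matrix.trace_sum, Matrix.conjTranspose_mul, Matrix.mul_assoc]
  have h2 : ∑ a, hsSq (A a * Z) ≤ ‖(Zᴴ * (N * Z)).trace‖ := by
    rw [← h, Complex.norm_real]; exact le_abs_self _
  refine h2.trans ((norm_trace_conjTranspose_mul_le _ _).trans ?_)
  have h3 : √(hsSq (N * Z)) ≤ ‖N‖ * √(hsSq Z) := by
    rw [Real.sqrt_le_left (by positivity), mul_pow, Real.sq_sqrt (hsSq_nonneg _)]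
    exact hsSq_mul_le _ _
  calc √(hsSq Z) * √(hsSq (N * Z)) ≤ √(hsSq Z) * (‖N‖ * √(hsSq Z)) := by gcongr
    _ = ‖N‖ * (√(hsSq Z) * √(hsSq Z)) := by ring
    _ = _ := by rw [Real.mul_self_sqrt (hsSq_nonneg _)]

theorem hsSq_eq_zero {M : Mat d} (h : hsSq M = 0) : M = 0 := by
  unfold hsSq at h
  ext i j
  rw [Finset.sum_eq_zero_iff_of_nonneg (fun _ _ => by positivity)] at h
  have := h i (Finset.mem_univ _)
  rw [Finset.sum_eq_zero_iff_of_nonneg (fun _ _ => by positivity)] at this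
  simpa using this j (Finset.mem_univ _)

theorem unitary_mul_diagonal_mul {A : Mat d} (hA : A.IsHermitian) :
    ∃ V : Mat d, Vᴴ * V = 1 ∧ V * Vᴴ = 1 ∧
      A = V * Matrix.diagonal (fun i => (hA.eigenvalues i : ℂ)) * Vᴴ := by
  refine ⟨hA.eigenvectorUnitary, Unitary.coe_star_mul_self _, Unitary.coe_mul_star_self _, ?_⟩
  conv_lhs => rw [hA.spectral_theorem, Unitary.conjStarAlgAut_apply]
  rfl

/-- Singular values and right singular vectors. -/
theorem exists_singular (X : Mat d) : ∃ (V : Mat d) (s : Fin d → ℝ), Vᴴ * V = 1 ∧ V * Vᴴ = 1 ∧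
    (∀ i, 0 ≤ s i) ∧ ∑ i, s i = traceNorm X ∧
    (X * V)ᴴ * (X * V) = Matrix.diagonal (fun i => ((s i) ^ 2 : ℂ)) := by
  obtain ⟨V, h1, h2, h3⟩ := unitary_mul_diagonal_mul (Matrix.isHermitian_conjTranspose_mul_self X)
  refine ⟨V, fun i => √((Matrix.isHermitian_conjTranspose_mul_self X).eigenvalues i), h1, h2,
    fun i => Real.sqrt_nonneg _, rfl, ?_⟩
  have h0 : ∀ i, (((√((Matrix.isHermitian_conjTranspose_mul_self X).eigenvalues i) : ℝ) : ℂ)) ^ 2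
      = (Matrix.isHermitian_conjTranspose_mul_self X).eigenvalues i := fun i => by
    rw [← Complex.ofReal_pow, Real.sq_sqrt]
    exact (Matrix.posSemidef_conjTranspose_mul_self X).eigenvalues_nonneg i
  simp only [h0]
  have : (X * V)ᴴ * (X * V) = Vᴴ * (Xᴴ * X) * V := by
    simp only [Matrix.conjTranspose_mul, Matrix.mul_assoc]
  have h4 : Vᴴ * (Xᴴ * X) * V = Vᴴ * (V * Matrix.diagonal (fun i =>
        ((Matrix.isHermitian_conjTranspose_mul_self X).eigenvalues i : ℂ)) * Vᴴ) * V :=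
    congrArg (fun M => Vᴴ * M * V) h3
  rw [this, h4]
  calc _ = (Vᴴ * V) * Matrix.diagonal (fun i =>
        ((Matrix.isHermitian_conjTranspose_mul_self X).eigenvalues i : ℂ)) * (Vᴴ * V) := by
        simp only [Matrix.mul_assoc]
    _ = _ := by rw [h1, Matrix.one_mul, Matrix.mul_one]

theorem traceNorm_nonneg (X : Mat d) : 0 ≤ traceNorm X :=
  Finset.sum_nonneg fun _ _ => Real.sqrt_nonneg _

/-- Factorization of a matrix into two Hilbert–Schmidt factors, optimal for the trace norm. -/
theorem exists_factor (X : Mat d) :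
    ∃ B C : Mat d, X = B * Cᴴ ∧ hsSq B = traceNorm X ∧ hsSq C = traceNorm X := by
  obtain ⟨V, s, h1, h2, hs, hsum, hX⟩ := exists_singular X
  set r : Fin d → ℝ := fun i => √(s i)
  have hr : ∀ i, (r i) ^ 2 = s i := fun i => Real.sq_sqrt (hs i)
  let D : Mat d := Matrix.diagonal (fun i => (r i : ℂ))
  -- By the convention `0⁻¹ = 0` this is the pseudo-inverse of `D`. Nothing is lost, because the
  -- columns of `X V` belonging to zero singular values vanish.
  let D' : Mat d := Matrix.diagonal (fun i => ((r i)⁻¹ : ℂ))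
  have hD : Dᴴ = D := by simp [D, Matrix.diagonal_conjTranspose]
  have hD' : D'ᴴ = D' := by simp [D', Matrix.diagonal_conjTranspose]
  have hrr : ∀ i, (r i : ℂ) ^ 2 = s i := fun i => by exact_mod_cast hr i
  refine ⟨X * V * D', V * D, ?_, ?_, ?_⟩
  · have hP : X * V * (D' * D) = X * V := by
      have : hsSq (X * V * (D' * D) - X * V) = 0 := by
        have e : X * V * (D' * D) - X * V = X * V * (D' * D - 1) := by
          rw [Matrix.mul_sub, Matrix.mul_one]
        have : ((hsSq (X * V * (D' * D) - X * V) : ℝ) : ℂ) = 0 := by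
          rw [e, ← trace_conjTranspose_mul_self, Matrix.conjTranspose_mul, Matrix.mul_assoc,
            ← Matrix.mul_assoc (X * V)ᴴ, hX]
          have e2 : D' * D - 1 = Matrix.diagonal (fun i => ((r i : ℂ)⁻¹ * r i - 1 : ℂ)) := by
            rw [← Matrix.diagonal_one, Matrix.diagonal_mul_diagonal, Matrix.diagonal_sub]
          rw [e2, Matrix.diagonal_conjTranspose, Matrix.diagonal_mul_diagonal,
            Matrix.diagonal_mul_diagonal, Matrix.trace_diagonal]
          refine Finset.sum_eq_zero fun i _ => ?_
          by_cases h : r i = 0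
          · have : s i = 0 := by rw [← hr, h]; simp
            simp [this]
          · have : (r i : ℂ) ≠ 0 := by exact_mod_cast h
            simp [this]
        exact_mod_cast this
      exact sub_eq_zero.1 (hsSq_eq_zero this)
    rw [Matrix.conjTranspose_mul, hD]
    calc X = X * (V * Vᴴ) := by rw [h2, Matrix.mul_one]
      _ = X * V * (D' * D) * Vᴴ := by rw [hP, Matrix.mul_assoc]
      _ = _ := by simp only [Matrix.mul_assoc]
  · have : ((hsSq (X * V * D') : ℝ) : ℂ) = traceNorm X := by
      rw [← trace_conjTranspose_mul_self, Matrix.conjTranspose_mul, Matrix.mul_assoc,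
            ← Matrix.mul_assoc (X * V)ᴴ, hX, hD', Matrix.diagonal_mul_diagonal,
            Matrix.diagonal_mul_diagonal, Matrix.trace_diagonal, ← hsum]
      push_cast
      refine Finset.sum_congr rfl fun i _ => ?_
      by_cases h : r i = 0
      · have : s i = 0 := by rw [← hr, h]; simp
        simp [this]
      · have : (r i : ℂ) ≠ 0 := by exact_mod_cast h
        rw [← hrr]; field_simp
    exact_mod_cast this
  · have : ((hsSq (V * D) : ℝ) : ℂ) = traceNorm X := by
      rw [hsSq_isometry_mul h1, ← trace_conjTranspose_mul_self, hD, Matrix.diagonal_mul_diagonal,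
        Matrix.trace_diagonal, ← hsum]
      push_cast
      exact Finset.sum_congr rfl fun i _ => by rw [← hrr]; ring
    exact_mod_cast this

/-- The trace norm is attained by pairing with a contraction. -/
theorem exists_trace_mul_eq_traceNorm (X : Mat d) :
    ∃ U : Mat d, ‖U‖ ≤ 1 ∧ (U * X).trace = (traceNorm X : ℂ) := by
  obtain ⟨V, s, h1, h2, hs, hsum, hX⟩ := exists_singular X
  let D : Mat d := Matrix.diagonal (fun i => ((s i)⁻¹ : ℂ))
  have hD : Dᴴ = D := by simp [D, Matrix.diagonal_conjTranspose]
  have hVn := norm_le_one_of_isometry h1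
  have hVn' : ‖Vᴴ‖ ≤ 1 := by rwa [Matrix.l2_opNorm_conjTranspose]
  have hmul : ∀ A B : Mat d, ‖A‖ ≤ 1 → ‖B‖ ≤ 1 → ‖A * B‖ ≤ 1 := fun A B hA hB =>
    (norm_mul_le A B).trans (mul_le_one₀ hA (norm_nonneg _) hB)
  -- The adjoint of the partial isometry in the polar decomposition of `X`, again with `0⁻¹ = 0`.
  refine ⟨V * D * (X * V)ᴴ, ?_, ?_⟩
  · rw [← Matrix.l2_opNorm_conjTranspose]
    have e := Matrix.l2_opNorm_conjTranspose_mul_self (V * D * (X * V)ᴴ)ᴴ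
    have e2 : (V * D * (X * V)ᴴ)ᴴᴴ * (V * D * (X * V)ᴴ)ᴴ =
        V * (D * ((X * V)ᴴ * (X * V)) * D) * Vᴴ := by
      simp only [Matrix.conjTranspose_mul, Matrix.conjTranspose_conjTranspose, Matrix.mul_assoc, hD]
    have e3 : ‖D * ((X * V)ᴴ * (X * V)) * D‖ ≤ 1 := by
      rw [hX, Matrix.diagonal_mul_diagonal, Matrix.diagonal_mul_diagonal,
        Matrix.l2_opNorm_diagonal]
      refine (pi_norm_le_iff_of_nonneg zero_le_one).2 fun i => ?_
      by_cases h : s i = 0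
      · simp [h]
      · have : (s i : ℂ) ≠ 0 := by exact_mod_cast h
        have : ((s i : ℂ)⁻¹ * (s i : ℂ) ^ 2 * (s i : ℂ)⁻¹) = 1 := by field_simp
        rw [this]; simp
    have e4 := hmul _ _ (hmul _ _ hVn e3) hVn'
    rw [← e2, e] at e4
    nlinarith [norm_nonneg (V * D * (X * V)ᴴ)ᴴ]
  · have : (V * D * (X * V)ᴴ * X).trace = (D * ((X * V)ᴴ * (X * V))).trace := by
      rw [Matrix.mul_assoc, Matrix.mul_assoc, Matrix.trace_mul_comm]
      simp only [Matrix.mul_assoc]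
    rw [this, hX, Matrix.diagonal_mul_diagonal, Matrix.trace_diagonal, ← hsum]
    push_cast
    refine Finset.sum_congr rfl fun i _ => ?_
    by_cases h : s i = 0
    · simp [h]
    · have : (s i : ℂ) ≠ 0 := by exact_mod_cast h
      field_simp

theorem norm_trace_mul_le (U X : Mat d) : ‖(U * X).trace‖ ≤ ‖U‖ * traceNorm X := by
  obtain ⟨B, C, h, hB, hC⟩ := exists_factor X
  have e : (U * X).trace = (Cᴴ * (U * B)).trace := by
    rw [h, ← Matrix.mul_assoc, Matrix.trace_mul_comm]
  rw [e]
  refine (norm_trace_conjTranspose_mul_le _ _).trans ?_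
  have h3 : √(hsSq (U * B)) ≤ ‖U‖ * √(hsSq B) := by
    rw [Real.sqrt_le_left (by positivity), mul_pow, Real.sq_sqrt (hsSq_nonneg _)]
    exact hsSq_mul_le _ _
  calc √(hsSq C) * √(hsSq (U * B)) ≤ √(hsSq C) * (‖U‖ * √(hsSq B)) := by gcongr
    _ = ‖U‖ * (√(hsSq C) * √(hsSq B)) := by ring
    _ = _ := by rw [hB, hC, Real.mul_self_sqrt (traceNorm_nonneg _)]

/-- Duality with the operator norm. It linearizes the trace norm: the triangle inequality and the
later estimates test against a contraction `U`. -/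
theorem traceNorm_le_of_forall {X : Mat d} {K : ℝ}
    (h : ∀ U : Mat d, ‖U‖ ≤ 1 → ‖(U * X).trace‖ ≤ K) : traceNorm X ≤ K := by
  obtain ⟨U, hU, e⟩ := exists_trace_mul_eq_traceNorm X
  have := h U hU
  rw [e, Complex.norm_real] at this
  exact (le_abs_self _).trans this

theorem norm_trace_mul_le_of_le_one {U : Mat d} (hU : ‖U‖ ≤ 1) (X : Mat d) :
    ‖(U * X).trace‖ ≤ traceNorm X :=
  (norm_trace_mul_le U X).trans (mul_le_of_le_one_left (traceNorm_nonneg _) hU)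

theorem traceNorm_add_le (X Y : Mat d) : traceNorm (X + Y) ≤ traceNorm X + traceNorm Y :=
  traceNorm_le_of_forall fun U hU => by
    rw [Matrix.mul_add, Matrix.trace_add]
    exact (norm_add_le _ _).trans
      (add_le_add (norm_trace_mul_le_of_le_one hU _) (norm_trace_mul_le_of_le_one hU _))

theorem traceNorm_smul_le (z : ℂ) (X : Mat d) : traceNorm (z • X) ≤ ‖z‖ * traceNorm X :=
  traceNorm_le_of_forall fun U hU => by
    rw [Matrix.mul_smul, Matrix.trace_smul, norm_smul]
    gcongr
    exact norm_trace_mul_le_of_le_one hU _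

theorem traceNorm_zero : traceNorm (0 : Mat d) = 0 :=
  le_antisymm (by simpa using traceNorm_smul_le 0 (0 : Mat d)) (traceNorm_nonneg _)

theorem traceNorm_mul_conjTranspose_le (B C : Mat d) :
    traceNorm (B * Cᴴ) ≤ √(hsSq B) * √(hsSq C) :=
  traceNorm_le_of_forall fun U hU => by
    rw [← Matrix.mul_assoc]
    refine (norm_trace_mul_le_sqrt _ _).trans ?_
    rw [hsSq_conjTranspose]
    gcongr
    refine (hsSq_mul_le U B).trans (mul_le_of_le_one_left (hsSq_nonneg _) ?_)
    exact pow_le_one₀ (norm_nonneg _) hU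

theorem traceNorm_mul_conjTranspose_self_le (B : Mat d) : traceNorm (B * Bᴴ) ≤ hsSq B := by
  have := traceNorm_mul_conjTranspose_le B B
  rwa [Real.mul_self_sqrt (hsSq_nonneg _)] at this

theorem norm_apply_le_norm (M : Mat d) (i j : Fin d) : ‖M i j‖ ≤ ‖M‖ := by
  have h := Matrix.l2_opNorm_mulVec M (EuclideanSpace.single j 1)
  refine le_trans ?_ (h.trans (by simp))
  refine le_trans (le_of_eq ?_) (PiLp.norm_apply_le _ i)
  simp

/-- The dimension factor is harmless: it only multiplies the little-o error of an Euler step. -/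
theorem traceNorm_le_mul_norm (X : Mat d) : traceNorm X ≤ d * ‖X‖ :=
  traceNorm_le_of_forall fun U hU => by
    simp only [Matrix.trace, Matrix.diag_apply]
    refine (norm_sum_le _ _).trans ?_
    refine (Finset.sum_le_sum fun i _ => (norm_apply_le_norm (U * X) i i).trans
      ((norm_mul_le U X).trans (mul_le_of_le_one_left (norm_nonneg _) hU))).trans ?_
    simp

theorem norm_le_sqrt_hsSq (M : Mat d) : ‖M‖ ≤ √(hsSq M) := by
  rw [Matrix.l2_opNorm_def]
  refine ContinuousLinearMap.opNorm_le_bound _ (Real.sqrt_nonneg _) fun x => ?_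
  rw [EuclideanSpace.norm_eq, EuclideanSpace.norm_eq, ← Real.sqrt_mul (hsSq_nonneg _)]
  refine Real.sqrt_le_sqrt ?_
  unfold hsSq
  rw [Finset.sum_mul]
  refine Finset.sum_le_sum fun i _ => ?_
  have h : ‖∑ j, M i j * x j‖ ≤ √(∑ j, ‖M i j‖ ^ 2) * √(∑ j, ‖x j‖ ^ 2) := by
    refine (norm_sum_le _ _).trans ?_
    simp only [norm_mul]
    exact Real.sum_mul_le_sqrt_mul_sqrt _ _ _
  have h2 := pow_le_pow_left₀ (norm_nonneg _) h 2
  rw [mul_pow, Real.sq_sqrt (by positivity), Real.sq_sqrt (by positivity)] at h2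
  simpa [Matrix.mulVec, dotProduct] using! h2

theorem norm_le_traceNorm (X : Mat d) : ‖X‖ ≤ traceNorm X := by
  obtain ⟨B, C, h, hB, hC⟩ := exists_factor X
  rw [h]
  refine (norm_mul_le _ _).trans ?_
  rw [Matrix.l2_opNorm_conjTranspose, ← h]
  calc ‖B‖ * ‖C‖ ≤ √(hsSq B) * √(hsSq C) := by gcongr <;> exact norm_le_sqrt_hsSq _
    _ = _ := by rw [hB, hC, Real.mul_self_sqrt (traceNorm_nonneg _)]

theorem eq_zero_of_traceNorm_nonpos {X : Mat d} (h : traceNorm X ≤ 0) : X = 0 :=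
  norm_le_zero_iff.1 ((norm_le_traceNorm X).trans h)

theorem exists_sqrt {P : Mat d} (hP : P.PosSemidef) : ∃ B : Mat d, P = B * Bᴴ := by
  obtain ⟨V, _, _, h3⟩ := unitary_mul_diagonal_mul hP.1
  refine ⟨V * Matrix.diagonal (fun i => ((√(hP.1.eigenvalues i) : ℝ) : ℂ)), ?_⟩
  conv_lhs => rw [h3]
  rw [Matrix.conjTranspose_mul, Matrix.mul_assoc, Matrix.mul_assoc, Matrix.diagonal_conjTranspose,
    ← Matrix.mul_assoc (Matrix.diagonal _) _ Vᴴ, Matrix.diagonal_mul_diagonal]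
  congr 3
  ext i
  simp only [Pi.star_apply, Complex.star_def, Complex.conj_ofReal]
  rw [← Complex.ofReal_mul, Real.mul_self_sqrt (hP.eigenvalues_nonneg i)]

theorem IsState.traceNorm_le_one {ρ : Mat d} (h : IsState ρ) : traceNorm ρ ≤ 1 := by
  obtain ⟨B, rfl⟩ := exists_sqrt h.1
  refine (traceNorm_mul_conjTranspose_self_le B).trans (le_of_eq ?_)
  have := h.2
  rw [trace_mul_conjTranspose_self] at this
  exact_mod_cast this

/-- A matrix of trace one and trace norm at most one is a state. -/
theorem isState_of_traceNorm_le_one {X : Mat d} (ht : X.trace = 1) (hn : traceNorm X ≤ 1) :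
    IsState X := by
  refine ⟨?_, ht⟩
  obtain ⟨B, C, h, hB, hC⟩ := exists_factor X
  -- Equality case of Cauchy–Schwarz: `‖B - C‖² = 2 ‖X‖₁ - 2 Re Tr X ≤ 0` in Hilbert–Schmidt norm,
  -- which forces `B = C` and makes `X = C Cᴴ` positive.
  have e : ((hsSq (B - C) : ℝ) : ℂ) = hsSq B + hsSq C - (B * Cᴴ).trace - star (B * Cᴴ).trace := by
    rw [← trace_mul_conjTranspose_self, ← trace_mul_conjTranspose_self,
      ← trace_mul_conjTranspose_self, ← Matrix.trace_conjTranspose]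
    simp only [Matrix.conjTranspose_sub, Matrix.sub_mul, Matrix.mul_sub, Matrix.trace_sub,
      Matrix.conjTranspose_mul, Matrix.conjTranspose_conjTranspose]
    ring
  rw [← h, ht] at e
  have e2 : hsSq (B - C) = hsSq B + hsSq C - 2 := by
    have : ((hsSq (B - C) : ℝ) : ℂ) = ((hsSq B + hsSq C - 2 : ℝ) : ℂ) := by
      rw [e]; push_cast; simp; ring
    exact_mod_cast this
  have e3 : hsSq (B - C) = 0 := le_antisymm (by linarith) (hsSq_nonneg _)
  have : B = C := sub_eq_zero.1 (hsSq_eq_zero e3)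
  rw [h, this]
  exact Matrix.posSemidef_self_mul_conjTranspose C

end CGME

end

/-! ### Semigroups of Lindblad form: contraction, fixed states, mixing. -/

noncomputable section

namespace CGME

open Filter Topology

section Semigroup

variable {E : Type*} [NormedAddCommGroup E] [NormedSpace ℂ E]

/-- The semigroup `exp (t L)` of a bounded operator on a Banach space. -/
def expSemigroup (L : E →L[ℂ] E) (t : ℝ) : E →L[ℂ] E := NormedSpace.exp ((t : ℂ) • L)

theorem expSemigroup_zero_apply (L : E →L[ℂ] E) (X : E) : expSemigroup L 0 X = X := by
  simp [expSemigroup]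

variable [CompleteSpace E]

theorem expSemigroup_add_apply (L : E →L[ℂ] E) (s t : ℝ) (X : E) :
    expSemigroup L (s + t) X = expSemigroup L s (expSemigroup L t X) := by
  let _ : NormedAlgebra ℚ (E →L[ℂ] E) := .restrictScalars ℚ ℂ _
  unfold expSemigroup
  rw [Complex.ofReal_add, add_smul,
    NormedSpace.exp_add_of_commute (((Commute.refl L).smul_left _).smul_right _)]
  rfl

theorem expSemigroup_iterate (L : E →L[ℂ] E) (n : ℕ) (t : ℝ) (X : E) :
    (expSemigroup L t)^[n] X = expSemigroup L (n * t) X := by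
  induction n with
  | zero => simp [expSemigroup_zero_apply]
  | succ n ih =>
    rw [Nat.cast_succ, add_mul, one_mul, add_comm (n * t), expSemigroup_add_apply, ← ih,
      Function.iterate_succ_apply']

theorem hasDerivAt_expSemigroup (L : E →L[ℂ] E) (t : ℝ) :
    HasDerivAt (expSemigroup L) (expSemigroup L t * L) t := by
  simpa using! (hasDerivAt_exp_smul_const L (t : ℂ)).scomp t
    (Complex.ofRealCLM.hasDerivAt (x := t))

theorem hasDerivAt_expSemigroup' (L : E →L[ℂ] E) (t : ℝ) :
    HasDerivAt (expSemigroup L) (L * expSemigroup L t) t := by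
  simpa using! (hasDerivAt_exp_smul_const' L (t : ℂ)).scomp t
    (Complex.ofRealCLM.hasDerivAt (x := t))

theorem hasDerivAt_expSemigroup_apply (L : E →L[ℂ] E) (t : ℝ) (X : E) :
    HasDerivAt (fun s => expSemigroup L s X) (expSemigroup L t (L X)) t := by
  exact ((ContinuousLinearMap.apply ℂ E X).hasFDerivAt.restrictScalars ℝ).comp_hasDerivAt t
    (hasDerivAt_expSemigroup L t)

theorem hasDerivAt_expSemigroup_apply' (L : E →L[ℂ] E) (t : ℝ) (X : E) :
    HasDerivAt (fun s => expSemigroup L s X) (L (expSemigroup L t X)) t := by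
  exact ((ContinuousLinearMap.apply ℂ E X).hasFDerivAt.restrictScalars ℝ).comp_hasDerivAt t
    (hasDerivAt_expSemigroup' L t)

/-- The exponential is differentiable in operator norm, which makes the error of an Euler step
uniform in `X`. -/
theorem exists_norm_expSemigroup_sub_le (L : E →L[ℂ] E) {η : ℝ} (hη : 0 < η) :
    ∃ δ > 0, ∀ ε : ℝ, 0 ≤ ε → ε < δ → ∀ X : E,
      ‖expSemigroup L ε X - (X + (ε : ℂ) • L X)‖ ≤ η * ε * ‖X‖ := by
  have hder : HasDerivAt (expSemigroup L) L 0 := by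
    simpa [expSemigroup] using hasDerivAt_expSemigroup L 0
  rw [hasDerivAt_iff_isLittleO] at hder
  have hev := hder.def hη
  rw [Metric.eventually_nhds_iff] at hev
  obtain ⟨δ, hδ, hev⟩ := hev
  refine ⟨δ, hδ, fun ε hε hεδ X => ?_⟩
  have h1 := hev (y := ε) (by rwa [Real.dist_eq, sub_zero, abs_of_nonneg hε])
  rw [sub_zero, Real.norm_of_nonneg hε] at h1
  refine le_trans (le_of_eq ?_) ((ContinuousLinearMap.le_opNorm _ X).trans
    (mul_le_mul_of_nonneg_right h1 (norm_nonneg X)))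
  have h0 : expSemigroup L 0 = 1 := by simp [expSemigroup]
  simp [h0, sub_sub]

end Semigroup

variable {d : ℕ}

/-- A consequence of complete positivity: the pairing of `J (B C†)` with contractions is controlled
by the traces of `J (B B†)` and `J (C C†)`. -/
def TraceDominated (J : SuperOp d) : Prop :=
  ∀ W B C : Mat d, ‖W‖ ≤ 1 →
    ‖(W * J (B * Cᴴ)).trace‖ ≤ (1 / 2) * ((J (B * Bᴴ)).trace.re + (J (C * Cᴴ)).trace.re)

/-- Generators of Lindblad form: `X ↦ J X + G X + X G†` with `J` completely positive, trace
annihilating. -/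
def IsLindbladian (L : SuperOp d) : Prop :=
  (∃ (J : SuperOp d) (G : Mat d), TraceDominated J ∧ ∀ X, L X = J X + G * X + X * Gᴴ) ∧
    ∀ X, (L X).trace = 0

theorem norm_trace_conj_le {W : Mat d} (hW : ‖W‖ ≤ 1) (K B C : Mat d) :
    ‖(W * (K * (B * Cᴴ) * Kᴴ)).trace‖ ≤ (1 / 2) * (hsSq (K * B) + hsSq (K * C)) := by
  have e : (W * (K * (B * Cᴴ) * Kᴴ)).trace = ((W * (K * B)) * (K * C)ᴴ).trace := by
    simp only [Matrix.conjTranspose_mul, Matrix.mul_assoc]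
  rw [e]
  refine (norm_trace_mul_le_half _ _).trans ?_
  rw [hsSq_conjTranspose]
  gcongr
  exact (hsSq_mul_le _ _).trans
    (mul_le_of_le_one_left (hsSq_nonneg _) (pow_le_one₀ (norm_nonneg _) hW))

theorem trace_conj_self (K B : Mat d) : (K * (B * Bᴴ) * Kᴴ).trace = (hsSq (K * B) : ℂ) := by
  rw [← trace_mul_conjTranspose_self]
  simp only [Matrix.conjTranspose_mul, Matrix.mul_assoc]

theorem sandwich_apply (K L X : Mat d) : sandwich K L X = K * X * L :=
  ContinuousLinearMap.mulLeftRight_apply _ _ _ _ _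

theorem traceDominated_sandwich (K : Mat d) : TraceDominated (sandwich K Kᴴ) := by
  intro W B C hW
  simp only [sandwich_apply, trace_conj_self, Complex.ofReal_re]
  exact norm_trace_conj_le hW K B C

theorem TraceDominated.sum {ι : Type*} {s : Finset ι} {J : ι → SuperOp d}
    (h : ∀ i ∈ s, TraceDominated (J i)) : TraceDominated (∑ i ∈ s, J i) := by
  intro W B C hW
  simp only [sum_apply, Matrix.mul_sum, Matrix.trace_sum, Complex.re_sum,
    ← Finset.sum_add_distrib]
  refine (norm_sum_le _ _).trans ?_
  rw [Finset.mul_sum]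
  exact Finset.sum_le_sum fun i hi => h i hi W B C hW

/-- The continuous linear functional `X ↦ Tr (W X)`. -/
def traceMul (W : Mat d) : Mat d →L[ℂ] ℂ :=
  LinearMap.toContinuousLinearMap ((Matrix.traceLinearMap (Fin d) ℂ ℂ).comp
    (LinearMap.mulLeft ℂ W))

@[simp]
theorem traceMul_apply (W X : Mat d) : traceMul W X = (W * X).trace := rfl

open MeasureTheory in
theorem integral_superOp_apply {α : Type*} [MeasurableSpace α] {μ : Measure α}
    {J : α → SuperOp d} (hJ : Integrable J μ) (X : Mat d) :
    (∫ a, J a ∂μ) X = ∫ a, J a X ∂μ :=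
  ContinuousLinearMap.integral_apply (H := Mat d) hJ X

open MeasureTheory in
theorem integrable_superOp_apply {α : Type*} [MeasurableSpace α] {μ : Measure α}
    {J : α → SuperOp d} (hJ : Integrable J μ) (X : Mat d) : Integrable (fun a => J a X) μ :=
  Integrable.apply_continuousLinearMap (H := Mat d) hJ X

open MeasureTheory in
theorem TraceDominated.integral {α : Type*} [MeasurableSpace α] {μ : Measure α}
    {J : α → SuperOp d} (hJ : Integrable J μ) (h : ∀ a, TraceDominated (J a)) :
    TraceDominated (∫ a, J a ∂μ) := by
  intro W B C hW
  have e : ∀ W X : Mat d, (W * (∫ a, J a ∂μ) X).trace = ∫ a, (W * J a X).trace ∂μ := fun W X => by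
    rw [integral_superOp_apply hJ]
    exact ((traceMul W).integral_comp_comm (integrable_superOp_apply hJ X)).symm
  have hi : ∀ W X : Mat d, Integrable (fun a => (W * J a X).trace) μ := fun W X =>
    (traceMul W).integrable_comp (integrable_superOp_apply hJ X)
  have e1 : ∀ X : Mat d, ((∫ a, J a ∂μ) X).trace.re = ∫ a, (J a X).trace.re ∂μ := fun X => by
    have := e 1 X
    simp only [one_mul] at this
    rw [this]
    exact (integral_re (by simpa using hi 1 X)).symm
  have hi1 : ∀ X : Mat d, Integrable (fun a => (J a X).trace.re) μ := fun X => by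
    have := (hi 1 X).re
    simpa using this
  rw [e, e1, e1, ← integral_add (hi1 _) (hi1 _), ← integral_const_mul]
  refine (norm_integral_le_integral_norm _).trans (integral_mono (hi _ _).norm ?_ fun a => ?_)
  · exact ((hi1 _).add (hi1 _)).const_mul _
  · exact h a W B C hW

theorem TraceDominated.smul {J : SuperOp d} (h : TraceDominated J) {r : ℝ} (hr : 0 ≤ r) :
    TraceDominated ((r : ℂ) • J) := by
  intro W B C hW
  have := mul_le_mul_of_nonneg_left (h W B C hW) hr
  simp only [smul_apply, Matrix.mul_smul, Matrix.trace_smul, smul_eq_mul, norm_mul,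
    Complex.norm_real, Real.norm_of_nonneg hr, Complex.re_ofReal_mul]
  linarith

/-- An explicit Euler step with a generator of Lindblad form is a contraction in trace norm up to
second order. -/
theorem IsLindbladian.exists_euler_bound {L : SuperOp d} (hL : IsLindbladian L) :
    ∃ g : ℝ, 0 ≤ g ∧ ∀ ε : ℝ, 0 ≤ ε → ∀ X : Mat d,
      traceNorm (X + (ε : ℂ) • L X) ≤ (1 + g * ε ^ 2) * traceNorm X := by
  obtain ⟨⟨J, G, hJ, hJG⟩, ht⟩ := hL
  -- The term `ε² G X Gᴴ` costs `‖G‖²` twice: once in the pairing itself and once in the trace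
  -- balance `htr`.
  refine ⟨‖G‖ ^ 2 * 2, by positivity, fun ε hε X => ?_⟩
  let M : Mat d := 1 + (ε : ℂ) • G
  -- Completing the square: the first-order drift becomes the positive map `X ↦ M X Mᴴ`, at the
  -- price of one second-order term.
  have hM : ∀ X, X + (ε : ℂ) • L X = M * X * Mᴴ + (ε : ℂ) • J X - ((ε ^ 2 : ℝ) : ℂ) • (G * X * Gᴴ) := by
    intro X
    rw [hJG]
    simp only [M, Matrix.conjTranspose_add, Matrix.conjTranspose_smul, Matrix.conjTranspose_one,
      Complex.star_def, Complex.conj_ofReal, Matrix.add_mul, Matrix.mul_add, Matrix.one_mul,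
      Matrix.mul_one, Matrix.smul_mul, Matrix.mul_smul, smul_add, smul_smul]
    push_cast
    rw [← pow_two]
    abel
  -- The trace of `hM` at `B Bᴴ`, using that `L` annihilates the trace.
  have htr : ∀ B : Mat d, hsSq (M * B) + ε * (J (B * Bᴴ)).trace.re
      = hsSq B + ε ^ 2 * hsSq (G * B) := by
    intro B
    have h1 := congrArg (fun Y => (Matrix.trace Y).re) (hM (B * Bᴴ))
    simp only [Matrix.trace_add, Matrix.trace_sub, Matrix.trace_smul, ht, trace_conj_self,
      trace_mul_conjTranspose_self, smul_eq_mul, Complex.add_re, Complex.sub_re,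
      Complex.re_ofReal_mul, Complex.ofReal_re, mul_zero, Complex.zero_re] at h1
    linarith
  obtain ⟨B, C, hX, hB, hC⟩ := exists_factor X
  have hGB := hsSq_mul_le G B
  have hGC := hsSq_mul_le G C
  refine traceNorm_le_of_forall fun W hW => ?_
  rw [hM, Matrix.mul_sub, Matrix.mul_add, Matrix.mul_smul, Matrix.mul_smul, Matrix.trace_sub,
    Matrix.trace_add, Matrix.trace_smul, Matrix.trace_smul]
  refine (norm_sub_le _ _).trans ((add_le_add_left (norm_add_le _ _) _).trans ?_)
  rw [norm_smul, norm_smul, Complex.norm_real, Complex.norm_real, Real.norm_of_nonneg hε,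
    Real.norm_of_nonneg (sq_nonneg ε)]
  have h1 := norm_trace_conj_le hW M B C
  have h2 := mul_le_mul_of_nonneg_left (hJ W B C hW) hε
  have h3 := mul_le_mul_of_nonneg_left (norm_trace_conj_le hW G B C) (sq_nonneg ε)
  rw [← hX] at h1 h2 h3
  have h4 := htr B
  have h5 := htr C
  rw [hB] at h4 hGB
  rw [hC] at h5 hGC
  have h6 := mul_le_mul_of_nonneg_left (add_le_add hGB hGC) (sq_nonneg ε)
  linarith

/-- The semigroup `exp (t L)` of a superoperator. -/
def semigroup (L : SuperOp d) (t : ℝ) : SuperOp d := expSemigroup (E := Mat d) L t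

theorem semigroup_zero_apply (L : SuperOp d) (X : Mat d) : semigroup L 0 X = X :=
  expSemigroup_zero_apply (E := Mat d) L X

theorem semigroup_add_apply (L : SuperOp d) (s t : ℝ) (X : Mat d) :
    semigroup L (s + t) X = semigroup L s (semigroup L t X) :=
  expSemigroup_add_apply (E := Mat d) L s t X

theorem hasDerivAt_semigroup_apply (L : SuperOp d) (t : ℝ) (X : Mat d) :
    HasDerivAt (fun s => semigroup L s X) (semigroup L t (L X)) t :=
  hasDerivAt_expSemigroup_apply (E := Mat d) L t X

theorem hasDerivAt_semigroup_apply' (L : SuperOp d) (t : ℝ) (X : Mat d) :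
    HasDerivAt (fun s => semigroup L s X) (L (semigroup L t X)) t :=
  hasDerivAt_expSemigroup_apply' (E := Mat d) L t X

/-- Both errors, the quadratic one of the Euler step and the little-o one of the exponential, are
given half of `η ε`. -/
theorem IsLindbladian.exists_step_bound {L : SuperOp d} (hL : IsLindbladian L) {η : ℝ}
    (hη : 0 < η) : ∃ δ > 0, ∀ ε : ℝ, 0 ≤ ε → ε < δ → ∀ X : Mat d,
      traceNorm (semigroup L ε X) ≤ (1 + η * ε) * traceNorm X := by
  obtain ⟨g, hg, hE⟩ := hL.exists_euler_bound
  have hη' : 0 < η / (2 * (d + 1)) := by positivity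
  obtain ⟨δ, hδ, hev⟩ := exists_norm_expSemigroup_sub_le (E := Mat d) L hη'
  refine ⟨min δ (η / (2 * (g + 1))), lt_min hδ (by positivity), fun ε hε hεδ X => ?_⟩
  have h2 : semigroup L ε X = (X + (ε : ℂ) • L X) + (semigroup L ε X - (X + (ε : ℂ) • L X)) :=
    (add_sub_cancel _ _).symm
  have h3 : ‖semigroup L ε X - (X + (ε : ℂ) • L X)‖ ≤ η / (2 * (d + 1)) * ε * traceNorm X :=
    (hev ε hε (hεδ.trans_le (min_le_left _ _)) X).trans (by
      gcongr
      exact norm_le_traceNorm X)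
  have h4 := traceNorm_le_mul_norm (semigroup L ε X - (X + (ε : ℂ) • L X))
  have hX := traceNorm_nonneg X
  have h5 : (d : ℝ) * (η / (2 * (d + 1)) * ε * traceNorm X) ≤ η / 2 * ε * traceNorm X := by
    have : (d : ℝ) * (η / (2 * (d + 1))) ≤ η / 2 := by
      rw [mul_div_assoc', div_le_div_iff₀ (by positivity) (by positivity)]
      nlinarith
    nlinarith [mul_le_mul_of_nonneg_right this (mul_nonneg hε hX)]
  have h6 : g * ε ^ 2 ≤ η / 2 * ε := by
    have : (g + 1) * ε ≤ η / 2 := by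
      have := hεδ.le.trans (min_le_right _ _)
      rw [le_div_iff₀ (by positivity)] at this
      linarith
    nlinarith
  rw [h2]
  refine (traceNorm_add_le _ _).trans ?_
  have h7 := hE ε hε X
  have h8 := mul_le_mul_of_nonneg_left h3 (Nat.cast_nonneg d : (0 : ℝ) ≤ d)
  have h9 := mul_le_mul_of_nonneg_right h6 hX
  linarith

/-- The semigroup of a generator of Lindblad form contracts the trace norm. -/
theorem IsLindbladian.traceNorm_semigroup_le {L : SuperOp d} (hL : IsLindbladian L) {t : ℝ}
    (ht : 0 ≤ t) (X : Mat d) : traceNorm (semigroup L t X) ≤ traceNorm X := by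
  -- Divide `[0, t]` into `n` short steps, whose factors multiply to at most `exp(η t)`; then let
  -- `η` tend to zero.
  have key : ∀ η : ℝ, 0 < η → traceNorm (semigroup L t X) ≤ Real.exp (η * t) * traceNorm X := by
    intro η hη
    obtain ⟨δ, hδ, hs⟩ := hL.exists_step_bound hη
    obtain ⟨n, hn⟩ := exists_nat_gt (t / δ)
    have hn0 : (0 : ℝ) < n := (div_nonneg ht hδ.le).trans_lt hn
    have hsmall : t / n < δ := by
      rw [div_lt_iff₀ hδ] at hn
      rw [div_lt_iff₀ hn0]; linarith
    have hstep : ∀ Y : Mat d, traceNorm (semigroup L (t / n) Y) ≤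
        Real.exp (η * (t / n)) * traceNorm Y := fun Y =>
      (hs _ (by positivity) hsmall Y).trans
        (mul_le_mul_of_nonneg_right (by linarith [Real.add_one_le_exp (η * (t / n))])
          (traceNorm_nonneg Y))
    have hiter : ∀ k : ℕ, traceNorm ((semigroup L (t / n))^[k] X) ≤
        Real.exp (η * (t / n)) ^ k * traceNorm X := by
      intro k
      induction k with
      | zero => simp
      | succ k ih =>
        rw [Function.iterate_succ_apply', pow_succ', mul_assoc]
        exact (hstep _).trans (mul_le_mul_of_nonneg_left ih (Real.exp_pos _).le)
    have := hiter n
    rw [← Real.exp_nat_mul] at this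
    have e0 : (semigroup L (t / n))^[n] X = semigroup L (n * (t / n)) X :=
      expSemigroup_iterate (E := Mat d) L n (t / n) X
    have e1 : (n : ℝ) * (t / n) = t := by field_simp
    have e2 : (n : ℝ) * (η * (t / n)) = η * t := by field_simp
    rwa [e0, e1, e2] at this
  have hlim : Tendsto (fun η : ℝ => Real.exp (η * t) * traceNorm X) (𝓝[>] 0)
      (𝓝 (traceNorm X)) := by
    have : Continuous fun η : ℝ => Real.exp (η * t) * traceNorm X := by fun_prop
    have h := this.tendsto 0
    simp only [zero_mul, Real.exp_zero, one_mul] at h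
    exact h.mono_left nhdsWithin_le_nhds
  exact ge_of_tendsto hlim (eventually_mem_nhdsWithin.mono fun η hη => key η hη)

/-- Mean value inequality for the scalar function `s ↦ Tr (U exp(sL) X)`, whose derivative is the
pairing at `L X`. -/
theorem norm_tracePairing_semigroup_sub_le {L : SuperOp d} {U X : Mat d} {K t : ℝ} (ht : 0 ≤ t)
    (h : ∀ s, 0 ≤ s → ‖(U * semigroup L s (L X)).trace‖ ≤ K) :
    ‖(U * semigroup L t X).trace - (U * X).trace‖ ≤ K * t := by
  have hd : ∀ s : ℝ, HasDerivAt (fun s => (U * semigroup L s X).trace)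
      (U * semigroup L s (L X)).trace s := fun s => by
    exact ((traceMul U).hasFDerivAt.restrictScalars ℝ).comp_hasDerivAt s
      (hasDerivAt_semigroup_apply L s X)
  have := norm_image_sub_le_of_norm_deriv_le_segment' (a := 0) (b := t)
    (fun s _ => (hd s).hasDerivWithinAt) (fun s hs => h s hs.1) t ⟨ht, le_rfl⟩
  simpa [semigroup_zero_apply] using this

theorem IsLindbladian.traceNorm_semigroup_sub_le {L : SuperOp d} (hL : IsLindbladian L) {t : ℝ}
    (ht : 0 ≤ t) (X : Mat d) : traceNorm (semigroup L t X - X) ≤ t * traceNorm (L X) :=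
  traceNorm_le_of_forall fun U hU => by
    rw [Matrix.mul_sub, Matrix.trace_sub, mul_comm t]
    exact norm_tracePairing_semigroup_sub_le ht fun s hs =>
      (norm_trace_mul_le_of_le_one hU _).trans (hL.traceNorm_semigroup_le hs _)

theorem IsLindbladian.semigroup_apply_of_eq_zero {L : SuperOp d} (hL : IsLindbladian L) {t : ℝ}
    (ht : 0 ≤ t) {X : Mat d} (hX : L X = 0) : semigroup L t X = X := by
  have := hL.traceNorm_semigroup_sub_le ht X
  rw [hX, traceNorm_zero, mul_zero] at this
  exact sub_eq_zero.1 (eq_zero_of_traceNorm_nonpos this)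

theorem IsLindbladian.trace_semigroup {L : SuperOp d} (hL : IsLindbladian L) {t : ℝ}
    (ht : 0 ≤ t) (X : Mat d) : (semigroup L t X).trace = X.trace := by
  have hd : ∀ s : ℝ, HasDerivAt (fun s => (semigroup L s X).trace)
      (L (semigroup L s X)).trace s := fun s => by
    have := ((traceMul 1).hasFDerivAt.restrictScalars ℝ).comp_hasDerivAt s
      (hasDerivAt_semigroup_apply' L s X)
    simpa [Function.comp_def] using! this
  have := norm_image_sub_le_of_norm_deriv_le_segment' (a := 0) (b := t) (C := 0)
    (fun s _ => (hd s).hasDerivWithinAt) (fun s hs => by simp [hL.2]) t ⟨ht, le_rfl⟩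
  simpa [sub_eq_zero, semigroup_zero_apply] using this

theorem IsLindbladian.isState_semigroup {L : SuperOp d} (hL : IsLindbladian L) {t : ℝ}
    (ht : 0 ≤ t) {ρ : Mat d} (hρ : IsState ρ) : IsState (semigroup L t ρ) :=
  isState_of_traceNorm_le_one ((hL.trace_semigroup ht ρ).trans hρ.2)
    ((hL.traceNorm_semigroup_le ht ρ).trans hρ.traceNorm_le_one)

/-- Among matrices of trace one, states are those of trace norm at most one, which is an
intersection of closed conditions `|Tr (U ρ)| ≤ 1`. -/
theorem isClosed_isState : IsClosed {ρ : Mat d | IsState ρ} := by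
  have : {ρ : Mat d | IsState ρ} = {ρ | ρ.trace = 1} ∩ {ρ | traceNorm ρ ≤ 1} := by
    ext ρ
    exact ⟨fun h => ⟨h.2, h.traceNorm_le_one⟩, fun h => isState_of_traceNorm_le_one h.1 h.2⟩
  have h2 : {ρ : Mat d | traceNorm ρ ≤ 1} =
      ⋂ U ∈ {U : Mat d | ‖U‖ ≤ 1}, {ρ | ‖(U * ρ).trace‖ ≤ 1} := by
    ext ρ
    simp only [Set.mem_ofPred_eq, Set.mem_iInter]
    exact ⟨fun h U hU => (norm_trace_mul_le_of_le_one hU ρ).trans h,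
      fun h => traceNorm_le_of_forall h⟩
  rw [this, h2]
  refine IsClosed.inter (isClosed_eq (by fun_prop) continuous_const) ?_
  exact isClosed_biInter fun U _ => isClosed_le (by fun_prop) continuous_const

theorem MixedAt.semigroup_le {L : SuperOp d} {t : ℝ≥0} (h : MixedAt L t) {ρ ρ' : Mat d}
    (hρ : IsState ρ) (hρ' : IsState ρ') :
    traceNorm (semigroup L t ρ - semigroup L t ρ') ≤ (1 / 2) * traceNorm (ρ - ρ') := by
  rw [← map_sub]
  exact h ρ ρ' hρ hρ'

/-- A mixing semigroup has a unique fixed state. -/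
theorem IsLindbladian.existsUnique_isFixedState {L : SuperOp d} (hL : IsLindbladian L) {t : ℝ≥0}
    (ht : MixedAt L t) (hne : ∃ ρ : Mat d, IsState ρ) : ∃! σ, IsFixedState L σ := by
  have huniq : ∀ σ σ' : Mat d, IsState σ → IsState σ' → semigroup L t σ = σ →
      semigroup L t σ' = σ' → σ = σ' := by
    intro σ σ' h h' e e'
    have := ht.semigroup_le h h'
    rw [e, e'] at this
    exact sub_eq_zero.1 (eq_zero_of_traceNorm_nonpos (by linarith))
  obtain ⟨ρ, hρ⟩ := hne
  let u : ℕ → Mat d := fun n => (semigroup L t)^[n] ρ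
  have hu : ∀ n, u (n + 1) = semigroup L t (u n) := fun n =>
    Function.iterate_succ_apply' _ _ _
  have hus : ∀ n, IsState (u n) := by
    intro n
    induction n with
    | zero => simpa [u] using hρ
    | succ n ih => rw [hu]; exact hL.isState_semigroup t.2 ih
  have hgeo : ∀ n, traceNorm (u n - u (n + 1)) ≤ traceNorm (u 0 - u 1) * (1 / 2) ^ n := by
    intro n
    induction n with
    | zero => simp
    | succ n ih =>
      have := ht.semigroup_le (hus n) (hus (n + 1))
      rw [← hu, ← hu] at this
      rw [pow_succ]
      linarith
  have hc : CauchySeq u := cauchySeq_of_le_geometric (1 / 2) (traceNorm (u 0 - u 1)) (by norm_num)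
    fun n => by rw [dist_eq_norm]; exact (norm_le_traceNorm _).trans (hgeo n)
  obtain ⟨σ, hσ⟩ := cauchySeq_tendsto_of_complete hc
  have hσs : IsState σ := isClosed_isState.mem_of_tendsto hσ (Eventually.of_forall hus)
  have hfix : semigroup L t σ = σ := by
    have h1 : Tendsto (fun n => u (n + 1)) atTop (𝓝 (semigroup L t σ)) := by
      simp only [hu]
      exact ((semigroup L t).continuous.tendsto σ).comp hσ
    exact tendsto_nhds_unique h1 (hσ.comp (tendsto_add_atTop_nat 1))
  -- The semigroup is commutative, so `exp(sL) σ` is also fixed by the time-`t` map, and `huniq`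
  -- identifies it with `σ`.
  have hall : ∀ s : ℝ, 0 ≤ s → semigroup L s σ = σ := by
    intro s hs
    refine huniq _ _ (hL.isState_semigroup hs hσs) hσs ?_ hfix
    rw [← semigroup_add_apply, add_comm, semigroup_add_apply, hfix]
  have hzero : L σ = 0 := by
    have h1 : HasDerivAt (fun s => semigroup L s σ) (L σ) 0 := by
      have := hasDerivAt_semigroup_apply L 0 σ
      rwa [semigroup_zero_apply] at this
    -- Constancy is known for nonnegative times only, hence a one-sided derivative.
    have h2 : HasDerivWithinAt (fun s => semigroup L s σ) 0 (Set.Ici 0) 0 :=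
      (hasDerivWithinAt_const (0 : ℝ) (Set.Ici 0) σ).congr (fun s hs => hall s hs) (hall 0 le_rfl)
    exact (uniqueDiffWithinAt_Ici (0 : ℝ)).eq_deriv _ h1.hasDerivWithinAt h2
  refine ⟨σ, ⟨hσs, hzero⟩, fun σ' h' => ?_⟩
  exact huniq _ _ h'.1 hσs (hL.semigroup_apply_of_eq_zero t.2 h'.2) hfix

/-- The distance of a fixed state from an approximate fixed state, in terms of the mixing time. -/
theorem IsLindbladian.traceNorm_sub_le {L : SuperOp d} (hL : IsLindbladian L) {t : ℝ≥0}
    (ht : MixedAt L t) {σ ρ : Mat d} (hσ : IsFixedState L σ) (hρ : IsState ρ) :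
    traceNorm (σ - ρ) ≤ 2 * traceNorm (L ρ) * t := by
  -- With `exp(tL) σ = σ` the triangle inequality gives `x ≤ x/2 + t ‖L ρ‖₁` for the distance `x`;
  -- solving for `x` produces the factor 2.
  have h1 := ht.semigroup_le hσ.1 hρ
  have h2 : traceNorm (semigroup L t ρ - ρ) ≤ t * traceNorm (L ρ) :=
    hL.traceNorm_semigroup_sub_le t.2 ρ
  have h3 := traceNorm_add_le (semigroup L t σ - semigroup L t ρ) (semigroup L t ρ - ρ)
  have h0 : semigroup L t σ = σ := hL.semigroup_apply_of_eq_zero t.2 hσ.2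
  rw [h0] at h1 h3
  rw [sub_add_sub_cancel] at h3
  linarith

/-- Passes to the infimum over mixing times by dividing by `2 ε`. Positivity of `ε` is what makes
the right side infinite when there is no mixing time, since `0 * ⊤ = 0`. -/
theorem IsLindbladian.ofReal_traceNorm_sub_le {L : SuperOp d} (hL : IsLindbladian L)
    {σ ρ : Mat d} (hσ : IsFixedState L σ) (hρ : IsState ρ) {ε : ℝ} (hε : 0 < ε)
    (h : traceNorm (L ρ) ≤ ε) :
    ENNReal.ofReal (traceNorm (σ - ρ)) ≤ ENNReal.ofReal (2 * ε) * mixingTime L := by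
  have hpos : ENNReal.ofReal (2 * ε) ≠ 0 := by
    rw [Ne, ENNReal.ofReal_eq_zero, not_le]; positivity
  rw [mul_comm, ← ENNReal.div_le_iff hpos ENNReal.ofReal_ne_top]
  refine le_iInf₂ fun t ht => ?_
  rw [ENNReal.div_le_iff hpos ENNReal.ofReal_ne_top, ← ENNReal.ofReal_coe_nnreal,
    ← ENNReal.ofReal_mul t.coe_nonneg]
  refine ENNReal.ofReal_le_ofReal ((hL.traceNorm_sub_le ht hσ hρ).trans ?_)
  rw [mul_comm (t : ℝ)]
  gcongr

end CGME

end

noncomputable section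

namespace CGME

/-! ### Plancherel's theorem, also over a finite time window. -/

section Plancherel

open MeasureTheory FourierTransform

theorem integral_fourier_mul_flip {f g : ℝ → ℂ} (hf : Integrable f) (hg : Integrable g) :
    ∫ x, 𝓕 f x * g x = ∫ x, f x * 𝓕 g x := by
  simpa using! VectorFourier.integral_bilin_fourierIntegral_eq_flip (ContinuousLinearMap.mul ℂ ℂ)
    (L := innerₗ ℝ) Real.continuous_fourierChar continuous_inner hf hg

/-- The Fourier integral of a function in `L¹ ∩ L²` agrees with its `L²` Fourier transform. -/
theorem fourier_toLp_ae_eq {f : ℝ → ℂ} (hf : Integrable f) (hf2 : MemLp f 2) :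
    (𝓕 (hf2.toLp f) : Lp ℂ 2 (volume : Measure ℝ)) =ᵐ[volume] 𝓕 f := by
  have hcont : Continuous (𝓕 f) :=
    VectorFourier.fourierIntegral_continuous Real.continuous_fourierChar
      (L := innerₗ ℝ) continuous_inner hf
  have hloc : LocallyIntegrable (𝓕 (hf2.toLp f) : Lp ℂ 2 (volume : Measure ℝ)) :=
    (Lp.memLp (𝓕 (hf2.toLp f))).locallyIntegrable (by norm_num)
  -- Smooth compactly supported functions are Schwartz functions, and on those both transforms are
  -- moved onto the test function.
  refine ae_eq_of_integral_contDiff_smul_eq hloc hcont.locallyIntegrable ?_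
  intro g hg hgs
  let φ : SchwartzMap ℝ ℂ := (hgs.comp_left (g := ((↑) : ℝ → ℂ)) (by simp)).toSchwartzMap
    (Complex.ofRealCLM.contDiff.comp hg)
  have hφ : ∀ x, φ x = (g x : ℂ) := fun x => rfl
  have h1 := congrArg (fun T : TemperedDistribution ℝ ℂ => T φ)
    (Lp.fourier_toTemperedDistribution_eq (hf2.toLp f))
  simp only [TemperedDistribution.fourier_apply, Lp.toTemperedDistribution_apply,
    smul_eq_mul] at h1
  calc ∫ x, g x • (𝓕 (hf2.toLp f) : Lp ℂ 2 (volume : Measure ℝ)) x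
      = ∫ x, φ x * (𝓕 (hf2.toLp f) : Lp ℂ 2 (volume : Measure ℝ)) x := by simp [hφ]
    _ = ∫ x, (𝓕 φ) x * hf2.toLp f x := h1.symm
    _ = ∫ x, f x * 𝓕 (φ : ℝ → ℂ) x := by
        refine integral_congr_ae ?_
        filter_upwards [hf2.coeFn_toLp] with x hx
        rw [hx, mul_comm, SchwartzMap.fourier_coe]
    _ = ∫ x, 𝓕 f x * φ x := (integral_fourier_mul_flip hf φ.integrable).symm
    _ = ∫ x, g x • 𝓕 f x := by simp [hφ, mul_comm]

/-- **Plancherel's theorem** for functions in `L¹ ∩ L²` on the line. -/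
theorem integrable_and_integral_norm_sq_fourier {f : ℝ → ℂ} (hf : Integrable f)
    (hf2 : MemLp f 2) :
    Integrable (fun x => ‖𝓕 f x‖ ^ 2) ∧ ∫ x, ‖𝓕 f x‖ ^ 2 = ∫ x, ‖f x‖ ^ 2 := by
  have hae := fourier_toLp_ae_eq hf hf2
  have hmem : MemLp (𝓕 f) 2 := (memLp_congr_ae hae).1 (Lp.memLp _)
  have hnorm : ∀ {g : ℝ → ℂ} (hg : MemLp g 2), ∫ x, ‖g x‖ ^ 2 = ‖hg.toLp g‖ ^ 2 := by
    intro g hg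
    rw [@norm_sq_eq_re_inner ℂ, L2.inner_def]
    have : ∫ x, inner ℂ (hg.toLp g x) (hg.toLp g x) = ((∫ x, ‖g x‖ ^ 2 : ℝ) : ℂ) := by
      rw [← integral_complex_ofReal]
      refine integral_congr_ae ?_
      filter_upwards [hg.coeFn_toLp] with x hx
      rw [hx, inner_self_eq_norm_sq_to_K]
      simp
    rw [this]
    simp
  refine ⟨(memLp_two_iff_integrable_sq_norm hmem.1).1 hmem, ?_⟩
  rw [hnorm hmem, hnorm hf2, ← Lp.norm_fourier_eq (hf2.toLp f)]
  congr 2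
  exact Lp.ext (hmem.coeFn_toLp.trans hae.symm)

/-- Plancherel's theorem for the Fourier integral over a finite window. -/
theorem integrable_and_integral_norm_sq_window {g : ℝ → ℂ} (hg : Continuous g) {T : ℝ}
    (hT : 0 ≤ T) :
    Integrable (fun ω : ℝ =>
      ‖∫ t in (-(T / 2))..(T / 2), Complex.exp (-(Complex.I * ω * t)) * g t‖ ^ 2) ∧
    ∫ ω : ℝ, ‖∫ t in (-(T / 2))..(T / 2), Complex.exp (-(Complex.I * ω * t)) * g t‖ ^ 2 =
      2 * Real.pi * ∫ t in (-(T / 2))..(T / 2), ‖g t‖ ^ 2 := by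
  have hle : -(T / 2) ≤ T / 2 := by linarith
  set f : ℝ → ℂ := (Set.Ioc (-(T / 2)) (T / 2)).indicator g with hfdef
  have hfi : Integrable f := by
    rw [hfdef, integrable_indicator_iff measurableSet_Ioc]
    exact (hg.integrableOn_Icc).mono_set Set.Ioc_subset_Icc_self
  have hf2 : MemLp f 2 := by
    rw [memLp_two_iff_integrable_sq_norm hfi.1]
    have : (fun x => ‖f x‖ ^ 2) = (Set.Ioc (-(T / 2)) (T / 2)).indicator (fun x => ‖g x‖ ^ 2) := by
      ext x
      by_cases hx : x ∈ Set.Ioc (-(T / 2)) (T / 2) <;> simp [hfdef, hx]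
    rw [this, integrable_indicator_iff measurableSet_Ioc]
    exact ((hg.norm.pow 2).integrableOn_Icc).mono_set Set.Ioc_subset_Icc_self
  obtain ⟨h1, h2⟩ := integrable_and_integral_norm_sq_fourier hfi hf2
  have hpi : (0 : ℝ) < 2 * Real.pi := by positivity
  -- The transform `𝓕` uses `exp(-2πi x t)`, hence a rescaling by `2π`, which returns as the factor
  -- `2π` in the integral.
  have hF : ∀ ω : ℝ, ∫ t in (-(T / 2))..(T / 2), Complex.exp (-(Complex.I * ω * t)) * g t =
      𝓕 f ((2 * Real.pi)⁻¹ * ω) := by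
    intro ω
    rw [Real.fourier_eq', intervalIntegral.integral_of_le hle,
      ← integral_indicator measurableSet_Ioc]
    refine integral_congr_ae (Filter.Eventually.of_forall fun t => ?_)
    by_cases ht : t ∈ Set.Ioc (-(T / 2)) (T / 2)
    · simp only [hfdef, Set.indicator_of_mem ht, smul_eq_mul]
      congr 2
      simp
      field_simp
    · simp [hfdef, ht]
  simp only [hF]
  refine ⟨h1.comp_mul_left' (inv_ne_zero hpi.ne'), ?_⟩
  rw [Measure.integral_comp_mul_left (fun x => ‖𝓕 f x‖ ^ 2), h2, inv_inv, abs_of_pos hpi,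
    smul_eq_mul, intervalIntegral.integral_of_le hle, ← integral_indicator measurableSet_Ioc]
  congr 2
  ext x
  by_cases hx : x ∈ Set.Ioc (-(T / 2)) (T / 2) <;> simp [hfdef, hx]

end Plancherel

/-! ### Windowed operator Fourier transforms in Hilbert–Schmidt norm. -/

section OpFourier

open MeasureTheory

variable {d : ℕ}

theorem continuous_exp_smul (H : Mat d) : Continuous fun z : ℂ => NormedSpace.exp (z • H) :=
  continuous_iff_continuousAt.2 fun z => (hasDerivAt_exp_smul_const (𝔸 := Mat d) H z).continuousAt

theorem continuous_heis (H A : Mat d) : Continuous (heis H A) := by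
  unfold heis
  exact (((continuous_exp_smul H).comp (by fun_prop : Continuous fun t : ℝ => Complex.I * t)).mul
    continuous_const).mul
    ((continuous_exp_smul H).comp (by fun_prop : Continuous fun t : ℝ => -(Complex.I * t)))

theorem continuous_opFourier (T : ℝ) (H A : Mat d) : Continuous (opFourier T H A) := by
  unfold opFourier
  have h : Continuous (Function.uncurry fun (ω t : ℝ) =>
      Complex.exp (-(Complex.I * ω * t)) • heis H A t) := by
    have := continuous_heis H A
    simp only [Function.uncurry_def]
    fun_prop
  exact (intervalIntegral.continuous_parametric_intervalIntegral_of_continuous' h _ _).const_smul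
    (((√(2 * Real.pi * T))⁻¹ : ℝ) : ℂ)

/-- The continuous linear functional `M ↦ (M Z) i j`. -/
def entryMul (Z : Mat d) (i j : Fin d) : Mat d →L[ℂ] ℂ :=
  LinearMap.toContinuousLinearMap ((Matrix.entryLinearMap ℂ ℂ i j).comp
    (LinearMap.mulRight ℂ Z))

theorem map_opFourier (φ : Mat d →L[ℂ] ℂ) (T : ℝ) (H A : Mat d) (ω : ℝ) :
    φ (opFourier T H A ω) = (((√(2 * Real.pi * T))⁻¹ : ℝ) : ℂ) *
      ∫ t in (-(T / 2))..(T / 2), Complex.exp (-(Complex.I * ω * t)) * φ (heis H A t) := by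
  have hc : Continuous fun t : ℝ => Complex.exp (-(Complex.I * ω * t)) • heis H A t := by
    have := continuous_heis H A
    fun_prop
  rw [opFourier, map_smul, smul_eq_mul,
    ← ContinuousLinearMap.intervalIntegral_comp_comm _ (hc.intervalIntegrable _ _)]
  simp only [map_smul, smul_eq_mul]

theorem opFourier_mul_apply (T : ℝ) (H A Z : Mat d) (ω : ℝ) (i j : Fin d) :
    (opFourier T H A ω * Z) i j = (((√(2 * Real.pi * T))⁻¹ : ℝ) : ℂ) *
      ∫ t in (-(T / 2))..(T / 2), Complex.exp (-(Complex.I * ω * t)) * (heis H A t * Z) i j :=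
  map_opFourier (entryMul Z i j) T H A ω

/-- Plancherel for each matrix entry; the normalization `(2πT)^(-1/2)` turns the integral over `ω`
into an average over the window. -/
theorem integrable_hsSq_opFourier_mul {T : ℝ} (hT : 0 < T) (H A Z : Mat d) :
    Integrable (fun ω => hsSq (opFourier T H A ω * Z)) ∧
    ∫ ω, hsSq (opFourier T H A ω * Z) =
      T⁻¹ * ∫ t in (-(T / 2))..(T / 2), hsSq (heis H A t * Z) := by
  have hc : ∀ i j, Continuous fun t : ℝ => (heis H A t * Z) i j := fun i j =>
    (entryMul Z i j).continuous.comp (continuous_heis H A)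
  have key := fun i j => integrable_and_integral_norm_sq_window (hc i j) hT.le
  have hK : (0 : ℝ) < 2 * Real.pi * T := by positivity
  have e : ∀ ω i j, ‖(opFourier T H A ω * Z) i j‖ ^ 2 = (2 * Real.pi * T)⁻¹ *
      ‖∫ t in (-(T / 2))..(T / 2), Complex.exp (-(Complex.I * ω * t)) * (heis H A t * Z) i j‖ ^ 2 := by
    intro ω i j
    rw [opFourier_mul_apply, norm_mul, Complex.norm_real, mul_pow, Real.norm_eq_abs, sq_abs,
      inv_pow, Real.sq_sqrt hK.le]
  have hint : ∀ i j, Integrable (fun ω => ‖(opFourier T H A ω * Z) i j‖ ^ 2) := fun i j => by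
    simp only [e]
    exact (key i j).1.const_mul _
  have hI : ∀ i j, IntervalIntegrable (fun t => ‖(heis H A t * Z) i j‖ ^ 2) volume
      (-(T / 2)) (T / 2) := fun i j => ((hc i j).norm.pow 2).intervalIntegrable _ _
  have hI' : ∀ i, IntervalIntegrable (fun t => ∑ j, ‖(heis H A t * Z) i j‖ ^ 2) volume
      (-(T / 2)) (T / 2) := fun i =>
    (continuous_finsetSum _ fun j _ => (hc i j).norm.pow 2).intervalIntegrable _ _
  unfold hsSq
  refine ⟨integrable_finsetSum _ fun i _ => integrable_finsetSum _ fun j _ => hint i j, ?_⟩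
  rw [integral_finsetSum _ fun i _ => integrable_finsetSum _ fun j _ => hint i j,
    intervalIntegral.integral_finsetSum fun i _ => hI' i, Finset.mul_sum]
  refine Finset.sum_congr rfl fun i _ => ?_
  rw [integral_finsetSum _ fun j _ => hint i j,
    intervalIntegral.integral_finsetSum fun j _ => hI i j, Finset.mul_sum]
  refine Finset.sum_congr rfl fun j _ => ?_
  simp only [e]
  rw [integral_const_mul, (key i j).2]
  field_simp

theorem exp_neg_mul_exp (X : Mat d) : NormedSpace.exp (-X) * NormedSpace.exp X = 1 := by
  rw [← Matrix.exp_add_of_commute _ _ (Commute.refl X).neg_left, neg_add_cancel,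
    NormedSpace.exp_zero]

theorem conjTranspose_exp_I_smul {H : Mat d} (hH : H.IsHermitian) (t : ℝ) :
    (NormedSpace.exp ((Complex.I * t) • H))ᴴ = NormedSpace.exp ((-(Complex.I * t)) • H) := by
  rw [← Matrix.exp_conjTranspose, Matrix.conjTranspose_smul, hH.eq]
  simp

theorem exp_I_smul_isometry {H : Mat d} (hH : H.IsHermitian) (t : ℝ) :
    (NormedSpace.exp ((Complex.I * t) • H))ᴴ * NormedSpace.exp ((Complex.I * t) • H) = 1 := by
  rw [conjTranspose_exp_I_smul hH, neg_smul, exp_neg_mul_exp]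

theorem exp_I_smul_coisometry {H : Mat d} (hH : H.IsHermitian) (t : ℝ) :
    NormedSpace.exp ((Complex.I * t) • H) * (NormedSpace.exp ((Complex.I * t) • H))ᴴ = 1 := by
  have := exp_neg_mul_exp (-((Complex.I * t) • H))
  rwa [neg_neg, ← neg_smul, ← conjTranspose_exp_I_smul hH] at this

theorem heis_eq {H : Mat d} (hH : H.IsHermitian) (A : Mat d) (t : ℝ) :
    heis H A t = NormedSpace.exp ((Complex.I * t) • H) * A *
      (NormedSpace.exp ((Complex.I * t) • H))ᴴ := by
  rw [heis, conjTranspose_exp_I_smul hH]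

theorem conjTranspose_heis {H : Mat d} (hH : H.IsHermitian) (A : Mat d) (t : ℝ) :
    (heis H A t)ᴴ = heis H Aᴴ t := by
  simp only [heis_eq hH, Matrix.conjTranspose_mul, Matrix.conjTranspose_conjTranspose,
    Matrix.mul_assoc]

theorem sum_hsSq_heis_mul_le {ι : Type*} [Fintype ι] {H : Mat d} (hH : H.IsHermitian)
    {A : ι → Mat d} (hA : ‖∑ a, (A a)ᴴ * A a‖ ≤ 1) (t : ℝ) (Z : Mat d) :
    ∑ a, hsSq (heis H (A a) t * Z) ≤ hsSq Z := by
  set U := NormedSpace.exp ((Complex.I * t) • H) with hU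
  have h1 : ∀ a, hsSq (heis H (A a) t * Z) = hsSq (A a * (Uᴴ * Z)) := fun a => by
    rw [heis_eq hH, Matrix.mul_assoc, Matrix.mul_assoc,
      hsSq_isometry_mul (exp_I_smul_isometry hH t)]
  simp only [h1]
  refine (sum_hsSq_mul_le A _).trans ((mul_le_of_le_one_left (hsSq_nonneg _) hA).trans
    (le_of_eq ?_))
  refine hsSq_isometry_mul ?_ Z
  rw [Matrix.conjTranspose_conjTranspose]
  exact exp_I_smul_coisometry hH t

/-- The total jump strength is at most one: a time average of `∑ Aᴴ A` in the Heisenberg picture.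
This controls every factor that stands beside a balance defect. -/
theorem sum_integral_hsSq_opFourier_mul_le {ι : Type*} [Fintype ι] {T : ℝ} (hT : 0 < T)
    {H : Mat d} (hH : H.IsHermitian) {A : ι → Mat d} (hA : ‖∑ a, (A a)ᴴ * A a‖ ≤ 1) (Z : Mat d) :
    ∑ a, ∫ ω, hsSq (opFourier T H (A a) ω * Z) ≤ hsSq Z := by
  have hc : ∀ a, Continuous fun t : ℝ => hsSq (heis H (A a) t * Z) := fun a => by
    unfold hsSq
    exact continuous_finsetSum _ fun i _ => continuous_finsetSum _ fun j _ =>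
      ((entryMul Z i j).continuous.comp (continuous_heis H (A a))).norm.pow 2
  simp only [(integrable_hsSq_opFourier_mul hT H _ Z).2]
  rw [← Finset.mul_sum, ← intervalIntegral.integral_finsetSum fun a _ =>
    (hc a).intervalIntegrable _ _]
  have h2 : ∫ t in (-(T / 2))..(T / 2), ∑ a, hsSq (heis H (A a) t * Z) ≤
      ∫ _ in (-(T / 2))..(T / 2), hsSq Z :=
    intervalIntegral.integral_mono_on (by linarith)
      ((continuous_finsetSum _ fun a _ => hc a).intervalIntegrable _ _)
      (continuous_const.intervalIntegrable _ _) fun t _ => sum_hsSq_heis_mul_le hH hA t Z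
  rw [intervalIntegral.integral_const, smul_eq_mul] at h2
  calc _ ≤ T⁻¹ * ((T / 2 - -(T / 2)) * hsSq Z) := by gcongr
    _ = hsSq Z := by field_simp; ring

end OpFourier

end CGME

end

noncomputable section

namespace CGME

open MeasureTheory

/-! ### The Fourier pair of rate and correlation function. -/

section FourierPair

/-- The Fourier integral `∫ c(t) exp(-iωt) dt`. -/
def fourierInt (c : ℝ → ℂ) (ω : ℝ) : ℂ := ∫ t : ℝ, c t * Complex.exp (-(Complex.I * ω * t))

theorem norm_exp_neg_I_mul (ω t : ℝ) : ‖Complex.exp (-(Complex.I * ω * t))‖ = 1 := by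
  have : -(Complex.I * ω * t) = ((-(ω * t) : ℝ) : ℂ) * Complex.I := by push_cast; ring
  rw [this, Complex.norm_exp_ofReal_mul_I]

theorem continuous_fourierInt {c : ℝ → ℂ} (hc : Integrable c) : Continuous (fourierInt c) := by
  refine continuous_of_dominated (bound := fun t => ‖c t‖) (fun ω => ?_) (fun ω => ?_) hc.norm ?_
  · exact hc.1.mul (by fun_prop : Continuous fun t : ℝ =>
      Complex.exp (-(Complex.I * ω * t))).aestronglyMeasurable
  · refine Filter.Eventually.of_forall fun t => ?_
    rw [norm_mul, norm_exp_neg_I_mul, mul_one]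
  · exact Filter.Eventually.of_forall fun t => by fun_prop

open FourierTransform in
/-- Injectivity of the Fourier integral on `L¹`. -/
theorem ae_eq_zero_of_fourierInt_eq_zero {f : ℝ → ℂ} (hf : Integrable f)
    (h : ∀ ω, fourierInt f ω = 0) : f =ᵐ[volume] 0 := by
  have h0 : 𝓕⁻ f = 0 := by
    ext w
    rw [Real.fourierInv_eq', Pi.zero_apply, ← h (-(2 * Real.pi * w))]
    refine integral_congr_ae (Filter.Eventually.of_forall fun t => ?_)
    simp only [smul_eq_mul]
    rw [mul_comm]
    congr 2
    simp
    ring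
  have := ae_eq_fourier_fourierInv hf (by rw [h0]; exact integrable_zero _ _ _)
  filter_upwards [this] with x hx
  rw [hx, h0, Real.fourier_eq]
  simp

/-- The inverse Fourier transform of a real function is conjugate symmetric. -/
theorem IsInverseFourier.conj_ae_eq {γ : ℝ → ℝ} {c : ℝ → ℂ} (h : IsInverseFourier γ c) :
    ∀ᵐ t : ℝ, star (c t) = c (-t) := by
  obtain ⟨hc, hγ⟩ := h
  have hc' : Integrable fun t => star (c (-t)) := by
    have : Integrable fun t => Complex.conjCLE.toContinuousLinearMap (c (-t)) :=
      Complex.conjCLE.toContinuousLinearMap.integrable_comp hc.comp_neg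
    exact this
  have hconj : ∀ ω, fourierInt (fun t => star (c (-t))) ω = star (fourierInt c ω) := by
    intro ω
    have e : star (fourierInt c ω) = ∫ t : ℝ, star (c t * Complex.exp (-(Complex.I * ω * t))) :=
      (integral_conj).symm
    rw [e, ← integral_neg_eq_self]
    refine integral_congr_ae (Filter.Eventually.of_forall fun t => ?_)
    simp only [star_mul', Complex.star_def, ← Complex.exp_conj]
    simp
  have hK : (((√(2 * Real.pi))⁻¹ : ℝ) : ℂ) ≠ 0 := by
    norm_cast; positivity
  -- The rate is real, so the transform of `c` is real almost everywhere, and by continuity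
  -- everywhere. Injectivity then compares `c` with its reflected conjugate.
  have hreal : ∀ ω, star (fourierInt c ω) = fourierInt c ω := by
    have hcont := continuous_fourierInt hc
    have : (fun ω => star (fourierInt c ω)) =ᵐ[volume] fourierInt c := by
      filter_upwards [hγ] with ω hω
      change _ = _ * fourierInt c ω at hω
      have h2 := congrArg star hω
      rw [star_mul', Complex.star_def, Complex.conj_ofReal, Complex.conj_ofReal, hω] at h2
      exact (mul_left_cancel₀ hK h2).symm
    exact fun ω => congrFun ((Continuous.ae_eq_iff_eq volume (by fun_prop) hcont).1 this) ω
  have hsub : ∀ ω, fourierInt (fun t => c t - star (c (-t))) ω = 0 := by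
    intro ω
    have e : fourierInt (fun t => c t - star (c (-t))) ω =
        fourierInt c ω - fourierInt (fun t => star (c (-t))) ω := by
      unfold fourierInt
      rw [← integral_sub]
      · simp only [sub_mul]
      · exact (hc.mul_bdd (c := 1) (by fun_prop : Continuous fun t : ℝ =>
          Complex.exp (-(Complex.I * ω * t))).aestronglyMeasurable
          (Filter.Eventually.of_forall fun t => (norm_exp_neg_I_mul ω t).le))
      · exact (hc'.mul_bdd (c := 1) (by fun_prop : Continuous fun t : ℝ =>
          Complex.exp (-(Complex.I * ω * t))).aestronglyMeasurable
          (Filter.Eventually.of_forall fun t => (norm_exp_neg_I_mul ω t).le))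
    rw [e, hconj, hreal, sub_self]
  have h1 := ae_eq_zero_of_fourierInt_eq_zero (hc.sub hc') hsub
  filter_upwards [h1] with t ht
  have ht' : c t = star (c (-t)) := sub_eq_zero.1 ht
  rw [ht', star_star]

theorem IsInverseFourier.aestronglyMeasurable {γ : ℝ → ℝ} {c : ℝ → ℂ}
    (h : IsInverseFourier γ c) : AEStronglyMeasurable (fun ω => (γ ω : ℂ)) volume := by
  refine ⟨fun ω => (((√(2 * Real.pi))⁻¹ : ℝ) : ℂ) * fourierInt c ω, ?_, h.2⟩
  exact (continuous_const.mul (continuous_fourierInt h.1)).stronglyMeasurable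

end FourierPair

/-! ### Integrability of families of superoperators. -/

section Dissipator

variable {R : Type*} [NormedRing R] [NormedAlgebra ℂ R]

theorem integrable_smul_mulLeftRight {g : ℝ → ℂ} (hgm : AEStronglyMeasurable g volume)
    (hg : ∀ ω, ‖g ω‖ ≤ 1) {K L : ℝ → R} (hK : Continuous K) (hL : Continuous L) {b : ℝ → ℝ}
    (hb : Integrable b) (hle : ∀ ω, ‖K ω‖ * ‖L ω‖ ≤ b ω) :
    Integrable fun ω => g ω • ContinuousLinearMap.mulLeftRight ℂ R (K ω) (L ω) := by
  have hcont : Continuous fun ω => ContinuousLinearMap.mulLeftRight ℂ R (K ω) (L ω) := by fun_prop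
  refine hb.mono' (hgm.smul hcont.aestronglyMeasurable) (Filter.Eventually.of_forall fun ω => ?_)
  rw [norm_smul]
  refine (mul_le_of_le_one_left (norm_nonneg _) (hg ω)).trans (le_trans ?_ (hle ω))
  exact ContinuousLinearMap.opNorm_mulLeftRight_apply_apply_le ℂ R (K ω) (L ω)

/-- The anticommutator multiplies by the unit on one side, so the unit must have norm one; for
matrices this amounts to `d > 0`. -/
theorem integrable_smul_mulLeftRight_dissipator [NormOneClass R] {g : ℝ → ℂ}
    (hgm : AEStronglyMeasurable g volume)
    (hg : ∀ ω, ‖g ω‖ ≤ 1) {K L : ℝ → R} (hK : Continuous K) (hL : Continuous L) {b : ℝ → ℝ}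
    (hb : Integrable b) (hle : ∀ ω, ‖K ω‖ * ‖L ω‖ ≤ b ω) :
    Integrable fun ω => g ω • (ContinuousLinearMap.mulLeftRight ℂ R (K ω) (L ω) -
      (1 / 2 : ℂ) • (ContinuousLinearMap.mulLeftRight ℂ R (L ω * K ω) 1 +
        ContinuousLinearMap.mulLeftRight ℂ R 1 (L ω * K ω))) := by
  have h1 := integrable_smul_mulLeftRight hgm hg hK hL hb hle
  have hle' : ∀ ω, ‖L ω * K ω‖ ≤ b ω := fun ω =>
    (norm_mul_le _ _).trans (by rw [mul_comm]; exact hle ω)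
  have h2 := integrable_smul_mulLeftRight hgm hg (hL.mul hK) (continuous_const (y := (1 : R))) hb
    (fun ω => by simpa using hle' ω)
  have h3 := integrable_smul_mulLeftRight hgm hg (continuous_const (y := (1 : R))) (hL.mul hK) hb
    (fun ω => by simpa using hle' ω)
  refine (h1.sub ((h2.add h3).smul (1 / 2 : ℂ))).congr (Filter.Eventually.of_forall fun ω => ?_)
  simp only [Pi.sub_apply, Pi.smul_apply, Pi.add_apply, smul_sub, smul_add, smul_comm (g ω),
    Pi.mul_apply]

end Dissipator

/-! ### The dissipative part and the Lindblad form of the generator. -/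

section DissGenerator

variable {d : ℕ}

theorem dissipator_apply (K X : Mat d) :
    dissipator K X = K * X * Kᴴ - (1 / 2 : ℂ) • (Kᴴ * K * X + X * (Kᴴ * K)) := by
  change sandwich K Kᴴ X - (1 / 2 : ℂ) • (sandwich (Kᴴ * K) 1 X + sandwich 1 (Kᴴ * K) X) = _
  simp only [sandwich_apply, Matrix.mul_one, Matrix.one_mul]

theorem trace_dissipator (K X : Mat d) : (dissipator K X).trace = 0 := by
  have h1 : (K * X * Kᴴ).trace = (Kᴴ * K * X).trace := by
    rw [Matrix.trace_mul_comm, ← Matrix.mul_assoc]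
  have h2 : (X * (Kᴴ * K)).trace = (Kᴴ * K * X).trace := Matrix.trace_mul_comm _ _
  rw [dissipator_apply, Matrix.trace_sub, Matrix.trace_smul, Matrix.trace_add, h1, h2, smul_eq_mul]
  ring

/-- Admissible rates: measurable with values in `[0, 1]`. -/
structure IsRate (γ : ℝ → ℝ) : Prop where
  aestronglyMeasurable : AEStronglyMeasurable (fun ω => (γ ω : ℂ)) volume
  nonneg : ∀ ω, 0 ≤ γ ω
  le_one : ∀ ω, γ ω ≤ 1

theorem IsRate.norm_le_one {γ : ℝ → ℝ} (h : IsRate γ) (ω : ℝ) : ‖(γ ω : ℂ)‖ ≤ 1 := by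
  rw [Complex.norm_real, Real.norm_of_nonneg (h.nonneg ω)]
  exact h.le_one ω

variable {T : ℝ} {γ : ℝ → ℝ}

theorem integrable_hsSq_opFourier (hT : 0 < T) (H A : Mat d) :
    Integrable fun ω => hsSq (opFourier T H A ω) := by
  simpa using (integrable_hsSq_opFourier_mul hT H A 1).1

theorem norm_mul_norm_conjTranspose_le (K : Mat d) : ‖K‖ * ‖Kᴴ‖ ≤ hsSq K := by
  rw [Matrix.l2_opNorm_conjTranspose]
  have := norm_le_sqrt_hsSq K
  have h2 := mul_self_le_mul_self (norm_nonneg _) this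
  rwa [Real.mul_self_sqrt (hsSq_nonneg _)] at h2

theorem integrable_sandwich_opFourier (hT : 0 < T) (hγ : IsRate γ) (H A : Mat d) :
    Integrable fun ω => (γ ω : ℂ) • sandwich (opFourier T H A ω) (opFourier T H A ω)ᴴ :=
  integrable_smul_mulLeftRight (R := Mat d) hγ.aestronglyMeasurable hγ.norm_le_one
    (continuous_opFourier T H A) (continuous_opFourier T H A).matrix_conjTranspose
    (integrable_hsSq_opFourier hT H A) fun _ => norm_mul_norm_conjTranspose_le _

theorem integrable_dissipator_opFourier [NeZero d] (hT : 0 < T) (hγ : IsRate γ) (H A : Mat d) :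
    Integrable fun ω => (γ ω : ℂ) • dissipator (opFourier T H A ω) := by
  exact integrable_smul_mulLeftRight_dissipator (R := Mat d) hγ.aestronglyMeasurable hγ.norm_le_one
    (continuous_opFourier T H A) (continuous_opFourier T H A).matrix_conjTranspose
    (integrable_hsSq_opFourier hT H A) fun _ => norm_mul_norm_conjTranspose_le _

theorem integrable_conjTranspose_mul_opFourier (hT : 0 < T) (hγ : IsRate γ) (H A : Mat d) :
    Integrable fun ω => (γ ω : ℂ) • ((opFourier T H A ω)ᴴ * opFourier T H A ω) := by
  have hc := continuous_opFourier T H A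
  refine (integrable_hsSq_opFourier hT H A).mono'
    (hγ.aestronglyMeasurable.smul (hc.matrix_conjTranspose.mul hc).aestronglyMeasurable)
    (Filter.Eventually.of_forall fun ω => ?_)
  rw [norm_smul]
  refine (mul_le_of_le_one_left (norm_nonneg _) (hγ.norm_le_one ω)).trans ?_
  refine (norm_mul_le _ _).trans ?_
  rw [mul_comm]
  exact norm_mul_norm_conjTranspose_le _

theorem dissGenerator_apply [NeZero d] {m : ℕ} (hT : 0 < T) (hγ : IsRate γ) (H : Mat d)
    (A : Fin m → Mat d) (X : Mat d) : dissGenerator T H A γ X =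
      ∑ a, ∫ ω, (γ ω : ℂ) • dissipator (opFourier T H (A a) ω) X := by
  unfold dissGenerator
  rw [sum_apply]
  refine Finset.sum_congr rfl fun a _ => ?_
  rw [integral_superOp_apply (integrable_dissipator_opFourier hT hγ H (A a))]
  rfl

theorem integrable_dissipator_opFourier_apply [NeZero d] (hT : 0 < T) (hγ : IsRate γ)
    (H A X : Mat d) : Integrable fun ω => (γ ω : ℂ) • dissipator (opFourier T H A ω) X :=
  integrable_superOp_apply (integrable_dissipator_opFourier hT hγ H A) X

/-- The decay operator `∑_a ∫ γ(ω) Â^a(ω)† Â^a(ω) dω`. -/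
def decayOp {m : ℕ} (T : ℝ) (H : Mat d) (A : Fin m → Mat d) (γ : ℝ → ℝ) : Mat d :=
  ∑ a, ∫ ω, (γ ω : ℂ) • ((opFourier T H (A a) ω)ᴴ * opFourier T H (A a) ω)

/-- The jump part `ρ ↦ ∑_a ∫ γ(ω) Â^a(ω) ρ Â^a(ω)† dω`. -/
def jumpPart {m : ℕ} (T : ℝ) (H : Mat d) (A : Fin m → Mat d) (γ : ℝ → ℝ) : SuperOp d :=
  ∑ a, ∫ ω, (γ ω : ℂ) • sandwich (opFourier T H (A a) ω) (opFourier T H (A a) ω)ᴴ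

theorem conjTranspose_integral {α : Type*} [MeasurableSpace α] {μ : Measure α} (F : α → Mat d) :
    (∫ x, F x ∂μ)ᴴ = ∫ x, (F x)ᴴ ∂μ :=
  ((starL' ℝ : Mat d ≃L[ℝ] Mat d).integral_comp_comm F).symm

theorem conjTranspose_decayOp {m : ℕ} (T : ℝ) (H : Mat d) (A : Fin m → Mat d) (γ : ℝ → ℝ) :
    (decayOp T H A γ)ᴴ = decayOp T H A γ := by
  unfold decayOp
  rw [Matrix.conjTranspose_sum]
  refine Finset.sum_congr rfl fun a _ => ?_
  rw [conjTranspose_integral]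
  simp only [Matrix.conjTranspose_smul, Matrix.conjTranspose_mul,
    Matrix.conjTranspose_conjTranspose, Complex.star_def, Complex.conj_ofReal]

theorem traceDominated_jumpPart {m : ℕ} (hT : 0 < T) (hγ : IsRate γ) (H : Mat d)
    (A : Fin m → Mat d) : TraceDominated (jumpPart T H A γ) :=
  TraceDominated.sum fun a _ => TraceDominated.integral (integrable_sandwich_opFourier hT hγ H (A a))
    fun ω => (traceDominated_sandwich _).smul (hγ.nonneg ω)

/-- Separates the completely positive jumps from a Hermitian drift, which is the shape that
`IsLindbladian` requires. -/
theorem dissGenerator_apply_eq [NeZero d] {m : ℕ} (hT : 0 < T) (hγ : IsRate γ) (H : Mat d)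
    (A : Fin m → Mat d) (X : Mat d) : dissGenerator T H A γ X = jumpPart T H A γ X -
      (1 / 2 : ℂ) • (decayOp T H A γ * X + X * decayOp T H A γ) := by
  rw [dissGenerator_apply hT hγ, jumpPart, sum_apply, decayOp, Finset.sum_mul, Finset.mul_sum,
    ← Finset.sum_add_distrib, Finset.smul_sum, ← Finset.sum_sub_distrib]
  refine Finset.sum_congr rfl fun a _ => ?_
  have h1 := integrable_conjTranspose_mul_opFourier hT hγ H (A a)
  have h2 := integrable_superOp_apply (integrable_sandwich_opFourier hT hγ H (A a)) X
  have hl : Integrable fun ω => (γ ω : ℂ) •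
      ((opFourier T H (A a) ω)ᴴ * opFourier T H (A a) ω) * X := h1.mul_const X
  have hr : Integrable fun ω => X * (γ ω : ℂ) •
      ((opFourier T H (A a) ω)ᴴ * opFourier T H (A a) ω) := h1.const_mul X
  have hlr : Integrable fun ω => (1 / 2 : ℂ) • ((γ ω : ℂ) •
      ((opFourier T H (A a) ω)ᴴ * opFourier T H (A a) ω) * X + X * (γ ω : ℂ) •
      ((opFourier T H (A a) ω)ᴴ * opFourier T H (A a) ω)) := (hl.add hr).smul (1 / 2 : ℂ)
  rw [integral_superOp_apply (integrable_sandwich_opFourier hT hγ H (A a)),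
    ← integral_mul_const_of_integrable h1, ← integral_const_mul_of_integrable h1,
    ← integral_add hl hr, ← integral_smul, ← integral_sub h2 hlr]
  refine integral_congr_ae (Filter.Eventually.of_forall fun ω => ?_)
  simp only [dissipator_apply]
  change _ = (γ ω : ℂ) • sandwich _ _ X - _
  simp only [sandwich_apply, smul_sub, smul_add, Matrix.smul_mul, Matrix.mul_smul,
    smul_comm (γ ω : ℂ) (1 / 2 : ℂ)]

theorem trace_dissGenerator [NeZero d] {m : ℕ} (hT : 0 < T) (hγ : IsRate γ) (H : Mat d)
    (A : Fin m → Mat d) (X : Mat d) : (dissGenerator T H A γ X).trace = 0 := by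
  rw [dissGenerator_apply hT hγ, Matrix.trace_sum]
  refine Finset.sum_eq_zero fun a _ => ?_
  have h : ∀ Y : Mat d, Y.trace = traceMul 1 Y := fun Y => by simp
  rw [h, ← (traceMul 1).integral_comp_comm (integrable_dissipator_opFourier_apply hT hγ H (A a) X)]
  simp [trace_dissipator]

theorem hamiltonianPart_apply (G X : Mat d) :
    hamiltonianPart G X = (-Complex.I) • (G * X - X * G) := by
  change (-Complex.I) • (sandwich G 1 X - sandwich 1 G X) = _
  simp only [sandwich_apply, Matrix.mul_one, Matrix.one_mul]

/-- The generator of the coarse-grained master equation has Lindblad form. -/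
theorem isLindbladian_cgmeGenerator [NeZero d] {m : ℕ} (hT : 0 < T) (hγ : IsRate γ) (H : Mat d)
    (A : Fin m → Mat d) (c : ℝ → ℂ) (hW : (lambShift T H A c).IsHermitian) :
    IsLindbladian (cgmeGenerator T H A γ c) := by
  have happ : ∀ X, cgmeGenerator T H A γ c X =
      hamiltonianPart (lambShift T H A c) X + dissGenerator T H A γ X := fun X => rfl
  refine ⟨⟨jumpPart T H A γ, (-Complex.I) • lambShift T H A c - (1 / 2 : ℂ) • decayOp T H A γ,
    traceDominated_jumpPart hT hγ H A, fun X => ?_⟩, fun X => ?_⟩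
  · have hstar : star (1 / 2 : ℂ) = 1 / 2 := by simp
    have hstarI : star (-Complex.I) = Complex.I := by simp
    rw [happ, hamiltonianPart_apply, dissGenerator_apply_eq hT hγ, Matrix.conjTranspose_sub,
      Matrix.conjTranspose_smul, Matrix.conjTranspose_smul, hW.eq, conjTranspose_decayOp, hstar,
      hstarI]
    simp only [Matrix.sub_mul, Matrix.mul_sub, Matrix.smul_mul, Matrix.mul_smul, smul_sub,
      smul_add, neg_smul, Matrix.neg_mul]
    abel
  · rw [happ, Matrix.trace_add, trace_dissGenerator hT hγ, hamiltonianPart_apply,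
      Matrix.trace_smul, Matrix.trace_sub, Matrix.trace_mul_comm]
    simp

end DissGenerator

end CGME

end

noncomputable section

namespace CGME

open MeasureTheory

/-! ### The kernel of the Lamb shift. -/

section Kernel

theorem measurable_sign : Measurable Real.sign := by
  unfold Real.sign
  exact Measurable.ite measurableSet_Iio measurable_const
    (Measurable.ite measurableSet_Ioi measurable_const measurable_const)

theorem abs_sign_le_one (x : ℝ) : |Real.sign x| ≤ 1 := by
  rcases Real.sign_apply_eq x with h | h | h <;> simp [h]

/-- Turns `c (t₂ - t₁)` into a function of one coordinate, so that a strip of width `w` carries mass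
`w ‖c‖₁`. -/
theorem measurePreserving_shear (μ : Measure ℝ) [SFinite μ] :
    MeasurePreserving (fun p : ℝ × ℝ => (p.1, p.2 - p.1)) (μ.prod volume) (μ.prod volume) := by
  have := measurePreserving_prod_neg_add μ (volume : Measure ℝ)
  simpa only [neg_add_eq_sub] using this

/-- The kernel `sgn(t₁ - t₂) c(t₂ - t₁)`. -/
def signKernel (c : ℝ → ℂ) (p : ℝ × ℝ) : ℂ := (Real.sign (p.1 - p.2) : ℂ) * c (p.2 - p.1)

variable {c : ℝ → ℂ}

theorem norm_signKernel_le (c : ℝ → ℂ) (p : ℝ × ℝ) : ‖signKernel c p‖ ≤ ‖c (p.2 - p.1)‖ := by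
  rw [signKernel, norm_mul, Complex.norm_real]
  exact mul_le_of_le_one_left (norm_nonneg _) (abs_sign_le_one _)

theorem aestronglyMeasurable_signKernel (hc : Integrable c) :
    AEStronglyMeasurable (signKernel c) (volume : Measure (ℝ × ℝ)) := by
  have h1 : AEStronglyMeasurable (fun p : ℝ × ℝ => c (p.2 - p.1)) volume :=
    (hc.1.comp_snd (μ := (volume : Measure ℝ))).comp_measurePreserving
      (measurePreserving_shear volume)
  have h2 : Measurable fun p : ℝ × ℝ => (Real.sign (p.1 - p.2) : ℂ) :=
    Complex.measurable_ofReal.comp (measurable_sign.comp (measurable_fst.sub measurable_snd))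
  exact h2.aestronglyMeasurable.mul h1

theorem integrableOn_comp_sub (hc : Integrable c) {J : Set ℝ} (hJ : volume J ≠ ∞) :
    IntegrableOn (fun p : ℝ × ℝ => c (p.2 - p.1)) (J ×ˢ Set.univ) ∧
      ∫ p in J ×ˢ (Set.univ : Set ℝ), ‖c (p.2 - p.1)‖ = volume.real J * ∫ t, ‖c t‖ := by
  have hfin : IsFiniteMeasure (volume.restrict J) := ⟨by simpa using hJ.lt_top⟩
  have hm : ((volume : Measure (ℝ × ℝ)).restrict (J ×ˢ Set.univ)) =
      (volume.restrict J).prod volume := by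
    rw [Measure.volume_eq_prod, ← Measure.prod_restrict, Measure.restrict_univ]
  have hi : Integrable (fun p : ℝ × ℝ => c (p.2 - p.1)) ((volume.restrict J).prod volume) :=
    (measurePreserving_shear (volume.restrict J)).integrable_comp_of_integrable
      (hc.comp_snd (volume.restrict J))
  rw [IntegrableOn, hm]
  refine ⟨hi, ?_⟩
  rw [integral_prod _ hi.norm]
  have : ∀ x : ℝ, ∫ y, ‖c (y - x)‖ = ∫ t, ‖c t‖ := fun x =>
    integral_sub_right_eq_self (fun t => ‖c t‖) x
  simp only [this]
  rw [setIntegral_const, smul_eq_mul]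

theorem integrableOn_comp_sub' (hc : Integrable c) {J : Set ℝ} (hJ : volume J ≠ ∞) :
    IntegrableOn (fun p : ℝ × ℝ => c (p.2 - p.1)) (Set.univ ×ˢ J) ∧
      ∫ p in (Set.univ : Set ℝ) ×ˢ J, ‖c (p.2 - p.1)‖ = volume.real J * ∫ t, ‖c t‖ := by
  obtain ⟨h1, h2⟩ := integrableOn_comp_sub hc.comp_neg hJ
  have hc' : ∫ t, ‖c (-t)‖ = ∫ t, ‖c t‖ := integral_neg_eq_self (fun t => ‖c t‖) volume
  simp only [neg_sub] at h1 h2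
  rw [hc'] at h2
  constructor
  · rw [Measure.volume_eq_prod] at h1 ⊢
    exact h1.swap
  · rw [← h2, Measure.volume_eq_prod, ← setIntegral_prod_swap]
    rfl

end Kernel

/-! ### The Lamb shift: Hermitian, bounded, nearly commuting with `H`. -/

section Lamb

variable {d : ℕ}

/-- Test with the matrix all of whose `d` columns equal `x`. -/
theorem norm_le_one_of_hsSq_mul_le {M : Mat d} (h : ∀ B, hsSq (M * B) ≤ hsSq B) : ‖M‖ ≤ 1 := by
  rw [Matrix.l2_opNorm_def]
  refine ContinuousLinearMap.opNorm_le_bound _ zero_le_one fun x => ?_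
  rw [one_mul, EuclideanSpace.norm_eq, EuclideanSpace.norm_eq]
  refine Real.sqrt_le_sqrt ?_
  have h1 := h (Matrix.of fun i _ => x i)
  simp only [hsSq, Matrix.mul_apply, Matrix.of_apply, Finset.sum_const, Finset.card_univ,
    Fintype.card_fin, nsmul_eq_mul, ← Finset.mul_sum] at h1
  rcases Nat.eq_zero_or_pos d with rfl | hd
  · simp
  · have := le_of_mul_le_mul_left h1 (by exact_mod_cast hd)
    simpa [Matrix.mulVec, dotProduct] using! this

variable {m : ℕ} {H : Mat d} {A : Fin m → Mat d}

/-- The two-point operator `∑_a A^a(t₂)† A^a(t₁)`. -/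
def twoPoint (H : Mat d) (A : Fin m → Mat d) (p : ℝ × ℝ) : Mat d :=
  ∑ a, heis H (A a)ᴴ p.2 * heis H (A a) p.1

theorem continuous_heis_mul_heis (H A : Mat d) :
    Continuous fun p : ℝ × ℝ => heis H Aᴴ p.2 * heis H A p.1 :=
  ((continuous_heis H Aᴴ).comp continuous_snd).mul ((continuous_heis H A).comp continuous_fst)

theorem continuous_twoPoint (H : Mat d) (A : Fin m → Mat d) : Continuous (twoPoint H A) :=
  continuous_finsetSum _ fun a _ => continuous_heis_mul_heis H (A a)

/-- A self-bounding argument. With `M` the two-point operator, expanding one copy of `M` in `‖M B‖²`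
and applying Cauchy–Schwarz gives `‖M B‖² ≤ ½ (‖M B‖² + ‖B‖²)`. -/
theorem norm_twoPoint_le (hH : H.IsHermitian) (hA : ‖∑ a, (A a)ᴴ * A a‖ ≤ 1) (p : ℝ × ℝ) :
    ‖twoPoint H A p‖ ≤ 1 := by
  refine norm_le_one_of_hsSq_mul_le fun B => ?_
  set M := twoPoint H A p with hM
  have h1 : ((hsSq (M * B) : ℝ) : ℂ) =
      ∑ a, ((heis H (A a) p.2 * (M * B))ᴴ * (heis H (A a) p.1 * B)).trace := by
    rw [← trace_conjTranspose_mul_self, ← Matrix.trace_sum]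
    congr 1
    have h0 : M * B = ∑ a, heis H (A a)ᴴ p.2 * heis H (A a) p.1 * B := by
      rw [hM, twoPoint, Finset.sum_mul]
    conv_lhs => rw [congrArg ((M * B)ᴴ * ·) h0, Finset.mul_sum]
    refine Finset.sum_congr rfl fun a _ => ?_
    simp only [Matrix.conjTranspose_mul, conjTranspose_heis hH, Matrix.mul_assoc]
  have h2 : hsSq (M * B) ≤ (1 / 2) * (hsSq (M * B) + hsSq B) := by
    calc hsSq (M * B) = ‖((hsSq (M * B) : ℝ) : ℂ)‖ := by
          rw [Complex.norm_real, Real.norm_of_nonneg (hsSq_nonneg _)]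
      _ ≤ ∑ a, (1 / 2) * (hsSq (heis H (A a) p.2 * (M * B)) + hsSq (heis H (A a) p.1 * B)) := by
          rw [h1]
          refine (norm_sum_le _ _).trans (Finset.sum_le_sum fun a _ => ?_)
          refine (norm_trace_mul_le_half _ _).trans (le_of_eq ?_)
          rw [hsSq_conjTranspose]
      _ = (1 / 2) * (∑ a, hsSq (heis H (A a) p.2 * (M * B)) +
            ∑ a, hsSq (heis H (A a) p.1 * B)) := by
          rw [← Finset.mul_sum, Finset.sum_add_distrib]
      _ ≤ _ := by
          gcongr <;> exact sum_hsSq_heis_mul_le hH hA _ _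
  linarith

theorem heis_mul_heis (hH : H.IsHermitian) (X Y : Mat d) (t : ℝ) :
    heis H X t * heis H Y t = heis H (X * Y) t := by
  rw [heis_eq hH, heis_eq hH, heis_eq hH]
  calc _ = NormedSpace.exp ((Complex.I * t) • H) * X * ((NormedSpace.exp ((Complex.I * t) • H))ᴴ *
        NormedSpace.exp ((Complex.I * t) • H)) * Y * (NormedSpace.exp ((Complex.I * t) • H))ᴴ := by
        simp only [Matrix.mul_assoc]
    _ = _ := by rw [exp_I_smul_isometry hH, Matrix.mul_one]; simp only [Matrix.mul_assoc]

theorem heis_heis (H X : Mat d) (s t : ℝ) : heis H (heis H X s) t = heis H X (s + t) := by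
  have h : ∀ z w : ℂ, NormedSpace.exp (z • H) * NormedSpace.exp (w • H) =
      NormedSpace.exp ((z + w) • H) := fun z w => by
    rw [add_smul, Matrix.exp_add_of_commute]
    exact ((Commute.refl H).smul_left z).smul_right w
  have e1 : Complex.I * ((s + t : ℝ) : ℂ) = Complex.I * t + Complex.I * s := by push_cast; ring
  have e2 : -(Complex.I * t + Complex.I * s) = -(Complex.I * s) + -(Complex.I * t) := by ring
  unfold heis
  rw [e1, e2, ← h, ← h]
  simp only [Matrix.mul_assoc]

/-- A common shift of both times is a unitary conjugation. Since the kernel depends on time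
differences only, the integrand of the Lamb shift inherits this. -/
theorem twoPoint_add (hH : H.IsHermitian) (p : ℝ × ℝ) (h : ℝ) :
    twoPoint H A (p + (h, h)) = heis H (twoPoint H A p) h := by
  have hs : ∀ X : Fin m → Mat d, heis H (∑ a, X a) h = ∑ a, heis H (X a) h := fun X => by
    simp only [heis, Finset.mul_sum, Finset.sum_mul]
  rw [twoPoint, twoPoint, hs]
  refine Finset.sum_congr rfl fun a _ => ?_
  rw [← heis_mul_heis hH, heis_heis, heis_heis, Prod.snd_add, Prod.fst_add]

theorem conjTranspose_twoPoint (hH : H.IsHermitian) (p : ℝ × ℝ) :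
    (twoPoint H A p)ᴴ = twoPoint H A p.swap := by
  simp only [twoPoint, Matrix.conjTranspose_sum, Matrix.conjTranspose_mul, conjTranspose_heis hH,
    Matrix.conjTranspose_conjTranspose, Prod.fst_swap, Prod.snd_swap]

/-- The integrand of the Lamb shift. -/
def lambIntegrand (H : Mat d) (A : Fin m → Mat d) (c : ℝ → ℂ) (p : ℝ × ℝ) : Mat d :=
  signKernel c p • twoPoint H A p

variable {c : ℝ → ℂ}

theorem norm_lambIntegrand_le (hH : H.IsHermitian) (hA : ‖∑ a, (A a)ᴴ * A a‖ ≤ 1) (p : ℝ × ℝ) :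
    ‖lambIntegrand H A c p‖ ≤ ‖c (p.2 - p.1)‖ := by
  rw [lambIntegrand, norm_smul]
  exact (mul_le_of_le_one_right (norm_nonneg _) (norm_twoPoint_le hH hA p)).trans
    (norm_signKernel_le c p)

theorem aestronglyMeasurable_lambIntegrand (hc : Integrable c) :
    AEStronglyMeasurable (lambIntegrand H A c) volume :=
  (aestronglyMeasurable_signKernel hc).smul (continuous_twoPoint H A).aestronglyMeasurable

theorem norm_heis_le (hH : H.IsHermitian) (X : Mat d) (t : ℝ) : ‖heis H X t‖ ≤ ‖X‖ := by
  have h1 := norm_le_one_of_isometry (exp_I_smul_isometry hH t)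
  rw [heis_eq hH]
  refine (norm_mul_le _ _).trans ?_
  rw [Matrix.l2_opNorm_conjTranspose]
  refine (mul_le_of_le_one_right (norm_nonneg _) h1).trans ?_
  exact (norm_mul_le _ _).trans (mul_le_of_le_one_left (norm_nonneg _) h1)

theorem volume_Ioc_ne_top (a b : ℝ) : volume (Set.Ioc a b) ≠ ∞ := by simp

theorem integrableOn_comp_sub_square (hc : Integrable c) {S : Set ℝ} (hS : volume S ≠ ∞) :
    IntegrableOn (fun p : ℝ × ℝ => c (p.2 - p.1)) (S ×ˢ S) :=
  (integrableOn_comp_sub hc hS).1.mono_set (Set.prod_mono_right (Set.subset_univ _))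

theorem integrableOn_lambIntegrand (hH : H.IsHermitian) (hA : ‖∑ a, (A a)ᴴ * A a‖ ≤ 1)
    (hc : Integrable c) {S : Set ℝ} (hS : volume S ≠ ∞) :
    IntegrableOn (lambIntegrand H A c) (S ×ˢ S) :=
  (integrableOn_comp_sub_square hc hS).norm.mono' (aestronglyMeasurable_lambIntegrand hc).restrict
    (Filter.Eventually.of_forall fun p => norm_lambIntegrand_le hH hA p)

/-- Moving the sum over `a` inside one double integral lets the joint bound on `twoPoint` act, so
that no factor `m` appears. -/
theorem lambShift_eq (hH : H.IsHermitian) (hc : Integrable c) {T : ℝ} (hT : 0 < T) :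
    lambShift T H A c = (Complex.I / (2 * √(2 * Real.pi) * T : ℝ)) •
      ∫ p in Set.Ioc (-(T / 2)) (T / 2) ×ˢ Set.Ioc (-(T / 2)) (T / 2), lambIntegrand H A c p := by
  have hle : -(T / 2) ≤ T / 2 := by linarith
  have hint : ∀ a, IntegrableOn (fun p : ℝ × ℝ => signKernel c p •
      (heis H (A a)ᴴ p.2 * heis H (A a) p.1))
      (Set.Ioc (-(T / 2)) (T / 2) ×ˢ Set.Ioc (-(T / 2)) (T / 2)) := by
    intro a
    refine ((integrableOn_comp_sub_square hc (volume_Ioc_ne_top _ _)).norm.mul_const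
      (‖(A a)ᴴ‖ * ‖A a‖)).mono' ((aestronglyMeasurable_signKernel hc).smul
      (continuous_heis_mul_heis H (A a)).aestronglyMeasurable).restrict
      (Filter.Eventually.of_forall fun p => ?_)
    rw [norm_smul]
    gcongr
    · exact norm_signKernel_le c p
    · refine (norm_mul_le _ _).trans ?_
      gcongr <;> exact norm_heis_le hH _ _
  rw [lambShift, ← Finset.smul_sum]
  congr 1
  simp only [lambIntegrand, twoPoint, Finset.smul_sum]
  rw [integral_finsetSum _ fun a _ => hint a]
  refine Finset.sum_congr rfl fun a _ => ?_
  have h := hint a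
  rw [Measure.volume_eq_prod] at h ⊢
  rw [setIntegral_prod _ h, intervalIntegral.integral_of_le hle]
  simp only [intervalIntegral.integral_of_le hle]
  rfl

/-- The adjoint exchanges the two times. The sign changes, `c` goes to its conjugate reflection, so
the integral is anti-Hermitian, and the imaginary prefactor compensates. -/
theorem isHermitian_lambShift (hH : H.IsHermitian) (hc : Integrable c)
    (hconj : ∀ᵐ t : ℝ, star (c t) = c (-t)) {T : ℝ} (hT : 0 < T) :
    (lambShift T H A c).IsHermitian := by
  set S := Set.Ioc (-(T / 2)) (T / 2)
  have hae : ∀ᵐ p : ℝ × ℝ, star (c (p.2 - p.1)) = c (p.1 - p.2) := by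
    have h1 : ∀ᵐ p : ℝ × ℝ, star (c p.2) = c (-p.2) :=
      Measure.quasiMeasurePreserving_snd.ae hconj
    have h2 := (measurePreserving_shear (volume : Measure ℝ)).quasiMeasurePreserving.ae h1
    simp only [neg_sub] at h2
    exact h2
  have hstar : (∫ p in S ×ˢ S, lambIntegrand H A c p)ᴴ = -∫ p in S ×ˢ S, lambIntegrand H A c p := by
    have h2 : ∫ p in S ×ˢ S, lambIntegrand H A c p =
        ∫ p in S ×ˢ S, lambIntegrand H A c p.swap := by
      rw [Measure.volume_eq_prod]
      exact (setIntegral_prod_swap S S (lambIntegrand H A c)).symm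
    rw [conjTranspose_integral, h2, ← integral_neg]
    refine integral_congr_ae (ae_restrict_of_ae ?_)
    filter_upwards [hae] with p hp
    rw [lambIntegrand, lambIntegrand, Matrix.conjTranspose_smul, conjTranspose_twoPoint hH,
      ← neg_smul]
    congr 1
    have hsg : Real.sign (p.2 - p.1) = -Real.sign (p.1 - p.2) := by
      rw [← Real.sign_neg, neg_sub]
    rw [signKernel, signKernel, star_mul', hp, Prod.fst_swap, Prod.snd_swap, hsg]
    simp
  have hk : star (Complex.I / (2 * √(2 * Real.pi) * T : ℝ)) =
      -(Complex.I / (2 * √(2 * Real.pi) * T : ℝ)) := by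
    rw [Complex.star_def, map_div₀, Complex.conj_I, Complex.conj_ofReal, neg_div]
  rw [Matrix.IsHermitian, lambShift_eq hH hc hT, Matrix.conjTranspose_smul, hstar, hk, neg_smul,
    smul_neg, neg_neg]

theorem norm_lambShift_prefactor {T : ℝ} (hT : 0 < T) :
    ‖(Complex.I / (2 * √(2 * Real.pi) * T : ℝ))‖ = (2 * √(2 * Real.pi) * T)⁻¹ := by
  rw [norm_div, Complex.norm_I, Complex.norm_real, Real.norm_of_nonneg (by positivity), one_div]

theorem norm_lambShift_le (hH : H.IsHermitian) (hA : ‖∑ a, (A a)ᴴ * A a‖ ≤ 1) (hc : Integrable c)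
    (hc1 : ∫ t, ‖c t‖ ≤ √(2 * Real.pi)) {T : ℝ} (hT : 0 < T) :
    ‖lambShift T H A c‖ ≤ 1 / 2 := by
  obtain ⟨h1, h2⟩ := integrableOn_comp_sub hc (volume_Ioc_ne_top (-(T / 2)) (T / 2))
  have h3 : ‖∫ p in Set.Ioc (-(T / 2)) (T / 2) ×ˢ Set.Ioc (-(T / 2)) (T / 2),
      lambIntegrand H A c p‖ ≤ T * √(2 * Real.pi) := by
    calc _ ≤ ∫ p in Set.Ioc (-(T / 2)) (T / 2) ×ˢ Set.Ioc (-(T / 2)) (T / 2), ‖c (p.2 - p.1)‖ :=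
          norm_integral_le_of_norm_le (integrableOn_comp_sub_square hc (volume_Ioc_ne_top _ _)).norm
            (Filter.Eventually.of_forall fun p => norm_lambIntegrand_le hH hA p)
      _ ≤ ∫ p in Set.Ioc (-(T / 2)) (T / 2) ×ˢ (Set.univ : Set ℝ), ‖c (p.2 - p.1)‖ :=
          setIntegral_mono_set h1.norm (Filter.Eventually.of_forall fun p => norm_nonneg _)
            (Set.prod_mono_right (Set.subset_univ _)).eventuallyLE
      _ = T * ∫ t, ‖c t‖ := by
          rw [h2, Real.volume_real_Ioc_of_le (by linarith)]; ring
      _ ≤ _ := by gcongr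
  rw [lambShift_eq hH hc hT, norm_smul, norm_lambShift_prefactor hT]
  calc _ ≤ (2 * √(2 * Real.pi) * T)⁻¹ * (T * √(2 * Real.pi)) := by gcongr
    _ = 1 / 2 := by field_simp

theorem heis_integral {α : Type*} [MeasurableSpace α] {μ : Measure α} {F : α → Mat d}
    (hF : Integrable F μ) (H : Mat d) (h : ℝ) :
    heis H (∫ x, F x ∂μ) h = ∫ x, heis H (F x) h ∂μ := by
  have e : ∀ X : Mat d, heis H X h = sandwich (NormedSpace.exp ((Complex.I * h) • H))
      (NormedSpace.exp ((-(Complex.I * h)) • H)) X := fun X => (sandwich_apply _ _ _).symm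
  simp only [e]
  exact (ContinuousLinearMap.integral_comp_comm (ContinuousLinearMap.mulLeftRight ℂ (Mat d) _ _)
    hF).symm

theorem lambIntegrand_add (hH : H.IsHermitian) (p : ℝ × ℝ) (h : ℝ) :
    lambIntegrand H A c (p + (h, h)) = heis H (lambIntegrand H A c p) h := by
  have : signKernel c (p + (h, h)) = signKernel c p := by simp [signKernel]
  rw [lambIntegrand, lambIntegrand, this, twoPoint_add hH]
  simp only [heis, Matrix.mul_smul, Matrix.smul_mul]

/-- Shifting a square window changes the integral by at most the mass of the strips at the ends. -/
theorem norm_integral_indicator_sub_le {F : ℝ × ℝ → Mat d} (hc : Integrable c)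
    (hF : ∀ p, ‖F p‖ ≤ ‖c (p.2 - p.1)‖) {S S' J : Set ℝ} (hJm : MeasurableSet J)
    (hJ : volume J ≠ ∞) (h1 : S \ S' ⊆ J) (h2 : S' \ S ⊆ J) :
    ‖∫ p, ((S' ×ˢ S').indicator F p - (S ×ˢ S).indicator F p)‖ ≤
      2 * (volume.real J * ∫ t, ‖c t‖) := by
  obtain ⟨i1, e1⟩ := integrableOn_comp_sub hc hJ
  obtain ⟨i2, e2⟩ := integrableOn_comp_sub' hc hJ
  have m1 : MeasurableSet (J ×ˢ (Set.univ : Set ℝ)) := hJm.prod MeasurableSet.univ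
  have m2 : MeasurableSet ((Set.univ : Set ℝ) ×ˢ J) := MeasurableSet.univ.prod hJm
  set n : ℝ × ℝ → ℝ := fun p => ‖c (p.2 - p.1)‖ with hn
  have I1 : Integrable ((J ×ˢ (Set.univ : Set ℝ)).indicator n) :=
    IntegrableOn.integrable_indicator i1.norm m1
  have I2 : Integrable (((Set.univ : Set ℝ) ×ˢ J).indicator n) :=
    IntegrableOn.integrable_indicator i2.norm m2
  have hle : ∀ p, ‖(S' ×ˢ S').indicator F p - (S ×ˢ S).indicator F p‖ ≤
      (J ×ˢ (Set.univ : Set ℝ)).indicator n p + ((Set.univ : Set ℝ) ×ˢ J).indicator n p := by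
    intro p
    have hn0 : ∀ B : Set (ℝ × ℝ), 0 ≤ B.indicator n p := fun B =>
      Set.indicator_nonneg (fun _ _ => norm_nonneg _) p
    have hcase : ∀ B B' : Set ℝ, B \ B' ⊆ J → p ∈ B ×ˢ B → p ∉ B' ×ˢ B' → ‖F p‖ ≤
        (J ×ˢ (Set.univ : Set ℝ)).indicator n p + ((Set.univ : Set ℝ) ×ˢ J).indicator n p := by
      intro B B' hB hp hp'
      by_cases hx : p.1 ∈ B'
      · have hy : p.2 ∈ J := hB ⟨hp.2, fun hy => hp' ⟨hx, hy⟩⟩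
        have : p ∈ (Set.univ : Set ℝ) ×ˢ J := ⟨trivial, hy⟩
        rw [Set.indicator_of_mem this]
        linarith [hF p, hn0 (J ×ˢ (Set.univ : Set ℝ))]
      · have : p ∈ J ×ˢ (Set.univ : Set ℝ) := ⟨hB ⟨hp.1, hx⟩, trivial⟩
        rw [Set.indicator_of_mem this]
        linarith [hF p, hn0 ((Set.univ : Set ℝ) ×ˢ J)]
    by_cases hp' : p ∈ S' ×ˢ S' <;> by_cases hp : p ∈ S ×ˢ S
    · simp only [hp, hp', Set.indicator_of_mem, sub_self, norm_zero]
      exact add_nonneg (hn0 _) (hn0 _)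
    · simp only [hp, hp', Set.indicator_of_mem, Set.indicator_of_notMem, sub_zero,
        not_false_eq_true]
      exact hcase S' S h2 hp' hp
    · simp only [hp, hp', Set.indicator_of_mem, Set.indicator_of_notMem, zero_sub, norm_neg,
        not_false_eq_true]
      exact hcase S S' h1 hp hp'
    · simp only [hp, hp', Set.indicator_of_notMem, sub_self, norm_zero, not_false_eq_true]
      exact add_nonneg (hn0 _) (hn0 _)
  refine (norm_integral_le_of_norm_le (I1.add I2) (Filter.Eventually.of_forall hle)).trans
    (le_of_eq ?_)
  simp only [Pi.add_apply]
  rw [integral_add I1 I2, integral_indicator m1, integral_indicator m2, e1, e2]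
  ring

/-- Evolution by `h` translates the square by `(h, h)`. The symmetric difference lies in a vertical
and a horizontal strip of width `2|h|`, of total mass `4|h| ‖c‖₁`. -/
theorem norm_heis_lambShift_sub_le (hH : H.IsHermitian) (hA : ‖∑ a, (A a)ᴴ * A a‖ ≤ 1)
    (hc : Integrable c) (hc1 : ∫ t, ‖c t‖ ≤ √(2 * Real.pi)) {T : ℝ} (hT : 0 < T) (h : ℝ) :
    ‖heis H (lambShift T H A c) h - lambShift T H A c‖ ≤ 2 / T * |h| := by
  set F := lambIntegrand H A c with hFdef
  set S := Set.Ioc (-(T / 2)) (T / 2) with hS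
  set S' := Set.Ioc (-(T / 2) + h) (T / 2 + h) with hS'
  have mS : MeasurableSet (S ×ˢ S) := measurableSet_Ioc.prod measurableSet_Ioc
  have mS' : MeasurableSet (S' ×ˢ S') := measurableSet_Ioc.prod measurableSet_Ioc
  have iS : IntegrableOn F (S ×ˢ S) := integrableOn_lambIntegrand hH hA hc (volume_Ioc_ne_top _ _)
  have iS' : IntegrableOn F (S' ×ˢ S') := integrableOn_lambIntegrand hH hA hc (volume_Ioc_ne_top _ _)
  have hshift : heis H (∫ p in S ×ˢ S, F p) h = ∫ p in S' ×ˢ S', F p := by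
    rw [heis_integral iS, ← integral_indicator mS, ← integral_indicator mS',
      ← integral_add_right_eq_self ((S' ×ˢ S').indicator F) ((h, h) : ℝ × ℝ)]
    refine integral_congr_ae (Filter.Eventually.of_forall fun p => ?_)
    have hmem : p + (h, h) ∈ S' ×ˢ S' ↔ p ∈ S ×ˢ S := by
      simp [hS, hS', Set.mem_prod]
    change _ = (S' ×ˢ S').indicator F (p + (h, h))
    by_cases hp : p ∈ S ×ˢ S
    · rw [Set.indicator_of_mem hp, Set.indicator_of_mem (hmem.2 hp), hFdef, lambIntegrand_add hH]
    · rw [Set.indicator_of_notMem hp, Set.indicator_of_notMem (fun h' => hp (hmem.1 h'))]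
  -- The intervals swept by the two endpoints of the window; unordered, to allow both signs of `h`.
  let J : Set ℝ := Set.uIcc (-(T / 2)) (-(T / 2) + h) ∪ Set.uIcc (T / 2) (T / 2 + h)
  have hJm : MeasurableSet J := measurableSet_uIcc.union measurableSet_uIcc
  have hvol : volume J ≤ ENNReal.ofReal (2 * |h|) := by
    refine (measure_union_le _ _).trans ?_
    rw [Real.volume_interval, Real.volume_interval, ← ENNReal.ofReal_add (abs_nonneg _) (abs_nonneg _)]
    refine ENNReal.ofReal_le_ofReal (le_of_eq ?_)
    simp [two_mul]
  have hJ : volume J ≠ ∞ := ne_top_of_le_ne_top ENNReal.ofReal_ne_top hvol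
  have hJr : volume.real J ≤ 2 * |h| :=
    ENNReal.toReal_le_of_le_ofReal (by positivity) hvol
  have hs1 : S \ S' ⊆ J := by
    rintro x ⟨⟨hx1, hx2⟩, hx3⟩
    by_cases hx : -(T / 2) + h < x
    · right
      have : T / 2 + h < x := not_le.1 fun h' => hx3 ⟨hx, h'⟩
      exact Set.mem_uIcc.2 (Or.inr ⟨this.le, hx2⟩)
    · left
      exact Set.mem_uIcc.2 (Or.inl ⟨hx1.le, not_lt.1 hx⟩)
  have hs2 : S' \ S ⊆ J := by
    rintro x ⟨⟨hx1, hx2⟩, hx3⟩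
    by_cases hx : -(T / 2) < x
    · right
      have : T / 2 < x := not_le.1 fun h' => hx3 ⟨hx, h'⟩
      exact Set.mem_uIcc.2 (Or.inl ⟨this.le, hx2⟩)
    · left
      exact Set.mem_uIcc.2 (Or.inr ⟨hx1.le, not_lt.1 hx⟩)
  have hdiff : ‖(∫ p in S' ×ˢ S', F p) - ∫ p in S ×ˢ S, F p‖ ≤ 4 * |h| * √(2 * Real.pi) := by
    rw [← integral_indicator mS, ← integral_indicator mS', ← integral_sub
      (iS'.integrable_indicator mS') (iS.integrable_indicator mS)]
    refine (norm_integral_indicator_sub_le hc (fun p => norm_lambIntegrand_le hH hA p) hJm hJ hs1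
      hs2).trans ?_
    calc 2 * (volume.real J * ∫ t, ‖c t‖) ≤ 2 * (2 * |h| * √(2 * Real.pi)) := by gcongr
      _ = _ := by ring
  have hsm : ∀ (z : ℂ) (X : Mat d), heis H (z • X) h = z • heis H X h := fun z X => by
    simp only [heis, Matrix.mul_smul, Matrix.smul_mul]
  rw [lambShift_eq hH hc hT, hsm, hshift, ← smul_sub, norm_smul, norm_lambShift_prefactor hT]
  calc _ ≤ (2 * √(2 * Real.pi) * T)⁻¹ * (4 * |h| * √(2 * Real.pi)) := by gcongr
    _ = _ := by field_simp; norm_num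

theorem hasDerivAt_exp_ofReal_smul_zero (X : Mat d) :
    HasDerivAt (fun t : ℝ => NormedSpace.exp ((t : ℂ) • X)) X 0 := by
  have h := (hasDerivAt_exp_smul_const (𝔸 := Mat d) X ((0 : ℝ) : ℂ)).scomp (0 : ℝ)
    (Complex.ofRealCLM.hasDerivAt (x := (0 : ℝ)))
  simpa [Function.comp_def] using! h

theorem hasDerivAt_heis_zero (H X : Mat d) :
    HasDerivAt (heis H X) (Complex.I • (H * X - X * H)) 0 := by
  have h1 : HasDerivAt (fun t : ℝ => NormedSpace.exp ((Complex.I * t) • H)) (Complex.I • H) 0 := by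
    have h := hasDerivAt_exp_ofReal_smul_zero (Complex.I • H)
    refine h.congr_of_eventuallyEq (Filter.Eventually.of_forall fun t => ?_)
    simp only [smul_smul, mul_comm]
  have h2 : HasDerivAt (fun t : ℝ => NormedSpace.exp ((-(Complex.I * t)) • H))
      (-(Complex.I • H)) 0 := by
    have h := hasDerivAt_exp_ofReal_smul_zero (-(Complex.I • H))
    refine h.congr_of_eventuallyEq (Filter.Eventually.of_forall fun t => ?_)
    simp only [smul_neg, neg_smul, smul_smul, mul_comm]
  have h3 := (h1.mul_const X).mul h2
  refine h3.congr_deriv ?_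
  simp [sub_eq_add_neg]

/-- The Lamb shift almost commutes with the Hamiltonian. -/
theorem norm_commutator_lambShift_le (hH : H.IsHermitian) (hA : ‖∑ a, (A a)ᴴ * A a‖ ≤ 1)
    (hc : Integrable c) (hc1 : ∫ t, ‖c t‖ ≤ √(2 * Real.pi)) {T : ℝ} (hT : 0 < T) :
    ‖H * lambShift T H A c - lambShift T H A c * H‖ ≤ 2 / T := by
  -- The commutator with `H` is, up to the factor `i`, the derivative at zero of the Heisenberg
  -- evolution, so a Lipschitz constant bounds it.
  have h := (hasDerivAt_heis_zero H (lambShift T H A c)).le_of_lip' (C := 2 / T) (by positivity)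
    (Filter.Eventually.of_forall fun s => by
      have h0 : heis H (lambShift T H A c) 0 = lambShift T H A c := by
        simp [heis]
      rw [h0, sub_zero]
      exact norm_heis_lambShift_sub_le hH hA hc hc1 hT s)
  rwa [norm_smul, Complex.norm_I, one_mul] at h

end Lamb

end CGME

end

noncomputable section

namespace CGME

open MeasureTheory

/-! ### The Gibbs state in the energy basis. -/

section Gibbs

variable {d : ℕ}

/-- An orthonormal eigenbasis `V` of `H` with energies `E`, and the square roots `q` of the Gibbs
weights. -/
structure IsGibbsBasis (β : ℝ) (H V : Mat d) (E q : Fin d → ℝ) : Prop where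
  isometry : Vᴴ * V = 1
  coisometry : V * Vᴴ = 1
  hamiltonian : H = V * Matrix.diagonal (fun i => (E i : ℂ)) * Vᴴ
  sum_sq : ∑ i, q i ^ 2 = 1
  pos : ∀ i, 0 < q i
  ratio : ∀ i j, q j = Real.exp (β * (E i - E j) / 2) * q i

/-- The square root of the Gibbs state. -/
def sqrtGibbs (V : Mat d) (q : Fin d → ℝ) : Mat d :=
  V * Matrix.diagonal (fun i => (q i : ℂ)) * Vᴴ

theorem exp_smul_eq {H V : Mat d} {E : Fin d → ℝ} (h1 : Vᴴ * V = 1) (h2 : V * Vᴴ = 1)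
    (hH : H = V * Matrix.diagonal (fun i => (E i : ℂ)) * Vᴴ) (z : ℂ) :
    NormedSpace.exp (z • H) = V * Matrix.diagonal (fun i => Complex.exp (z * E i)) * Vᴴ := by
  have hV : IsUnit V := ⟨⟨V, Vᴴ, h2, h1⟩, rfl⟩
  have hinv : V⁻¹ = Vᴴ := Matrix.inv_eq_left_inv h1
  have e : z • H = V * Matrix.diagonal (fun i => z * (E i : ℂ)) * V⁻¹ := by
    have hz : Matrix.diagonal (fun i => z * (E i : ℂ)) =
        z • Matrix.diagonal (fun i => (E i : ℂ)) := by
      rw [← Matrix.diagonal_smul]; rfl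
    rw [hinv, hH, hz, Matrix.mul_smul, Matrix.smul_mul]
  rw [e, Matrix.exp_conj _ _ hV, Matrix.exp_diagonal, hinv]
  congr 3
  ext i
  rw [Pi.coe_exp, ← Complex.exp_eq_exp_ℂ]

theorem exists_isGibbsBasis [NeZero d] {H : Mat d} (hH : H.IsHermitian) (β : ℝ) :
    ∃ (V : Mat d) (E q : Fin d → ℝ), IsGibbsBasis β H V E q ∧
      gibbs β H = sqrtGibbs V q * sqrtGibbs V q := by
  obtain ⟨V, h1, h2, h3⟩ := unitary_mul_diagonal_mul hH
  set E := hH.eigenvalues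
  set Z : ℝ := ∑ i, Real.exp (-(β * E i)) with hZ
  have hZ0 : 0 < Z := Finset.sum_pos (fun i _ => Real.exp_pos _) Finset.univ_nonempty
  let q : Fin d → ℝ := fun i => Real.exp (-(β * E i) / 2) / √Z
  have hq2 : ∀ i, q i ^ 2 = Real.exp (-(β * E i)) / Z := fun i => by
    simp only [q]
    rw [div_pow, Real.sq_sqrt hZ0.le, ← Real.exp_nat_mul]
    congr 2
    push_cast; ring
  refine ⟨V, E, q, ⟨h1, h2, h3, ?_, fun i => div_pos (Real.exp_pos _) (Real.sqrt_pos.2 hZ0), fun i j => ?_⟩, ?_⟩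
  · simp only [hq2]
    rw [← Finset.sum_div, div_self hZ0.ne']
  · simp only [q]
    rw [mul_div_assoc', ← Real.exp_add]
    congr 2
    ring
  · have hexp := exp_smul_eq h1 h2 h3 (-β : ℂ)
    have htr : (NormedSpace.exp ((-β : ℂ) • H)).trace = (Z : ℂ) := by
      rw [hexp, Matrix.mul_assoc, Matrix.trace_mul_comm, Matrix.mul_assoc, h1, Matrix.mul_one,
        Matrix.trace_diagonal, hZ]
      push_cast
      exact Finset.sum_congr rfl fun i _ => by rw [neg_mul]
    rw [gibbs, htr, hexp, sqrtGibbs]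
    have e : V * Matrix.diagonal (fun i => (q i : ℂ)) * Vᴴ *
        (V * Matrix.diagonal (fun i => (q i : ℂ)) * Vᴴ) =
        V * (Matrix.diagonal (fun i => (q i : ℂ)) * (Vᴴ * V) *
          Matrix.diagonal (fun i => (q i : ℂ))) * Vᴴ := by
      simp only [Matrix.mul_assoc]
    rw [e, h1, Matrix.mul_one, Matrix.diagonal_mul_diagonal, ← Matrix.smul_mul, ← Matrix.mul_smul,
      ← Matrix.diagonal_smul]
    congr 3
    ext i
    rw [Pi.smul_apply, smul_eq_mul, ← pow_two]
    have := hq2 i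
    have h5 : ((q i : ℂ)) ^ 2 = ((Real.exp (-(β * E i)) / Z : ℝ) : ℂ) := by
      rw [← this]; push_cast; rfl
    rw [h5]
    push_cast
    rw [neg_mul, div_eq_inv_mul]

namespace IsGibbsBasis

variable {β : ℝ} {H V : Mat d} {E q : Fin d → ℝ}

theorem conjTranspose_sqrtGibbs (V : Mat d) (q : Fin d → ℝ) :
    (sqrtGibbs V q)ᴴ = sqrtGibbs V q := by
  rw [sqrtGibbs, Matrix.conjTranspose_mul, Matrix.conjTranspose_mul,
    Matrix.conjTranspose_conjTranspose, Matrix.diagonal_conjTranspose, Matrix.mul_assoc]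
  congr 3
  ext i
  simp

theorem hsSq_conj (h : IsGibbsBasis β H V E q) (M : Mat d) : hsSq (Vᴴ * M * V) = hsSq M := by
  rw [hsSq_mul_coisometry h.coisometry, hsSq_isometry_mul]
  rw [Matrix.conjTranspose_conjTranspose, h.coisometry]

theorem conj_mul_sqrtGibbs (h : IsGibbsBasis β H V E q) (M : Mat d) (j k : Fin d) :
    (Vᴴ * (M * sqrtGibbs V q) * V) j k = (Vᴴ * M * V) j k * q k := by
  have e : Vᴴ * (M * sqrtGibbs V q) * V = Vᴴ * M * V * Matrix.diagonal (fun i => (q i : ℂ)) := by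
    rw [sqrtGibbs]
    calc _ = Vᴴ * M * V * Matrix.diagonal (fun i => (q i : ℂ)) * (Vᴴ * V) := by
          simp only [Matrix.mul_assoc]
      _ = _ := by rw [h.isometry, Matrix.mul_one]
  rw [e, Matrix.mul_diagonal]

theorem conj_sqrtGibbs_mul (h : IsGibbsBasis β H V E q) (M : Mat d) (j k : Fin d) :
    (Vᴴ * (sqrtGibbs V q * M) * V) j k = q j * (Vᴴ * M * V) j k := by
  have e : Vᴴ * (sqrtGibbs V q * M) * V = Matrix.diagonal (fun i => (q i : ℂ)) * (Vᴴ * M * V) := by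
    rw [sqrtGibbs]
    calc _ = (Vᴴ * V) * Matrix.diagonal (fun i => (q i : ℂ)) * (Vᴴ * M * V) := by
          simp only [Matrix.mul_assoc]
      _ = _ := by rw [h.isometry, Matrix.one_mul]
  rw [e, Matrix.diagonal_mul]

theorem hsSq_mul_sqrtGibbs (h : IsGibbsBasis β H V E q) (M : Mat d) :
    hsSq (M * sqrtGibbs V q) = ∑ j, ∑ k, ‖(Vᴴ * M * V) j k‖ ^ 2 * q k ^ 2 := by
  rw [← h.hsSq_conj]
  unfold hsSq
  refine Finset.sum_congr rfl fun j _ => Finset.sum_congr rfl fun k _ => ?_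
  rw [h.conj_mul_sqrtGibbs, norm_mul, mul_pow, Complex.norm_real, Real.norm_eq_abs, sq_abs]

theorem hsSq_sqrtGibbs_mul (h : IsGibbsBasis β H V E q) (M : Mat d) :
    hsSq (sqrtGibbs V q * M) = ∑ j, ∑ k, ‖(Vᴴ * M * V) j k‖ ^ 2 * q j ^ 2 := by
  rw [← h.hsSq_conj]
  unfold hsSq
  refine Finset.sum_congr rfl fun j _ => Finset.sum_congr rfl fun k _ => ?_
  rw [h.conj_sqrtGibbs_mul, norm_mul, mul_pow, Complex.norm_real, Real.norm_eq_abs, sq_abs,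
    mul_comm]

theorem hsSq_sqrtGibbs (h : IsGibbsBasis β H V E q) : hsSq (sqrtGibbs V q) = 1 := by
  have : ((hsSq (sqrtGibbs V q) : ℝ) : ℂ) = 1 := by
    rw [sqrtGibbs, hsSq_mul_coisometry (by rw [Matrix.conjTranspose_conjTranspose, h.isometry]),
      hsSq_isometry_mul h.isometry, ← trace_conjTranspose_mul_self,
      Matrix.diagonal_conjTranspose, Matrix.diagonal_mul_diagonal, Matrix.trace_diagonal]
    have h2 := h.sum_sq
    have h3 : ((∑ i, q i ^ 2 : ℝ) : ℂ) = 1 := by rw [h2]; simp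
    rw [← h3]
    push_cast
    exact Finset.sum_congr rfl fun i _ => by simp [pow_two]
  exact_mod_cast this

theorem isState (h : IsGibbsBasis β H V E q) : IsState (sqrtGibbs V q * sqrtGibbs V q) := by
  have e : sqrtGibbs V q * sqrtGibbs V q = sqrtGibbs V q * (sqrtGibbs V q)ᴴ := by
    rw [conjTranspose_sqrtGibbs]
  rw [e]
  refine ⟨Matrix.posSemidef_self_mul_conjTranspose _, ?_⟩
  rw [trace_mul_conjTranspose_self, h.hsSq_sqrtGibbs, Complex.ofReal_one]

theorem conj_heis (h : IsGibbsBasis β H V E q) (A : Mat d) (t : ℝ) (j k : Fin d) :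
    (Vᴴ * heis H A t * V) j k =
      Complex.exp (Complex.I * (E j - E k : ℝ) * t) * (Vᴴ * A * V) j k := by
  have e : Vᴴ * heis H A t * V =
      Matrix.diagonal (fun i => Complex.exp (Complex.I * t * E i)) * (Vᴴ * A * V) *
        Matrix.diagonal (fun i => Complex.exp (-(Complex.I * t) * E i)) := by
    rw [heis, exp_smul_eq h.isometry h.coisometry h.hamiltonian,
      exp_smul_eq h.isometry h.coisometry h.hamiltonian]
    calc _ = (Vᴴ * V) * Matrix.diagonal (fun i => Complex.exp (Complex.I * t * E i)) *
        (Vᴴ * A * V) * Matrix.diagonal (fun i => Complex.exp (-(Complex.I * t) * E i)) *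
        (Vᴴ * V) := by simp only [Matrix.mul_assoc]
      _ = _ := by rw [h.isometry, Matrix.one_mul, Matrix.mul_one]
  rw [e, Matrix.mul_diagonal, Matrix.diagonal_mul, mul_right_comm, ← Complex.exp_add]
  congr 2
  push_cast; ring

/-- The normalized Fourier transform of the time window. -/
def windowFourier (T x : ℝ) : ℂ :=
  (((√(2 * Real.pi * T))⁻¹ : ℝ) : ℂ) * ∫ t in (-(T / 2))..(T / 2), Complex.exp (-(Complex.I * x * t))

/-- The integral is explicit and its two boundary terms give at most `2 / |x|`; at `x = 0` the left
side vanishes. -/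
theorem norm_windowFourier_sq_mul_le {T : ℝ} (hT : 0 < T) (x : ℝ) :
    ‖windowFourier T x‖ ^ 2 * x ^ 2 ≤ (2 * Real.pi * T)⁻¹ * 4 := by
  by_cases hx : x = 0
  · rw [hx]; simp; positivity
  have hx' : -(Complex.I * x) ≠ 0 := by simpa using hx
  have h1 : ∫ t in (-(T / 2))..(T / 2), Complex.exp (-(Complex.I * x * t)) =
      (Complex.exp (-(Complex.I * x) * (T / 2 : ℝ)) -
        Complex.exp (-(Complex.I * x) * (-(T / 2) : ℝ))) / (-(Complex.I * x)) := by
    rw [← integral_exp_mul_complex hx']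
    simp only [neg_mul]
  have h2 : ‖∫ t in (-(T / 2))..(T / 2), Complex.exp (-(Complex.I * x * t))‖ ≤ 2 / |x| := by
    rw [h1, norm_div, norm_neg, norm_mul, Complex.norm_I, one_mul, Complex.norm_real,
      Real.norm_eq_abs]
    gcongr
    refine (norm_sub_le _ _).trans (le_of_eq ?_)
    rw [neg_mul, neg_mul, norm_exp_neg_I_mul, norm_exp_neg_I_mul]
    norm_num
  have h3 := pow_le_pow_left₀ (norm_nonneg _) h2 2
  rw [div_pow, sq_abs, le_div_iff₀ (by positivity)] at h3
  rw [windowFourier, norm_mul, Complex.norm_real, Real.norm_eq_abs, mul_pow, sq_abs, inv_pow,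
    Real.sq_sqrt (by positivity), mul_assoc]
  gcongr
  linarith

/-- In the energy basis the transform multiplies each entry by a scalar, a broadened delta function
at the Bohr frequency `E j - E k`. -/
theorem conj_opFourier (h : IsGibbsBasis β H V E q) (T : ℝ) (A : Mat d) (ω : ℝ) (j k : Fin d) :
    (Vᴴ * opFourier T H A ω * V) j k =
      windowFourier T (ω - (E j - E k)) * (Vᴴ * A * V) j k := by
  let φ : Mat d →L[ℂ] ℂ := LinearMap.toContinuousLinearMap
    ((Matrix.entryLinearMap ℂ ℂ j k).comp ((LinearMap.mulRight ℂ V).comp (LinearMap.mulLeft ℂ Vᴴ)))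
  have hφ : ∀ M : Mat d, φ M = (Vᴴ * M * V) j k := fun M => rfl
  rw [← hφ, map_opFourier, windowFourier, mul_assoc (((√(2 * Real.pi * T))⁻¹ : ℝ) : ℂ)]
  congr 1
  rw [← intervalIntegral.integral_mul_const]
  refine intervalIntegral.integral_congr fun t _ => ?_
  simp only [hφ]
  rw [h.conj_heis, ← mul_assoc, ← Complex.exp_add]
  congr 2
  push_cast; ring

end IsGibbsBasis

end Gibbs

/-! ### Scalar estimates for detailed balance. -/

section Scalar

/-- The left side is at most `min 1 a²`, and this form keeps both regimes: quadratic vanishing at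
zero and boundedness at infinity. -/
theorem one_sub_exp_neg_sq_le {a : ℝ} (ha : 0 ≤ a) :
    (1 - Real.exp (-a)) ^ 2 ≤ 2 * a ^ 2 / (1 + a ^ 2) := by
  have h0 : 0 ≤ 1 - Real.exp (-a) := by
    have := Real.exp_le_one_iff.2 (neg_nonpos.2 ha); linarith
  have h1 : 1 - Real.exp (-a) ≤ 1 := by linarith [Real.exp_pos (-a)]
  have h2 : 1 - Real.exp (-a) ≤ a := by linarith [Real.add_one_le_exp (-a)]
  have h3 : (1 - Real.exp (-a)) ^ 2 ≤ 1 := pow_le_one₀ h0 h1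
  have h4 : (1 - Real.exp (-a)) ^ 2 ≤ a ^ 2 := pow_le_pow_left₀ h0 h2 2
  rw [le_div_iff₀ (by positivity)]
  nlinarith [mul_nonneg (sq_nonneg a) (sub_nonneg.2 h3)]

/-- Detailed balance in the form used for the Gibbs weights `x²`, `y²` of two levels whose energies
differ by `ν`. -/
theorem rate_mul_sq_le {γ : ℝ → ℝ} {β : ℝ}
    (hdb : ∀ ω, γ ω = Real.exp (-(β * ω)) * γ (-ω)) (h1 : ∀ ω, γ ω ≤ 1)
    {x y ν : ℝ} (hxy : x = Real.exp (β * ν / 2) * y) (ω : ℝ) :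
    γ ω * (x - Real.exp (β * ω / 2) * y) ^ 2 ≤ (x ^ 2 + y ^ 2) *
      (2 * (β * (ω - ν) / 2) ^ 2 / (1 + (β * (ω - ν) / 2) ^ 2)) := by
  set u := β * (ω - ν) / 2 with hu
  have hpos : 0 ≤ 2 * u ^ 2 / (1 + u ^ 2) := by positivity
  rcases le_total u 0 with hle | hle
  -- Below the Bohr frequency the difference is at most `x` in size and `γ ω ≤ 1` suffices.
  · have e : x - Real.exp (β * ω / 2) * y = x * (1 - Real.exp (-(-u))) := by
      have : Real.exp (β * ω / 2) = Real.exp (β * ν / 2) * Real.exp u := by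
        rw [← Real.exp_add]; congr 1; rw [hu]; ring
      rw [neg_neg, this, hxy]; ring
    have h2 := one_sub_exp_neg_sq_le (neg_nonneg.2 hle)
    rw [neg_sq] at h2
    rw [e, mul_pow]
    calc γ ω * (x ^ 2 * (1 - Real.exp (-(-u))) ^ 2)
        ≤ 1 * (x ^ 2 * (2 * u ^ 2 / (1 + u ^ 2))) := by
          gcongr
          exact h1 ω
      _ ≤ _ := by nlinarith [mul_nonneg (sq_nonneg y) hpos]
  -- Above it the growing factor `exp(βω)` is absorbed by detailed balance, which replaces `γ ω` by
  -- `γ (-ω) ≤ 1`.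
  · have e : (x - Real.exp (β * ω / 2) * y) ^ 2 =
        Real.exp (β * ω) * (y ^ 2 * (1 - Real.exp (-u)) ^ 2) := by
      have e1 : Real.exp (β * ν / 2) = Real.exp (β * ω / 2) * Real.exp (-u) := by
        rw [← Real.exp_add]; congr 1; rw [hu]; ring
      have e2 : Real.exp (β * ω) = Real.exp (β * ω / 2) ^ 2 := by
        rw [← Real.exp_nat_mul]; congr 1; push_cast; ring
      rw [hxy, e1, e2]; ring
    have e3 : γ ω * Real.exp (β * ω) = γ (-ω) := by
      rw [hdb ω, mul_right_comm, ← Real.exp_add]; simp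
    have h2 := one_sub_exp_neg_sq_le hle
    rw [e, ← mul_assoc, e3]
    calc γ (-ω) * (y ^ 2 * (1 - Real.exp (-u)) ^ 2)
        ≤ 1 * (y ^ 2 * (2 * u ^ 2 / (1 + u ^ 2))) := by
          gcongr
          exact h1 _
      _ ≤ _ := by nlinarith [mul_nonneg (sq_nonneg x) hpos]

theorem integrable_lorentzian {β : ℝ} (hβ : 0 < β) (ν : ℝ) :
    Integrable (fun ω : ℝ => (1 + (β * (ω - ν) / 2) ^ 2)⁻¹) ∧
      ∫ ω : ℝ, (1 + (β * (ω - ν) / 2) ^ 2)⁻¹ = 2 / β * Real.pi := by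
  have hβ2 : β / 2 ≠ 0 := by positivity
  have e : ∀ ω : ℝ, (1 + (β * (ω - ν) / 2) ^ 2)⁻¹ =
      (fun u : ℝ => (1 + (β / 2 * u) ^ 2)⁻¹) (ω - ν) := fun ω => by
    simp only; congr 3; ring
  simp only [e]
  refine ⟨(integrable_inv_one_add_sq.comp_mul_left' hβ2).comp_sub_right ν, ?_⟩
  rw [integral_sub_right_eq_self (fun u : ℝ => (1 + (β / 2 * u) ^ 2)⁻¹) ν,
    Measure.integral_comp_mul_left (fun u : ℝ => (1 + u ^ 2)⁻¹) (β / 2),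
    integral_univ_inv_one_add_sq, smul_eq_mul, abs_of_pos (by positivity), inv_div]

end Scalar

end CGME

end

noncomputable section

namespace CGME

open MeasureTheory

/-! ### Approximate detailed balance of the jump operators. -/

section DetailedBalance

variable {d : ℕ} {β T : ℝ} {γ : ℝ → ℝ} {H V : Mat d} {E q : Fin d → ℝ}

theorem continuous_hsSq : Continuous (hsSq : Mat d → ℝ) := by
  unfold hsSq
  exact continuous_finsetSum _ fun i _ => continuous_finsetSum _ fun j _ =>
    ((continuous_id.matrix_elem i j).norm.pow 2)

theorem IsRate.aestronglyMeasurable_real (hγ : IsRate γ) : AEStronglyMeasurable γ volume := by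
  simpa using hγ.aestronglyMeasurable.re

/-- The defect `Â(ω) S - exp(βω/2) S Â(ω)` of the detailed balance relation. -/
def balanceDefect (β T : ℝ) (H S A : Mat d) (ω : ℝ) : Mat d :=
  opFourier T H A ω * S - (Real.exp (β * ω / 2) : ℂ) • (S * opFourier T H A ω)

theorem continuous_balanceDefect (β T : ℝ) (H S A : Mat d) :
    Continuous (balanceDefect β T H S A) := by
  have := continuous_opFourier T H A
  unfold balanceDefect
  fun_prop

/-- The quadratic zero of the scalar estimate cancels the `1/x²` of the window transform, so a
Lorentzian of width about `1/β` remains. The constant is `4/(2πT) · β²/2`. -/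
theorem IsGibbsBasis.rate_mul_hsSq_balanceDefect_le (h : IsGibbsBasis β H V E q) (hT : 0 < T)
    (hγ : IsRate γ) (hdb : ∀ ω, γ ω = Real.exp (-(β * ω)) * γ (-ω)) (A : Mat d) (ω : ℝ) :
    γ ω * hsSq (balanceDefect β T H (sqrtGibbs V q) A ω) ≤
      ∑ j, ∑ k, (‖(Vᴴ * A * V) j k‖ ^ 2 * (q k ^ 2 + q j ^ 2) * (β ^ 2 / (Real.pi * T))) *
        (1 + (β * (ω - (E j - E k)) / 2) ^ 2)⁻¹ := by
  rw [← h.hsSq_conj, hsSq, Finset.mul_sum]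
  refine Finset.sum_le_sum fun j _ => ?_
  rw [Finset.mul_sum]
  refine Finset.sum_le_sum fun k _ => ?_
  have e1 : (Vᴴ * balanceDefect β T H (sqrtGibbs V q) A ω * V) j k =
      windowFourier T (ω - (E j - E k)) * (Vᴴ * A * V) j k *
        ((q k - Real.exp (β * ω / 2) * q j : ℝ) : ℂ) := by
    rw [balanceDefect, Matrix.mul_sub, Matrix.sub_mul, Matrix.mul_smul, Matrix.smul_mul,
      Matrix.sub_apply, Matrix.smul_apply, h.conj_mul_sqrtGibbs, h.conj_sqrtGibbs_mul,
      h.conj_opFourier, smul_eq_mul]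
    push_cast; ring
  have h1 := rate_mul_sq_le hdb hγ.le_one (h.ratio j k) ω
  have h2 := norm_windowFourier_sq_mul_le hT (ω - (E j - E k))
  set x := ω - (E j - E k)
  set w := ‖windowFourier T x‖ ^ 2
  set a := ‖(Vᴴ * A * V) j k‖ ^ 2
  have hw : 0 ≤ w := by positivity
  have ha : 0 ≤ a := by positivity
  have hD : 0 < 1 + (β * x / 2) ^ 2 := by positivity
  have e2 : ‖(Vᴴ * balanceDefect β T H (sqrtGibbs V q) A ω * V) j k‖ ^ 2 =
      w * a * (q k - Real.exp (β * ω / 2) * q j) ^ 2 := by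
    rw [e1, norm_mul, norm_mul, mul_pow, mul_pow, Complex.norm_real, Real.norm_eq_abs, sq_abs]
  rw [e2]
  calc γ ω * (w * a * (q k - Real.exp (β * ω / 2) * q j) ^ 2)
      = w * a * (γ ω * (q k - Real.exp (β * ω / 2) * q j) ^ 2) := by ring
    _ ≤ w * a * ((q k ^ 2 + q j ^ 2) * (2 * (β * x / 2) ^ 2 / (1 + (β * x / 2) ^ 2))) := by gcongr
    _ = (w * x ^ 2) * (a * (q k ^ 2 + q j ^ 2) * (β ^ 2 / 2) * (1 + (β * x / 2) ^ 2)⁻¹) := by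
        rw [div_eq_mul_inv _ (1 + (β * x / 2) ^ 2)]; ring
    _ ≤ ((2 * Real.pi * T)⁻¹ * 4) *
        (a * (q k ^ 2 + q j ^ 2) * (β ^ 2 / 2) * (1 + (β * x / 2) ^ 2)⁻¹) := by gcongr
    _ = _ := by field_simp; ring

/-- The Lorentzian integrates to `2π/β`, and `β²/(πT) · 2π/β = 2β/T`. -/
theorem IsGibbsBasis.integral_rate_mul_hsSq_balanceDefect_le (h : IsGibbsBasis β H V E q)
    (hβ : 0 < β) (hT : 0 < T) (hγ : IsRate γ)
    (hdb : ∀ ω, γ ω = Real.exp (-(β * ω)) * γ (-ω)) (A : Mat d) :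
    Integrable (fun ω => γ ω * hsSq (balanceDefect β T H (sqrtGibbs V q) A ω)) ∧
      ∫ ω, γ ω * hsSq (balanceDefect β T H (sqrtGibbs V q) A ω) ≤
        2 * (β / T) * (hsSq (A * sqrtGibbs V q) + hsSq (sqrtGibbs V q * A)) := by
  have hle := fun ω => h.rate_mul_hsSq_balanceDefect_le hT hγ hdb A ω
  have hL := fun j k => (integrable_lorentzian hβ (E j - E k)).1.const_mul
    (‖(Vᴴ * A * V) j k‖ ^ 2 * (q k ^ 2 + q j ^ 2) * (β ^ 2 / (Real.pi * T)))
  have hb := integrable_finsetSum Finset.univ fun j _ =>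
    integrable_finsetSum Finset.univ fun k _ => hL j k
  have h0 : ∀ ω, 0 ≤ γ ω * hsSq (balanceDefect β T H (sqrtGibbs V q) A ω) := fun ω =>
    mul_nonneg (hγ.nonneg ω) (hsSq_nonneg _)
  have hi : Integrable (fun ω => γ ω * hsSq (balanceDefect β T H (sqrtGibbs V q) A ω)) := by
    refine hb.mono' (hγ.aestronglyMeasurable_real.mul (continuous_hsSq.comp
      (continuous_balanceDefect β T H (sqrtGibbs V q) A)).aestronglyMeasurable)
      (Filter.Eventually.of_forall fun ω => ?_)
    rw [Real.norm_of_nonneg (h0 ω)]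
    exact hle ω
  refine ⟨hi, (integral_mono hi hb hle).trans (le_of_eq ?_)⟩
  rw [integral_finsetSum _ fun j _ => integrable_finsetSum Finset.univ fun k _ => hL j k,
    h.hsSq_mul_sqrtGibbs, h.hsSq_sqrtGibbs_mul, ← Finset.sum_add_distrib, Finset.mul_sum]
  refine Finset.sum_congr rfl fun j _ => ?_
  rw [integral_finsetSum _ fun k _ => hL j k, ← Finset.sum_add_distrib, Finset.mul_sum]
  refine Finset.sum_congr rfl fun k _ => ?_
  rw [integral_const_mul, (integrable_lorentzian hβ _).2]
  field_simp

variable {m : ℕ} {A : Fin m → Mat d} {π : Equiv.Perm (Fin m)}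

theorem sum_hsSq_sqrtGibbs_mul_eq (hπ : ∀ a, A (π a) = (A a)ᴴ) (V : Mat d) (q : Fin d → ℝ) :
    ∑ a, hsSq (sqrtGibbs V q * A a) = ∑ a, hsSq (A a * sqrtGibbs V q) := by
  rw [← Equiv.sum_comp π fun a => hsSq (A a * sqrtGibbs V q)]
  refine Finset.sum_congr rfl fun a _ => ?_
  rw [hπ, ← hsSq_conjTranspose, Matrix.conjTranspose_mul, IsGibbsBasis.conjTranspose_sqrtGibbs]

/-- Approximate detailed balance of the windowed jump operators. -/
theorem IsGibbsBasis.sum_integral_balanceDefect_le (h : IsGibbsBasis β H V E q)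
    (hβ : 0 < β) (hT : 0 < T) (hγ : IsRate γ)
    (hdb : ∀ ω, γ ω = Real.exp (-(β * ω)) * γ (-ω)) (hπ : ∀ a, A (π a) = (A a)ᴴ)
    (hA : ‖∑ a, (A a)ᴴ * A a‖ ≤ 1) :
    ∑ a, ∫ ω, γ ω * hsSq (balanceDefect β T H (sqrtGibbs V q) (A a) ω) ≤ 4 * (β / T) := by
  refine (Finset.sum_le_sum fun a _ =>
    (h.integral_rate_mul_hsSq_balanceDefect_le hβ hT hγ hdb (A a)).2).trans ?_
  rw [← Finset.mul_sum, Finset.sum_add_distrib, sum_hsSq_sqrtGibbs_mul_eq hπ]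
  have h1 := (sum_hsSq_mul_le A (sqrtGibbs V q)).trans
    (mul_le_of_le_one_left (hsSq_nonneg _) hA)
  rw [h.hsSq_sqrtGibbs] at h1
  have h2 : 0 ≤ 2 * (β / T) := by positivity
  nlinarith

/-- The window is real and symmetric conditions on the family enter through `Aᴴ`: the adjoint of a
jump at `ω` is the jump of `Aᴴ` at `-ω`. This matches gain terms with loss terms. -/
theorem conjTranspose_opFourier (hH : H.IsHermitian) (T : ℝ) (A : Mat d) (ω : ℝ) :
    (opFourier T H A ω)ᴴ = opFourier T H Aᴴ (-ω) := by
  unfold opFourier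
  rw [Matrix.conjTranspose_smul, Complex.star_def, Complex.conj_ofReal, intervalIntegral,
    Matrix.conjTranspose_sub, conjTranspose_integral, conjTranspose_integral, intervalIntegral]
  congr 2 <;>
  · refine integral_congr_ae (Filter.Eventually.of_forall fun t => ?_)
    simp only [Matrix.conjTranspose_smul, conjTranspose_heis hH, Complex.star_def,
      ← Complex.exp_conj]
    congr 2
    simp

/-- The algebraic identity behind the estimate of the dissipator on the Gibbs state. -/
theorem dissipator_mul_self_eq {K S : Mat d} (hS : Sᴴ = S) (e : ℝ) {D : Mat d}
    (hD : D = K * S - (e : ℂ) • (S * K)) :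
    dissipator K (S * S) = ((e ^ 2 : ℝ) : ℂ) • (S * (K * Kᴴ) * S) - S * (Kᴴ * K) * S +
      (D * (K * S)ᴴ + ((e : ℂ) • (S * K)) * Dᴴ) -
      (1 / 2 : ℂ) • (Kᴴ * D * S - Dᴴ * (K * S) + (S * Dᴴ * K - (K * S)ᴴ * D)) := by
  -- Substitute `K S = e S K + D` into `(K S)(K S)ᴴ`, and `e Kᴴ S = S Kᴴ - Dᴴ` into the
  -- anticommutator. The main terms keep one `S` on either side.
  have hD' : Dᴴ = S * Kᴴ - (e : ℂ) • (Kᴴ * S) := by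
    rw [hD, Matrix.conjTranspose_sub, Matrix.conjTranspose_smul, Matrix.conjTranspose_mul,
      Matrix.conjTranspose_mul, hS, Complex.star_def, Complex.conj_ofReal]
  rw [dissipator_apply, hD', hD, Matrix.conjTranspose_mul, hS]
  simp only [Matrix.sub_mul, Matrix.mul_sub, Matrix.smul_mul, Matrix.mul_smul, smul_sub, smul_add,
    smul_smul, Matrix.mul_assoc, pow_two]
  module

theorem norm_trace_mul_le_weighted {l : ℝ} (hl : 0 < l) (X Y : Mat d) :
    ‖(X * Y).trace‖ ≤ (1 / 2) * (l * hsSq X + l⁻¹ * hsSq Y) := by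
  refine (norm_trace_mul_le_sqrt X Y).trans ?_
  have h1 := Real.sq_sqrt (hsSq_nonneg X)
  have h2 := Real.sq_sqrt (hsSq_nonneg Y)
  set x := √(hsSq X)
  set y := √(hsSq Y)
  rw [← h1, ← h2]
  have h3 : 0 ≤ l⁻¹ * (l * x - y) ^ 2 := by positivity
  have h4 : l⁻¹ * (l * x - y) ^ 2 = l * x ^ 2 + l⁻¹ * y ^ 2 - 2 * (x * y) := by
    field_simp; ring
  linarith

/-- Each of the six terms has exactly one factor `D`, paired with the other factor by Cauchy–Schwarz
with weight `l`. Where `U` cannot be dropped it is moved next to `S`, so that `K` acts from the left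
and the bound on the total jump strength applies. -/
theorem norm_trace_remainder_le {U : Mat d} (hU : ‖U‖ ≤ 1) {K S : Mat d} (hS : Sᴴ = S) {l : ℝ}
    (hl : 0 < l) (D Y : Mat d) :
    ‖(U * ((D * (K * S)ᴴ + Y * Dᴴ) -
      (1 / 2 : ℂ) • (Kᴴ * D * S - Dᴴ * (K * S) + (S * Dᴴ * K - (K * S)ᴴ * D)))).trace‖ ≤
      2 * l * hsSq D + (1 / 2) * l⁻¹ * (2 * hsSq (K * S) + hsSq Y +
        (1 / 2) * (hsSq (K * (Uᴴ * S)) + hsSq (K * (U * S)))) := by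
  have hc : ∀ M : Mat d, hsSq (U * M) ≤ hsSq M := fun M =>
    (hsSq_mul_le U M).trans
      (mul_le_of_le_one_left (hsSq_nonneg _) (pow_le_one₀ (norm_nonneg _) hU))
  have hl' : 0 < l⁻¹ := inv_pos.2 hl
  have w := fun X Y : Mat d => norm_trace_mul_le_weighted hl X Y
  have t1 : ‖(U * (D * (K * S)ᴴ)).trace‖ ≤ (1 / 2) * (l * hsSq D + l⁻¹ * hsSq (K * S)) := by
    rw [← Matrix.mul_assoc]
    refine (w _ _).trans ?_
    rw [hsSq_conjTranspose]
    gcongr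
    exact hc D
  have t2 : ‖(U * (Y * Dᴴ)).trace‖ ≤ (1 / 2) * (l * hsSq D + l⁻¹ * hsSq Y) := by
    rw [← Matrix.mul_assoc, Matrix.trace_mul_comm]
    refine (w _ _).trans ?_
    rw [hsSq_conjTranspose]
    gcongr
    exact hc Y
  have t3 : ‖(U * (Kᴴ * D * S)).trace‖ ≤
      (1 / 2) * (l * hsSq D + l⁻¹ * hsSq (K * (Uᴴ * S))) := by
    have e : (U * (Kᴴ * D * S)).trace = (D * (K * (Uᴴ * S))ᴴ).trace := by
      rw [Matrix.conjTranspose_mul, Matrix.conjTranspose_mul, Matrix.conjTranspose_conjTranspose,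
        hS, Matrix.trace_mul_comm]
      simp only [Matrix.mul_assoc]
      rw [Matrix.trace_mul_comm]
      simp only [Matrix.mul_assoc]
    rw [e]
    refine (w _ _).trans (le_of_eq ?_)
    rw [hsSq_conjTranspose]
  have t4 : ‖(U * (Dᴴ * (K * S))).trace‖ ≤ (1 / 2) * (l * hsSq D + l⁻¹ * hsSq (K * S)) := by
    rw [← Matrix.mul_assoc]
    refine (w _ _).trans ?_
    gcongr
    rw [← hsSq_conjTranspose D]
    exact hc _
  have t5 : ‖(U * (S * Dᴴ * K)).trace‖ ≤
      (1 / 2) * (l * hsSq D + l⁻¹ * hsSq (K * (U * S))) := by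
    have e : (U * (S * Dᴴ * K)).trace = (Dᴴ * (K * (U * S))).trace := by
      simp only [Matrix.mul_assoc]
      rw [← Matrix.mul_assoc U S, Matrix.trace_mul_comm (U * S)]
      simp only [Matrix.mul_assoc]
    rw [e]
    refine (w _ _).trans (le_of_eq ?_)
    rw [hsSq_conjTranspose]
  have t6 : ‖(U * ((K * S)ᴴ * D)).trace‖ ≤ (1 / 2) * (l * hsSq D + l⁻¹ * hsSq (K * S)) := by
    rw [← Matrix.mul_assoc, Matrix.trace_mul_comm]
    refine (w _ _).trans ?_
    gcongr
    rw [← hsSq_conjTranspose (K * S)]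
    exact hc _
  simp only [Matrix.mul_sub, Matrix.mul_add, Matrix.mul_smul, Matrix.trace_sub, Matrix.trace_add,
    Matrix.trace_smul]
  refine (norm_sub_le _ _).trans ?_
  have h1 := norm_add_le (U * (D * (K * S)ᴴ)).trace (U * (Y * Dᴴ)).trace
  have h2 : ‖(1 / 2 : ℂ) • ((U * (Kᴴ * D * S)).trace - (U * (Dᴴ * (K * S))).trace +
      ((U * (S * Dᴴ * K)).trace - (U * ((K * S)ᴴ * D)).trace))‖ ≤
      (1 / 2) * ((‖(U * (Kᴴ * D * S)).trace‖ + ‖(U * (Dᴴ * (K * S))).trace‖) +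
        (‖(U * (S * Dᴴ * K)).trace‖ + ‖(U * ((K * S)ᴴ * D)).trace‖)) := by
    rw [norm_smul]
    have : ‖(1 / 2 : ℂ)‖ = 1 / 2 := by norm_num
    rw [this]
    gcongr
    exact (norm_add_le _ _).trans (add_le_add (norm_sub_le _ _) (norm_sub_le _ _))
  linarith

end DetailedBalance

end CGME

end

noncomputable section

namespace CGME

open MeasureTheory

/-! ### The dissipative part on the Gibbs state. -/

section DissipativeBound

variable {d m : ℕ} {β T : ℝ} {γ : ℝ → ℝ} {H V : Mat d} {E q : Fin d → ℝ} {A : Fin m → Mat d}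
  {π : Equiv.Perm (Fin m)}

theorem hsSq_smul (z : ℂ) (M : Mat d) : hsSq (z • M) = ‖z‖ ^ 2 * hsSq M := by
  unfold hsSq
  simp only [Matrix.smul_apply, norm_smul, mul_pow, Finset.mul_sum]

theorem rate_mul_exp_sq (hdb : ∀ ω, γ ω = Real.exp (-(β * ω)) * γ (-ω)) (ω : ℝ) :
    γ ω * Real.exp (β * ω / 2) ^ 2 = γ (-ω) := by
  rw [hdb ω, mul_right_comm, ← Real.exp_nat_mul, ← Real.exp_add]
  have : -(β * ω) + ((2 : ℕ) : ℝ) * (β * ω / 2) = 0 := by push_cast; ring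
  rw [this, Real.exp_zero, one_mul]

/-- The loss term of the dissipator on the state `S²`, tested against `U`. -/
def lossTerm (T : ℝ) (H : Mat d) (γ : ℝ → ℝ) (U S A : Mat d) (ω : ℝ) : ℂ :=
  (γ ω : ℂ) * (U * (S * ((opFourier T H A ω)ᴴ * opFourier T H A ω) * S)).trace

theorem integrable_lossTerm (hT : 0 < T) (hγ : IsRate γ) (H U S A : Mat d) :
    Integrable (lossTerm T H γ U S A) := by
  have h := (traceMul (S * U * S)).integrable_comp (integrable_conjTranspose_mul_opFourier hT hγ H A)
  refine h.congr (Filter.Eventually.of_forall fun ω => ?_)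
  simp only [lossTerm, map_smul, traceMul_apply, smul_eq_mul]
  congr 1
  rw [Matrix.mul_assoc, Matrix.mul_assoc S U, Matrix.trace_mul_comm S]
  simp only [Matrix.mul_assoc]

/-- What is left of the dissipator on the state `S²`, tested against `U`, after the gain and loss
terms. -/
def balanceRemainder (β T : ℝ) (H U S A : Mat d) (ω : ℝ) : ℂ :=
  (U * ((balanceDefect β T H S A ω * (opFourier T H A ω * S)ᴴ +
      ((Real.exp (β * ω / 2) : ℂ) • (S * opFourier T H A ω)) * (balanceDefect β T H S A ω)ᴴ) -
    (1 / 2 : ℂ) • ((opFourier T H A ω)ᴴ * balanceDefect β T H S A ω * S -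
      (balanceDefect β T H S A ω)ᴴ * (opFourier T H A ω * S) +
      (S * (balanceDefect β T H S A ω)ᴴ * opFourier T H A ω -
        (opFourier T H A ω * S)ᴴ * balanceDefect β T H S A ω)))).trace

/-- Since `γ ω exp(βω) = γ (-ω)`, the gain term at `ω` equals the loss term of the adjoint operator
at `-ω`. -/
theorem rate_mul_trace_dissipator (hH : H.IsHermitian)
    (hdb : ∀ ω, γ ω = Real.exp (-(β * ω)) * γ (-ω)) {S : Mat d} (hS : Sᴴ = S) (U A : Mat d)
    (ω : ℝ) :
    (γ ω : ℂ) * (U * dissipator (opFourier T H A ω) (S * S)).trace =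
      lossTerm T H γ U S Aᴴ (-ω) - lossTerm T H γ U S A ω +
        (γ ω : ℂ) * balanceRemainder β T H U S A ω := by
  have hK : (opFourier T H Aᴴ (-ω))ᴴ = opFourier T H A ω := by
    rw [← conjTranspose_opFourier hH, Matrix.conjTranspose_conjTranspose]
  have e2 : ((γ (-ω) : ℝ) : ℂ) = (γ ω : ℂ) * ((Real.exp (β * ω / 2) ^ 2 : ℝ) : ℂ) := by
    rw [← rate_mul_exp_sq hdb, Complex.ofReal_mul]
  rw [dissipator_mul_self_eq hS (Real.exp (β * ω / 2)) (D := balanceDefect β T H S A ω) rfl,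
    lossTerm, lossTerm, hK, ← conjTranspose_opFourier hH, balanceRemainder, e2]
  simp only [Matrix.mul_add, Matrix.mul_sub, Matrix.mul_smul, Matrix.trace_add, Matrix.trace_sub,
    Matrix.trace_smul, smul_eq_mul]
  ring

/-- Obtained by difference: the dissipator and both loss terms are integrable. -/
theorem integrable_rate_mul_balanceRemainder [NeZero d] (hH : H.IsHermitian) (hT : 0 < T)
    (hγ : IsRate γ) (hdb : ∀ ω, γ ω = Real.exp (-(β * ω)) * γ (-ω)) {S : Mat d} (hS : Sᴴ = S)
    (U A : Mat d) : Integrable fun ω => (γ ω : ℂ) * balanceRemainder β T H U S A ω := by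
  have h1 := (traceMul U).integrable_comp (integrable_dissipator_opFourier_apply hT hγ H A (S * S))
  refine ((h1.sub (integrable_lossTerm hT hγ H U S Aᴴ).comp_neg).add
    (integrable_lossTerm hT hγ H U S A)).congr (Filter.Eventually.of_forall fun ω => ?_)
  have := rate_mul_trace_dissipator (T := T) hH hdb hS U A ω
  simp only [Pi.add_apply, Pi.sub_apply, map_smul, traceMul_apply, smul_eq_mul]
  rw [this]
  ring

/-- After `ω ↦ -ω` the gain terms are the loss terms permuted by `π`, and they cancel in the sum
over `a`. -/
theorem trace_mul_dissGenerator [NeZero d] (hH : H.IsHermitian) (hT : 0 < T) (hγ : IsRate γ)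
    (hdb : ∀ ω, γ ω = Real.exp (-(β * ω)) * γ (-ω)) (hπ : ∀ a, A (π a) = (A a)ᴴ)
    {S : Mat d} (hS : Sᴴ = S) (U : Mat d) :
    (U * dissGenerator T H A γ (S * S)).trace =
      ∑ a, ∫ ω, (γ ω : ℂ) * balanceRemainder β T H U S (A a) ω := by
  have hl := fun B : Mat d => integrable_lossTerm hT hγ H U S B
  have hr := fun a => integrable_rate_mul_balanceRemainder hH hT hγ hdb hS U (A a)
  rw [dissGenerator_apply hT hγ, ← traceMul_apply, map_sum]
  have e : ∀ a, traceMul U (∫ ω, (γ ω : ℂ) • dissipator (opFourier T H (A a) ω) (S * S)) =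
      (∫ ω, lossTerm T H γ U S (A (π a)) ω) - (∫ ω, lossTerm T H γ U S (A a) ω) +
        ∫ ω, (γ ω : ℂ) * balanceRemainder β T H U S (A a) ω := fun a => by
    rw [← (traceMul U).integral_comp_comm
      (integrable_dissipator_opFourier_apply hT hγ H (A a) (S * S)), hπ,
      ← integral_neg_eq_self (lossTerm T H γ U S (A a)ᴴ), ← integral_sub (hl _).comp_neg (hl _)]
    refine Eq.trans ?_ (integral_add ((hl _).comp_neg.sub (hl _)) (hr a))
    refine integral_congr_ae (Filter.Eventually.of_forall fun ω => ?_)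
    simp only [map_smul, traceMul_apply, smul_eq_mul]
    exact rate_mul_trace_dissipator hH hdb hS U (A a) ω
  simp only [e]
  rw [Finset.sum_add_distrib, Finset.sum_sub_distrib,
    Equiv.sum_comp π fun a => ∫ ω, lossTerm T H γ U S (A a) ω, sub_self, zero_add]

theorem norm_rate_mul_balanceRemainder_le (hH : H.IsHermitian) (hγ : IsRate γ)
    (hdb : ∀ ω, γ ω = Real.exp (-(β * ω)) * γ (-ω)) {S U : Mat d} (hS : Sᴴ = S) (hU : ‖U‖ ≤ 1)
    {l : ℝ} (hl : 0 < l) (A : Mat d) (ω : ℝ) :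
    ‖(γ ω : ℂ) * balanceRemainder β T H U S A ω‖ ≤
      2 * l * (γ ω * hsSq (balanceDefect β T H S A ω)) +
        (1 / 2) * l⁻¹ * (2 * hsSq (opFourier T H A ω * S) + hsSq (opFourier T H Aᴴ (-ω) * S) +
          (1 / 2) * (hsSq (opFourier T H A ω * (Uᴴ * S)) + hsSq (opFourier T H A ω * (U * S)))) := by
  have h0 := hγ.nonneg ω
  have h1 := hγ.le_one ω
  rw [norm_mul, Complex.norm_real, Real.norm_of_nonneg h0]
  refine (mul_le_mul_of_nonneg_left (norm_trace_remainder_le hU hS hl _ _) h0).trans ?_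
  -- Detailed balance removes `exp(βω)`, and passing to the adjoint puts `S` on the right of a jump
  -- operator.
  have hY : γ ω * hsSq ((Real.exp (β * ω / 2) : ℂ) • (S * opFourier T H A ω)) ≤
      hsSq (opFourier T H Aᴴ (-ω) * S) := by
    rw [hsSq_smul, Complex.norm_real, Real.norm_of_nonneg (Real.exp_pos _).le, ← mul_assoc,
      rate_mul_exp_sq hdb, ← conjTranspose_opFourier hH, ← hsSq_conjTranspose (_ * S),
      Matrix.conjTranspose_mul, hS, Matrix.conjTranspose_conjTranspose]
    exact mul_le_of_le_one_left (hsSq_nonneg _) (hγ.le_one _)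
  have hc : ∀ M : Mat d, γ ω * hsSq M ≤ hsSq M := fun M => mul_le_of_le_one_left (hsSq_nonneg M) h1
  have hl' : 0 < l⁻¹ := inv_pos.2 hl
  calc _ = 2 * l * (γ ω * hsSq (balanceDefect β T H S A ω)) +
        (1 / 2) * l⁻¹ * (2 * (γ ω * hsSq (opFourier T H A ω * S)) +
          γ ω * hsSq ((Real.exp (β * ω / 2) : ℂ) • (S * opFourier T H A ω)) +
          (1 / 2) * (γ ω * hsSq (opFourier T H A ω * (Uᴴ * S)) +
            γ ω * hsSq (opFourier T H A ω * (U * S)))) := by ring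
    _ ≤ _ := by gcongr <;> exact hc _

/-- Defects contribute `2l · 4β/T`. The other factors contribute `½ l⁻¹ (2 + 1 + 1)`, because each
sum of jump norms is at most one. -/
theorem IsGibbsBasis.norm_trace_mul_dissGenerator_le [NeZero d] (h : IsGibbsBasis β H V E q)
    (hH : H.IsHermitian) (hβ : 0 < β) (hT : 0 < T) (hγ : IsRate γ)
    (hdb : ∀ ω, γ ω = Real.exp (-(β * ω)) * γ (-ω)) (hπ : ∀ a, A (π a) = (A a)ᴴ)
    (hA : ‖∑ a, (A a)ᴴ * A a‖ ≤ 1) {U : Mat d} (hU : ‖U‖ ≤ 1) {l : ℝ} (hl : 0 < l) :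
    ‖(U * dissGenerator T H A γ (sqrtGibbs V q * sqrtGibbs V q)).trace‖ ≤
      8 * l * (β / T) + 2 * l⁻¹ := by
  have hS := conjTranspose_sqrtGibbs V q
  have hS1 := h.hsSq_sqrtGibbs
  have hbal := h.sum_integral_balanceDefect_le hβ hT hγ hdb hπ hA
  have hdef := fun a => (h.integral_rate_mul_hsSq_balanceDefect_le hβ hT hγ hdb (A a)).1
  set S := sqrtGibbs V q
  have hi := fun B Z => (integrable_hsSq_opFourier_mul hT H B Z).1
  have hsum := fun Z => sum_integral_hsSq_opFourier_mul_le hT hH hA Z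
  have hcontr : ∀ W : Mat d, ‖W‖ ≤ 1 → hsSq (W * S) ≤ 1 := fun W hW =>
    (hsSq_mul_le W S).trans (by rw [hS1, mul_one]; exact pow_le_one₀ (norm_nonneg _) hW)
  have h1 := (hsum S).trans hS1.le
  have h2 := (hsum (Uᴴ * S)).trans (hcontr _ (by rwa [Matrix.l2_opNorm_conjTranspose]))
  have h3 := (hsum (U * S)).trans (hcontr _ hU)
  have h4 : ∑ a, ∫ ω, hsSq (opFourier T H (A a)ᴴ (-ω) * S) ≤ 1 := by
    refine le_trans (le_of_eq ?_) h1
    rw [← Equiv.sum_comp π fun a => ∫ ω, hsSq (opFourier T H (A a) ω * S)]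
    refine Finset.sum_congr rfl fun a _ => ?_
    rw [hπ, integral_neg_eq_self fun ω => hsSq (opFourier T H (A a)ᴴ ω * S)]
  have i1 := fun a => (hdef a).const_mul (2 * l)
  have i2 := fun a => (hi (A a) S).const_mul 2
  have i3 := fun a => (hi (A a)ᴴ S).comp_neg
  have i4 := fun a => ((hi (A a) (Uᴴ * S)).add (hi (A a) (U * S))).const_mul (1 / 2)
  have i5 := fun a => (((i2 a).add (i3 a)).add (i4 a)).const_mul (1 / 2 * l⁻¹)
  rw [trace_mul_dissGenerator hH hT hγ hdb hπ hS U]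
  calc _ ≤ ∑ a, ∫ ω, (2 * l * (γ ω * hsSq (balanceDefect β T H S (A a) ω)) +
        (1 / 2) * l⁻¹ * (2 * hsSq (opFourier T H (A a) ω * S) +
          hsSq (opFourier T H (A a)ᴴ (-ω) * S) +
          (1 / 2) * (hsSq (opFourier T H (A a) ω * (Uᴴ * S)) +
            hsSq (opFourier T H (A a) ω * (U * S))))) :=
        (norm_sum_le _ _).trans (Finset.sum_le_sum fun a _ =>
          norm_integral_le_of_norm_le ((i1 a).add (i5 a)) (Filter.Eventually.of_forall fun ω =>
            norm_rate_mul_balanceRemainder_le hH hγ hdb hS hU hl (A a) ω))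
    _ = ∑ a, (2 * l * (∫ ω, γ ω * hsSq (balanceDefect β T H S (A a) ω)) +
        (1 / 2) * l⁻¹ * (2 * (∫ ω, hsSq (opFourier T H (A a) ω * S)) +
          (∫ ω, hsSq (opFourier T H (A a)ᴴ (-ω) * S)) +
          (1 / 2) * ((∫ ω, hsSq (opFourier T H (A a) ω * (Uᴴ * S))) +
            ∫ ω, hsSq (opFourier T H (A a) ω * (U * S))))) := by
        refine Finset.sum_congr rfl fun a _ => ?_
        refine (integral_add (i1 a) (i5 a)).trans ?_
        rw [integral_const_mul]
        congr 1
        refine (integral_const_mul _ _).trans ?_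
        congr 1
        refine (integral_add ((i2 a).add (i3 a)) (i4 a)).trans ?_
        congr 1
        · refine (integral_add (i2 a) (i3 a)).trans ?_
          rw [integral_const_mul]
        · refine (integral_const_mul _ _).trans ?_
          congr 1
          exact integral_add (hi (A a) (Uᴴ * S)) (hi (A a) (U * S))
    _ = 2 * l * (∑ a, ∫ ω, γ ω * hsSq (balanceDefect β T H S (A a) ω)) +
        (1 / 2) * l⁻¹ * (2 * (∑ a, ∫ ω, hsSq (opFourier T H (A a) ω * S)) +
          (∑ a, ∫ ω, hsSq (opFourier T H (A a)ᴴ (-ω) * S)) +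
          (1 / 2) * ((∑ a, ∫ ω, hsSq (opFourier T H (A a) ω * (Uᴴ * S))) +
            ∑ a, ∫ ω, hsSq (opFourier T H (A a) ω * (U * S)))) := by
        simp only [Finset.sum_add_distrib, Finset.mul_sum, mul_add]
    _ ≤ 2 * l * (4 * (β / T)) + (1 / 2) * l⁻¹ * (2 * 1 + 1 + (1 / 2) * (1 + 1)) := by
        have hl' : 0 < l⁻¹ := inv_pos.2 hl
        gcongr
    _ = _ := by ring

/-- The dissipative part nearly annihilates the Gibbs state. -/
theorem IsGibbsBasis.traceNorm_dissGenerator_le [NeZero d] (h : IsGibbsBasis β H V E q)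
    (hH : H.IsHermitian) (hβ : 0 < β) (hT : 0 < T) (hγ : IsRate γ)
    (hdb : ∀ ω, γ ω = Real.exp (-(β * ω)) * γ (-ω)) (hπ : ∀ a, A (π a) = (A a)ᴴ)
    (hA : ‖∑ a, (A a)ᴴ * A a‖ ≤ 1) :
    traceNorm (dissGenerator T H A γ (sqrtGibbs V q * sqrtGibbs V q)) ≤ 10 * √(β / T) := by
  have hs : 0 < √(β / T) := Real.sqrt_pos.2 (by positivity)
  refine traceNorm_le_of_forall fun U hU =>
    -- The weight `l = (β/T)^(-1/2)` balances the two terms in order of magnitude: `8 + 2 = 10`.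
    (h.norm_trace_mul_dissGenerator_le hH hβ hT hγ hdb hπ hA hU (inv_pos.2 hs)).trans (le_of_eq ?_)
  have h2 := Real.mul_self_sqrt (show 0 ≤ β / T by positivity)
  set s := √(β / T)
  rw [← h2]
  field_simp
  ring

end DissipativeBound

end CGME

end

noncomputable section

namespace CGME

open MeasureTheory

/-! ### The Lamb shift on the Gibbs state. -/

section LambShiftBound

variable {d m : ℕ} {β T : ℝ} {γ : ℝ → ℝ} {H V : Mat d} {E q : Fin d → ℝ} {A : Fin m → Mat d}
  {π : Equiv.Perm (Fin m)}

/-- Convexity of the exponential gives `u x ≤ y - x ≤ u y` for either sign of `u`. -/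
theorem sq_sub_le_of_eq_exp_mul {x y u : ℝ} (hx : 0 < x) (hy : 0 < y) (h : y = Real.exp u * x) :
    (y - x) ^ 2 ≤ u ^ 2 * (x ^ 2 + y ^ 2) := by
  have h1 : y - x ≤ u * y := by
    have : x = Real.exp (-u) * y := by rw [h, ← mul_assoc, ← Real.exp_add]; simp
    nlinarith [Real.add_one_le_exp (-u)]
  have h2 : u * x ≤ y - x := by nlinarith [Real.add_one_le_exp u]
  rcases le_total 0 u with hu | hu
  · nlinarith [mul_nonneg hu hx.le, mul_nonneg hu hy.le, sq_nonneg (u * x)]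
  · nlinarith [mul_nonneg (neg_nonneg.2 hu) hx.le, mul_nonneg (neg_nonneg.2 hu) hy.le,
      sq_nonneg (u * y)]

theorem IsGibbsBasis.conj_commutator (h : IsGibbsBasis β H V E q) (M : Mat d) (j k : Fin d) :
    (Vᴴ * (H * M - M * H) * V) j k = ((E j - E k : ℝ) : ℂ) * (Vᴴ * M * V) j k := by
  have e : Vᴴ * (H * M - M * H) * V = Matrix.diagonal (fun i => (E i : ℂ)) * (Vᴴ * M * V) -
      Vᴴ * M * V * Matrix.diagonal (fun i => (E i : ℂ)) := by
    rw [h.hamiltonian]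
    calc _ = (Vᴴ * V) * Matrix.diagonal (fun i => (E i : ℂ)) * (Vᴴ * M * V) -
          Vᴴ * M * V * Matrix.diagonal (fun i => (E i : ℂ)) * (Vᴴ * V) := by
          simp only [Matrix.mul_sub, Matrix.sub_mul, Matrix.mul_assoc]
      _ = _ := by rw [h.isometry, Matrix.one_mul, Matrix.mul_one]
  rw [e, Matrix.sub_apply, Matrix.diagonal_mul, Matrix.mul_diagonal]
  push_cast
  ring

/-- The commutator with the square root of the Gibbs state is controlled by the commutator with the
Hamiltonian. -/
theorem IsGibbsBasis.hsSq_commutator_sqrtGibbs_le (h : IsGibbsBasis β H V E q) (M : Mat d) :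
    hsSq (M * sqrtGibbs V q - sqrtGibbs V q * M) ≤ β ^ 2 / 2 * ‖H * M - M * H‖ ^ 2 := by
  have e : hsSq (M * sqrtGibbs V q - sqrtGibbs V q * M) ≤ β ^ 2 / 4 *
      (hsSq ((H * M - M * H) * sqrtGibbs V q) + hsSq (sqrtGibbs V q * (H * M - M * H))) := by
    rw [h.hsSq_mul_sqrtGibbs, h.hsSq_sqrtGibbs_mul, ← h.hsSq_conj, hsSq, ← Finset.sum_add_distrib,
      Finset.mul_sum]
    refine Finset.sum_le_sum fun j _ => ?_
    rw [← Finset.sum_add_distrib, Finset.mul_sum]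
    refine Finset.sum_le_sum fun k _ => ?_
    have e1 : (Vᴴ * (M * sqrtGibbs V q - sqrtGibbs V q * M) * V) j k =
        (Vᴴ * M * V) j k * ((q k - q j : ℝ) : ℂ) := by
      rw [Matrix.mul_sub, Matrix.sub_mul, Matrix.sub_apply, h.conj_mul_sqrtGibbs,
        h.conj_sqrtGibbs_mul]
      push_cast; ring
    rw [e1, h.conj_commutator, norm_mul, norm_mul, mul_pow, mul_pow, Complex.norm_real,
      Complex.norm_real, Real.norm_eq_abs, Real.norm_eq_abs, sq_abs, sq_abs]
    have := sq_sub_le_of_eq_exp_mul (h.pos j) (h.pos k) (h.ratio j k)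
    calc _ ≤ ‖(Vᴴ * M * V) j k‖ ^ 2 * ((β * (E j - E k) / 2) ^ 2 * (q j ^ 2 + q k ^ 2)) := by gcongr
      _ = _ := by ring
  refine e.trans ?_
  have h1 := hsSq_mul_le (H * M - M * H) (sqrtGibbs V q)
  have h2 := hsSq_mul_le' (sqrtGibbs V q) (H * M - M * H)
  rw [h.hsSq_sqrtGibbs, mul_one] at h1 h2
  nlinarith [sq_nonneg β]

theorem IsGibbsBasis.traceNorm_commutator_le (h : IsGibbsBasis β H V E q) (hβ : 0 < β) (M : Mat d) :
    traceNorm (M * (sqrtGibbs V q * sqrtGibbs V q) - sqrtGibbs V q * sqrtGibbs V q * M) ≤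
      √2 * β * ‖H * M - M * H‖ := by
  have hS := conjTranspose_sqrtGibbs V q
  have hS1 := h.hsSq_sqrtGibbs
  have hD := h.hsSq_commutator_sqrtGibbs_le M
  set S := sqrtGibbs V q
  set D := M * S - S * M with hDdef
  -- Leibniz rule `[M, S²] = [M, S] S + S [M, S]`, written as products to which the Hilbert–Schmidt
  -- bound on the trace norm applies.
  have e : M * (S * S) - S * S * M = D * Sᴴ + S * (Dᴴ)ᴴ := by
    rw [hS, Matrix.conjTranspose_conjTranspose, hDdef]
    simp only [Matrix.sub_mul, Matrix.mul_sub, Matrix.mul_assoc]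
    abel
  have h1 := traceNorm_mul_conjTranspose_le D S
  have h2 := traceNorm_mul_conjTranspose_le S Dᴴ
  rw [hsSq_conjTranspose] at h2
  rw [hS1, Real.sqrt_one] at h1 h2
  have h3 : √(hsSq D) ≤ β / √2 * ‖H * M - M * H‖ := by
    refine Real.sqrt_le_iff.2 ⟨by positivity, hD.trans (le_of_eq ?_)⟩
    rw [mul_pow, div_pow, Real.sq_sqrt zero_le_two]
  rw [e]
  refine (traceNorm_add_le _ _).trans ?_
  calc _ ≤ 2 * (β / √2 * ‖H * M - M * H‖) := by linarith
    _ = √2 * √2 * (β / √2 * ‖H * M - M * H‖) := by rw [Real.mul_self_sqrt zero_le_two]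
    _ = _ := by field_simp

/-- The Lamb shift nearly annihilates the Gibbs state. -/
theorem IsGibbsBasis.traceNorm_hamiltonianPart_le (h : IsGibbsBasis β H V E q) (hβ : 0 < β)
    (hT : 0 < T) {W : Mat d} (hW : ‖W‖ ≤ 1 / 2) (hHW : ‖H * W - W * H‖ ≤ 2 / T) :
    traceNorm (hamiltonianPart W (sqrtGibbs V q * sqrtGibbs V q)) ≤ 3 * √(β / T) := by
  rw [hamiltonianPart_apply]
  refine (traceNorm_smul_le _ _).trans ?_
  rw [norm_neg, Complex.norm_I, one_mul]
  have hs : 0 < √(β / T) := Real.sqrt_pos.2 (by positivity)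
  have hs2 := Real.mul_self_sqrt (show 0 ≤ β / T by positivity)
  rcases le_total √(β / T) 1 with h1 | h1
  -- For `β ≤ T` the commutator bound is linear in `β/T`, which is at most its square root.
  · have h2 : √2 ≤ 3 / 2 := Real.sqrt_le_iff.2 ⟨by norm_num, by norm_num⟩
    calc _ ≤ √2 * β * ‖H * W - W * H‖ := h.traceNorm_commutator_le hβ W
      _ ≤ 3 / 2 * β * (2 / T) := by gcongr
      _ = 3 * (√(β / T) * √(β / T)) := by rw [hs2]; ring
      _ ≤ _ := by nlinarith
  -- For `β ≥ T` the trivial bound `2 ‖W‖ ≤ 1 ≤ √(β/T)` is enough.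
  · have hρ := h.isState.traceNorm_le_one
    set ρ := sqrtGibbs V q * sqrtGibbs V q
    have h3 : traceNorm (W * ρ - ρ * W) ≤ 1 := traceNorm_le_of_forall fun U hU => by
      rw [Matrix.mul_sub, Matrix.trace_sub]
      have hUW : ‖U * W‖ ≤ 1 / 2 := (norm_mul_le _ _).trans
        ((mul_le_of_le_one_left (norm_nonneg _) hU).trans hW)
      have hWU : ‖W * U‖ ≤ 1 / 2 := (norm_mul_le _ _).trans
        ((mul_le_of_le_one_right (norm_nonneg _) hU).trans hW)
      have t1 := norm_trace_mul_le (U * W) ρ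
      have t2 := norm_trace_mul_le (W * U) ρ
      have e2 : (U * (ρ * W)).trace = (W * U * ρ).trace := by
        rw [← Matrix.mul_assoc, Matrix.trace_mul_comm, Matrix.mul_assoc]
      rw [← Matrix.mul_assoc, e2]
      refine (norm_sub_le _ _).trans ?_
      have := traceNorm_nonneg ρ
      nlinarith
    linarith

end LambShiftBound

end CGME

end

/-! ### Assembling the estimates. -/

noncomputable section

namespace CGME

open MeasureTheory

theorem exists_mixedAt_of_mixingTime_ne_top {d : ℕ} {L : SuperOp d} (h : mixingTime L ≠ ⊤) :
    ∃ t : ℝ≥0, MixedAt L t := by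
  by_contra hne
  push Not at hne
  exact h (by simp [mixingTime, hne])

variable {d m : ℕ} {β T : ℝ} {γ : ℝ → ℝ} {c : ℝ → ℂ} {H : Mat d} {A : Fin m → Mat d}
  {π : Equiv.Perm (Fin m)}

theorem isState_gibbs [NeZero d] (hH : H.IsHermitian) (β : ℝ) : IsState (gibbs β H) := by
  obtain ⟨V, E, q, h, e⟩ := exists_isGibbsBasis hH β
  exact e ▸ h.isState

/-- The coarse-grained master equation nearly annihilates the Gibbs state. -/
theorem traceNorm_cgmeGenerator_gibbs_le [NeZero d] (hH : H.IsHermitian) (hβ : 0 < β) (hT : 0 < T)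
    (hπ : ∀ a, A (π a) = (A a)ᴴ) (hA : ‖∑ a, (A a)ᴴ * A a‖ ≤ 1) (hγ : IsRate γ)
    (hdb : ∀ ω, γ ω = Real.exp (-(β * ω)) * γ (-ω)) (hc : Integrable c)
    (hc1 : ∫ t, ‖c t‖ ≤ √(2 * Real.pi)) :
    traceNorm (cgmeGenerator T H A γ c (gibbs β H)) ≤ 13 * √(β / T) := by
  obtain ⟨V, E, q, h, e⟩ := exists_isGibbsBasis hH β
  rw [e]
  refine (traceNorm_add_le _ _).trans ?_
  have h1 := h.traceNorm_hamiltonianPart_le hβ hT (norm_lambShift_le hH hA hc hc1 hT)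
    (norm_commutator_lambShift_le hH hA hc hc1 hT)
  have h2 := h.traceNorm_dissGenerator_le hH hβ hT hγ hdb hπ hA
  exact (add_le_add h1 h2).trans (le_of_eq (by ring))

end CGME

end

theorem mainTheorem4 :
    ∃ C : ℝ≥0, ∀ (d m : ℕ) (H : CGME.Mat d) (A : Fin m → CGME.Mat d) (β T : ℝ)
      (γ : ℝ → ℝ) (c : ℝ → ℂ),
      0 < d → H.IsHermitian → 0 < β → 0 < T →
      (∃ π : Equiv.Perm (Fin m), ∀ a, A (π a) = (A a)ᴴ) →
      ‖∑ a, (A a)ᴴ * A a‖ ≤ 1 →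
      (∀ ω, γ ω = Real.exp (-(β * ω)) * γ (-ω)) →
      (∀ ω, 0 ≤ γ ω ∧ γ ω ≤ 1) →
      CGME.IsInverseFourier γ c →
      (∫ t, ‖c t‖) ≤ √(2 * Real.pi) →
      (CGME.mixingTime (CGME.cgmeGenerator T H A γ c) ≠ ⊤ →
        ∃! σ, CGME.IsFixedState (CGME.cgmeGenerator T H A γ c) σ) ∧
      ∀ σ, CGME.IsFixedState (CGME.cgmeGenerator T H A γ c) σ →
        ENNReal.ofReal (CGME.traceNorm (σ - CGME.gibbs β H)) ≤
          C * ENNReal.ofReal √(β / T) *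
            (CGME.mixingTime (CGME.cgmeGenerator T H A γ c) +
              CGME.mixingTime (CGME.dissGenerator T H A γ)) := by
  -- `26 = 2 · (10 + 3)`: the dissipative and Lamb shift bounds, doubled by the mixing argument.
  refine ⟨26, fun d m H A β T γ c hd hH hβ hT ⟨π, hπ⟩ hA hdb hγ01 hc hc1 => ?_⟩
  have : NeZero d := ⟨hd.ne'⟩
  have hγ : CGME.IsRate γ :=
    ⟨hc.aestronglyMeasurable, fun ω => (hγ01 ω).1, fun ω => (hγ01 ω).2⟩
  have hL := CGME.isLindbladian_cgmeGenerator hT hγ H A c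
    (CGME.isHermitian_lambShift hH hc.1 hc.conj_ae_eq hT)
  have hstate := CGME.isState_gibbs hH β
  refine ⟨fun hmix => ?_, fun σ hσ => ?_⟩
  · obtain ⟨t, ht⟩ := CGME.exists_mixedAt_of_mixingTime_ne_top hmix
    exact hL.existsUnique_isFixedState ht ⟨_, hstate⟩
  · have hs : 0 < √(β / T) := Real.sqrt_pos.2 (by positivity)
    refine (hL.ofReal_traceNorm_sub_le hσ hstate (by positivity)
      (CGME.traceNorm_cgmeGenerator_gibbs_le hH hβ hT hπ hA hγ hdb hc.1 hc1)).trans ?_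
    have e : ENNReal.ofReal (2 * (13 * √(β / T))) =
        ((26 : ℝ≥0) : ℝ≥0∞) * ENNReal.ofReal √(β / T) := by
      rw [← mul_assoc, ENNReal.ofReal_mul (by norm_num)]
      norm_num
    rw [e]
    gcongr
    -- The estimate holds with the mixing time of the full generator alone; the second summand only
    -- enlarges the right side.
    exact le_self_add
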